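/- Let $(M,g)$ be a smooth Riemannian 3-manifold with a Sasakian structure, i.e. a smooth vector field $\xi$ that is a Killing field of unit length and satisfies $R(X,\xi)Y=g(\xi,Y)X-g(X,Y)\xi$ for all vectors $X,Y$, where $R(X,Y)Z=\nabla_X\nabla_YZ-\nabla_Y\nabla_XZ-\nabla_{[X,Y]}Z$ is the curvature of the Levi-Civita connection. Suppose that $(M,g)$ is conformally flat, i.e. around every point there are smooth coordinates in which $g$ is a positive smooth multiple of the Euclidean metric. Then $g$ is Einstein, $\mathrm{Ric}=2g$, with scalar curvature $R=6$. Moreover, let the unit sphere $S^3\subset\mathbb{C}^2$ carry its standard Sasakian structure, namely the round metric of curvature $1$ and the Hopf field $p\mapsto ip$. Then every point of $M$ has an open neighbourhood that is mapped onto an open subset of $S^3$ by a diffeomorphism preserving the metrics and the unit Killing fields; and if $M$ is closed (compact and connected), there is a smooth surjective covering map $S^3\to M$, a local diffeomorphism, that preserves the metrics and the unit Killing fields. -/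

import Mathlib

open scoped Manifold ContDiff Matrix

noncomputable section

namespace SasakiThree

/-! ### Riemannian geometry in coordinates

`G : ℝⁿ → Matrix` is the matrix `(g_{ij})` of a Riemannian metric in a coordinate chart. -/

section Coordinates

variable {n : ℕ}

/-- The partial derivative `∂_k f` at `y`. -/
def pderiv (k : Fin n) (f : EuclideanSpace ℝ (Fin n) → ℝ) (y : EuclideanSpace ℝ (Fin n)) : ℝ :=
  fderiv ℝ f y (EuclideanSpace.single k 1)

/-- The Christoffel symbols of the Levi-Civita connection,
`Γ^k_{ij} = ½ g^{kl} (∂_i g_{jl} + ∂_j g_{il} - ∂_l g_{ij})`. -/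
def christoffel (G : EuclideanSpace ℝ (Fin n) → Matrix (Fin n) (Fin n) ℝ) (k i j : Fin n)
    (y : EuclideanSpace ℝ (Fin n)) : ℝ :=
  (1 / 2 : ℝ) * ∑ l, (G y)⁻¹ k l *
    (pderiv i (fun z ↦ G z j l) y + pderiv j (fun z ↦ G z i l) y - pderiv l (fun z ↦ G z i j) y)

/-- The components `R^l_{ijk}` of the Riemann tensor
`R(X, Y) Z = ∇_X ∇_Y Z - ∇_Y ∇_X Z - ∇_{[X, Y]} Z`, normalised by
`R(∂_i, ∂_j) ∂_k = R^l_{ijk} ∂_l`. -/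
def riemannCoeff (G : EuclideanSpace ℝ (Fin n) → Matrix (Fin n) (Fin n) ℝ) (l i j k : Fin n)
    (y : EuclideanSpace ℝ (Fin n)) : ℝ :=
  pderiv i (christoffel G l j k) y - pderiv j (christoffel G l i k) y +
    ∑ m, (christoffel G l i m y * christoffel G m j k y -
      christoffel G l j m y * christoffel G m i k y)

/-- The components of the Ricci tensor `Ric(Y, Z) = tr (X ↦ R(X, Y) Z)`. -/
def ricciCoeff (G : EuclideanSpace ℝ (Fin n) → Matrix (Fin n) (Fin n) ℝ) (j k : Fin n)
    (y : EuclideanSpace ℝ (Fin n)) : ℝ :=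
  ∑ i, riemannCoeff G i i j k y

/-- The components of the Lie derivative `L_X g` of the metric along the vector field `X`. -/
def lieDerivMetricCoeff (G : EuclideanSpace ℝ (Fin n) → Matrix (Fin n) (Fin n) ℝ)
    (X : EuclideanSpace ℝ (Fin n) → EuclideanSpace ℝ (Fin n)) (i j : Fin n)
    (y : EuclideanSpace ℝ (Fin n)) : ℝ :=
  ∑ k, (X y k * pderiv k (fun z ↦ G z i j) y + G y k j * pderiv i (fun z ↦ X z k) y +
    G y i k * pderiv j (fun z ↦ X z k) y)

end Coordinates

/-! ### Riemannian manifolds -/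

section Manifold

variable {n : ℕ} {M : Type*} [TopologicalSpace M] [ChartedSpace (EuclideanSpace ℝ (Fin n)) M]
  [IsManifold (𝓡 n) ∞ M]

/-- Smooth Riemannian metrics on the `n`-manifold `M`. -/
abbrev SmoothMetric (n : ℕ) (M : Type*) [TopologicalSpace M]
    [ChartedSpace (EuclideanSpace ℝ (Fin n)) M] [IsManifold (𝓡 n) ∞ M] :=
  Bundle.ContMDiffRiemannianMetric (𝓡 n) ∞ (EuclideanSpace ℝ (Fin n))
    (TangentSpace (𝓡 n) : M → Type _)

/-- The matrix `g(∂_i, ∂_j)` of the metric in the chart `φ`, as a function of the coordinates. -/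
def metricCoeff (g : SmoothMetric n M) (φ : OpenPartialHomeomorph M (EuclideanSpace ℝ (Fin n)))
    (y : EuclideanSpace ℝ (Fin n)) : Matrix (Fin n) (Fin n) ℝ :=
  Matrix.of fun i j ↦ g.inner (φ.symm y)
    (mfderiv (𝓡 n) (𝓡 n) φ.symm y (EuclideanSpace.single i (1 : ℝ)))
    (mfderiv (𝓡 n) (𝓡 n) φ.symm y (EuclideanSpace.single j (1 : ℝ)))

/-- The components of a vector field in the chart `φ`, as a function of the coordinates. -/
def fieldCoeff (X : ∀ x : M, TangentSpace (𝓡 n) x)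
    (φ : OpenPartialHomeomorph M (EuclideanSpace ℝ (Fin n)))
    (y : EuclideanSpace ℝ (Fin n)) : EuclideanSpace ℝ (Fin n) :=
  mvfderiv (𝓡 n) φ (φ.symm y) (X (φ.symm y))

/-- The components of a tangent vector at `x` in the preferred chart at `x`. -/
def components (x : M) (u : TangentSpace (𝓡 n) x) : EuclideanSpace ℝ (Fin n) :=
  mvfderiv (𝓡 n) (chartAt (EuclideanSpace ℝ (Fin n)) x) x u

/-- The tangent vector at `x` with given components in the preferred chart at `x`. -/
def ofComponents (x : M) (a : EuclideanSpace ℝ (Fin n)) : TangentSpace (𝓡 n) x :=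
  (mvfderiv (𝓡 n) (chartAt (EuclideanSpace ℝ (Fin n)) x) x).inverse a

/-- The matrix of the metric in the preferred chart at `x`. -/
def metricAt (g : SmoothMetric n M) (x : M) : EuclideanSpace ℝ (Fin n) → Matrix (Fin n) (Fin n) ℝ :=
  metricCoeff g (chartAt (EuclideanSpace ℝ (Fin n)) x)

/-- The Riemann curvature operator `R(u, v) w` at the point `x`. -/
def curvature (g : SmoothMetric n M) (x : M) (u v w : TangentSpace (𝓡 n) x) : TangentSpace (𝓡 n) x :=
  ofComponents x (WithLp.toLp 2 fun l ↦ ∑ i, ∑ j, ∑ k,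
    riemannCoeff (metricAt g x) l i j k (chartAt (EuclideanSpace ℝ (Fin n)) x x) *
      components x u i * components x v j * components x w k)

/-- The Ricci tensor at the point `x`. -/
def ricci (g : SmoothMetric n M) (x : M) (u v : TangentSpace (𝓡 n) x) : ℝ :=
  ∑ j, ∑ k, ricciCoeff (metricAt g x) j k (chartAt (EuclideanSpace ℝ (Fin n)) x x) *
    components x u j * components x v k

/-- The scalar curvature at the point `x`: the trace `g^{jk} R_{jk}` of the Ricci tensor. -/
def scalarCurvature (g : SmoothMetric n M) (x : M) : ℝ :=
  ∑ j, ∑ k, (metricAt g x (chartAt (EuclideanSpace ℝ (Fin n)) x x))⁻¹ j k *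
    ricciCoeff (metricAt g x) j k (chartAt (EuclideanSpace ℝ (Fin n)) x x)

/-- `X` is a Killing vector field: `L_X g = 0`. -/
def IsKilling (g : SmoothMetric n M) (X : ∀ x : M, TangentSpace (𝓡 n) x) : Prop :=
  ∀ (x : M) (i j : Fin n), lieDerivMetricCoeff (metricAt g x)
    (fieldCoeff X (chartAt (EuclideanSpace ℝ (Fin n)) x)) i j
    (chartAt (EuclideanSpace ℝ (Fin n)) x x) = 0

/-- `(M, g)` is Sasakian with (smooth) unit Killing vector field `ξ`. -/
structure IsSasakian (g : SmoothMetric n M) (ξ : ∀ x : M, TangentSpace (𝓡 n) x) : Prop where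
  contMDiff : ContMDiff (𝓡 n) (𝓡 n).tangent ∞ (fun x ↦ (⟨x, ξ x⟩ : TangentBundle (𝓡 n) M))
  unit : ∀ x, g.inner x (ξ x) (ξ x) = 1
  killing : IsKilling g ξ
  curvature_eq : ∀ (x : M) (u v : TangentSpace (𝓡 n) x),
    curvature g x u (ξ x) v = g.inner x (ξ x) v • u - g.inner x u v • ξ x

/-- `(M, g)` is (locally) conformally flat: around each point there are coordinates in which the
metric is a positive smooth multiple of the Euclidean metric. -/
def IsConformallyFlat (g : SmoothMetric n M) : Prop :=
  ∀ x : M, ∃ φ ∈ IsManifold.maximalAtlas (𝓡 n) ∞ M, x ∈ φ.source ∧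
    ∃ lam : M → ℝ, ContMDiffOn (𝓡 n) 𝓘(ℝ) ∞ lam φ.source ∧
      ∀ y ∈ φ.source, 0 < lam y ∧ ∀ u v : TangentSpace (𝓡 n) y,
        g.inner y u v = lam y * inner ℝ (mvfderiv (𝓡 n) φ y u) (mvfderiv (𝓡 n) φ y v)

end Manifold

/-! ### The standard Sasakian structure of the unit sphere `S³ ⊆ ℝ⁴ = ℂ²` -/

section Sphere

/-- The unit sphere in `ℝ⁴`. -/
abbrev S3 : Type := Metric.sphere (0 : EuclideanSpace ℝ (Fin 4)) 1

instance : Fact (Module.finrank ℝ (EuclideanSpace ℝ (Fin 4)) = 3 + 1) := ⟨by simp⟩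

/-- Multiplication by `i` on `ℝ⁴ = ℂ²`. -/
def mulI (a : EuclideanSpace ℝ (Fin 4)) : EuclideanSpace ℝ (Fin 4) :=
  !₂[-a 1, a 0, -a 3, a 2]

/-- The differential at `p` of the inclusion `S³ → ℝ⁴`. -/
def dIncl (p : S3) : TangentSpace (𝓡 3) p →L[ℝ] EuclideanSpace ℝ (Fin 4) :=
  mvfderiv (𝓡 3) ((↑) : S3 → EuclideanSpace ℝ (Fin 4)) p

/-- The round metric, induced by the Euclidean metric of `ℝ⁴`. -/
def roundMetric (p : S3) (u v : TangentSpace (𝓡 3) p) : ℝ := inner ℝ (dIncl p u) (dIncl p v)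

theorem exists_dIncl_eq_mulI (p : S3) :
    ∃ w : TangentSpace (𝓡 3) p, dIncl p w = mulI (p : EuclideanSpace ℝ (Fin 4)) := by
  have h : mulI (p : EuclideanSpace ℝ (Fin 4)) ∈
      (mvfderiv (𝓡 3) ((↑) : S3 → EuclideanSpace ℝ (Fin 4)) p).range := by
    rw [range_mvfderiv_subtypeVal, Submodule.mem_orthogonal_singleton_iff_inner_right]
    simp [mulI, PiLp.inner_apply, Fin.sum_univ_four]
    ring
  exact h

/-- The Hopf field `p ↦ i p` on `S³`, the unit Killing field of the standard Sasakian structure. -/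
def hopfField (p : S3) : TangentSpace (𝓡 3) p := (exists_dIncl_eq_mulI p).choose

theorem dIncl_hopfField (p : S3) : dIncl p (hopfField p) = mulI (p : EuclideanSpace ℝ (Fin 4)) :=
  (exists_dIncl_eq_mulI p).choose_spec

variable {M : Type*} [TopologicalSpace M] [ChartedSpace (EuclideanSpace ℝ (Fin 3)) M]
  [IsManifold (𝓡 3) ∞ M]

/-- Around every point, `(M, g, ξ)` is identified with an open piece of the standard `S³` by a
diffeomorphism that preserves the metrics and the unit Killing fields. -/
def IsLocallyStandard (g : SmoothMetric 3 M) (ξ : ∀ x : M, TangentSpace (𝓡 3) x) : Prop :=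
  ∀ x : M, ∃ Φ : OpenPartialHomeomorph M S3, x ∈ Φ.source ∧
    ContMDiffOn (𝓡 3) (𝓡 3) ∞ Φ Φ.source ∧ ContMDiffOn (𝓡 3) (𝓡 3) ∞ Φ.symm Φ.target ∧
    ∀ y ∈ Φ.source,
      (∀ u v : TangentSpace (𝓡 3) y, roundMetric (Φ y) (mfderiv (𝓡 3) (𝓡 3) Φ y u)
        (mfderiv (𝓡 3) (𝓡 3) Φ y v) = g.inner y u v) ∧
      mfderiv (𝓡 3) (𝓡 3) Φ y (ξ y) = hopfField (Φ y)

/-- `(M, g, ξ)` is covered by the standard `S³`: there is a smooth surjective covering map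
`S³ → M` that preserves the metrics and the unit Killing fields. -/
def IsCoveredByStandard (g : SmoothMetric 3 M) (ξ : ∀ x : M, TangentSpace (𝓡 3) x) : Prop :=
  ∃ π : S3 → M, IsCoveringMap π ∧ Function.Surjective π ∧
    IsLocalDiffeomorph (𝓡 3) (𝓡 3) ∞ π ∧
    ∀ p : S3,
      (∀ u v : TangentSpace (𝓡 3) p, g.inner (π p) (mfderiv (𝓡 3) (𝓡 3) π p u)
        (mfderiv (𝓡 3) (𝓡 3) π p v) = roundMetric p u v) ∧
      mfderiv (𝓡 3) (𝓡 3) π p (hopfField p) = ξ (π p)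

end Sphere

end SasakiThree

end

open scoped Manifold ContDiff Matrix

noncomputable section

namespace SasakiThree

/-! ### Coordinate tensors as index-free multilinear maps on `ℝⁿ` -/

section Tensor

variable {n : ℕ}

/-- The Euclidean space `ℝⁿ`. -/
local notation "E" n => EuclideanSpace ℝ (Fin n)

/-! In coordinates where `g = u⁻²|dy|²`, the curvature is an algebraic expression in the Hessian of
`u` and `|∇u|²` (`IsConformalNear.inner_riemannMap`). The Sasakian condition on `R(·, ξ)·` then
makes `ξ` an eigenvector of the Hessian, with eigenvalue `μ`, and makes the Hessian a multiple `α`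
of the identity on `ξ^⊥`, where `μ + α = (1 + |∇u|²)/u` (`hessian_eigen_of_sasakian`). If `μ ≠ α`,
the symmetry of the third derivatives of `u` kills the curl of `ξ` on `ξ^⊥`
(`eigenvalue_sub_mul_curl`). Geometrically, `ξ` would be a hypersurface-orthogonal unit Killing
field, hence parallel, and planes containing it would be flat, whereas the Sasakian condition gives
them curvature one. So `μ = α` (`hessian_eq_of_conformalKilling`): the Hessian is pure trace and `g`
has constant curvature one. The Ricci and scalar curvatures are traces of this.

The pure-trace equation integrates to `u = (1 + c²|y - p|²)/(2c)` (`exists_eq_of_hessian_eq`), so a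
similarity followed by inverse stereographic projection is an isometry onto a piece of `S³`. There a
Killing field is the restriction of a skew linear map `A` (`exists_skew`); unit length gives `A² =
-1` (`apply_apply_eq_neg`), and an orthogonal map conjugates `A` to multiplication by `i`
(`exists_conj_mulI`). This is the local model, `IsSasakian.exists_standardChart`.

For closed `M`, transitions between standard charts are locally restrictions of unitary maps
(`PreservesStandard.exists_eq`), so inverses of standard charts have unique continuation.
Compactness gives a uniform radius of extension, and `exists_continuation` spreads a germ over `ℝ³`,
that is, over the sphere minus a point. Two such extensions with antipodal punctures agree on the
overlap and glue to a local diffeomorphism `S³ → M`. It is a covering because `S³` is compact, and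
its image is open and closed. -/

theorem sum_smul_single (a : E n) : ∑ i, a i • EuclideanSpace.single i (1 : ℝ) = a := by
  ext k
  simp [Finset.sum_apply, Pi.single_apply]

theorem fderiv_eq_sum_pderiv (f : (E n) → ℝ) (y a : E n) :
    fderiv ℝ f y a = ∑ i, a i * pderiv i f y := by
  conv_lhs => rw [← sum_smul_single a]
  simp [pderiv]

theorem hasFDerivAt_sum_smul {V F ι : Type*} [NormedAddCommGroup V] [NormedSpace ℝ V]
    [NormedAddCommGroup F] [NormedSpace ℝ F] [Fintype ι] {f : ι → ι → V → ℝ} {y : V}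
    (hf : ∀ i j, DifferentiableAt ℝ (f i j) y) (L : ι → ι → F) :
    HasFDerivAt (fun z ↦ ∑ i, ∑ j, f i j z • L i j)
      (∑ i, ∑ j, (fderiv ℝ (f i j) y).smulRight (L i j)) y :=
  HasFDerivAt.fun_sum fun i _ ↦ HasFDerivAt.fun_sum fun j _ ↦
    (hf i j).hasFDerivAt.smul_const (L i j)

/-- The bilinear form with matrix `G y`. -/
def metricForm (G : (E n) → Matrix (Fin n) (Fin n) ℝ) (y : E n) : (E n) →L[ℝ] (E n) →L[ℝ] ℝ :=
  ∑ i, ∑ j, G y i j • (EuclideanSpace.proj i : (E n) →L[ℝ] ℝ).smulRight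
    (EuclideanSpace.proj j : (E n) →L[ℝ] ℝ)

theorem metricForm_apply (G : (E n) → Matrix (Fin n) (Fin n) ℝ) (y a b : E n) :
    metricForm G y a b = ∑ i, ∑ j, G y i j * (a i * b j) := by
  simp [metricForm]

theorem metricForm_single (G : (E n) → Matrix (Fin n) (Fin n) ℝ) (y : E n) (i j : Fin n) :
    metricForm G y (EuclideanSpace.single i 1) (EuclideanSpace.single j 1) = G y i j := by
  simp [metricForm_apply]

theorem hasFDerivAt_metricForm {G : (E n) → Matrix (Fin n) (Fin n) ℝ} {y : E n}
    (hG : ∀ i j, DifferentiableAt ℝ (fun z ↦ G z i j) y) :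
    HasFDerivAt (metricForm G) (∑ i, ∑ j, (fderiv ℝ (fun z ↦ G z i j) y).smulRight
      ((EuclideanSpace.proj i : (E n) →L[ℝ] ℝ).smulRight
        (EuclideanSpace.proj j : (E n) →L[ℝ] ℝ))) y := by
  exact hasFDerivAt_sum_smul (f := fun i j z ↦ G z i j) hG fun i j ↦
    (EuclideanSpace.proj i : (E n) →L[ℝ] ℝ).smulRight (EuclideanSpace.proj j : (E n) →L[ℝ] ℝ)

theorem fderiv_metricForm_apply {G : (E n) → Matrix (Fin n) (Fin n) ℝ} {y : E n}
    (hG : ∀ i j, DifferentiableAt ℝ (fun z ↦ G z i j) y) (a b c : E n) :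
    fderiv ℝ (metricForm G) y a b c = ∑ i, ∑ j, fderiv ℝ (fun z ↦ G z i j) y a * (b i * c j) := by
  rw [(hasFDerivAt_metricForm hG).fderiv]
  simp

/-- The Christoffel symbols as a bilinear map: `∇_a b` for constant vector fields. -/
def christoffelMap (G : (E n) → Matrix (Fin n) (Fin n) ℝ) (y : E n) :
    (E n) →L[ℝ] (E n) →L[ℝ] (E n) :=
  ∑ k, ∑ i, ∑ j, christoffel G k i j y • (EuclideanSpace.proj i : (E n) →L[ℝ] ℝ).smulRight
    ((EuclideanSpace.proj j : (E n) →L[ℝ] ℝ).smulRight (EuclideanSpace.single k (1 : ℝ)))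

theorem christoffelMap_apply (G : (E n) → Matrix (Fin n) (Fin n) ℝ) (y a b : E n) (k : Fin n) :
    christoffelMap G y a b k = ∑ i, ∑ j, christoffel G k i j y * (a i * b j) := by
  simp [christoffelMap, Finset.sum_apply, Pi.single_apply]

theorem hasFDerivAt_christoffelMap {G : (E n) → Matrix (Fin n) (Fin n) ℝ} {y : E n}
    (hG : ∀ k i j, DifferentiableAt ℝ (christoffel G k i j) y) :
    HasFDerivAt (christoffelMap G) (∑ k, ∑ i, ∑ j, (fderiv ℝ (christoffel G k i j) y).smulRight
      ((EuclideanSpace.proj i : (E n) →L[ℝ] ℝ).smulRight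
        ((EuclideanSpace.proj j : (E n) →L[ℝ] ℝ).smulRight
          (EuclideanSpace.single k (1 : ℝ))))) y :=
  HasFDerivAt.fun_sum fun k _ ↦ hasFDerivAt_sum_smul (f := christoffel G k) (hG k) fun i j ↦
    (EuclideanSpace.proj i : (E n) →L[ℝ] ℝ).smulRight
        ((EuclideanSpace.proj j : (E n) →L[ℝ] ℝ).smulRight (EuclideanSpace.single k (1 : ℝ)))

theorem fderiv_christoffelMap_apply {G : (E n) → Matrix (Fin n) (Fin n) ℝ} {y : E n}
    (hG : ∀ k i j, DifferentiableAt ℝ (christoffel G k i j) y) (a b c : E n) (k : Fin n) :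
    fderiv ℝ (christoffelMap G) y a b c k =
      ∑ i, ∑ j, fderiv ℝ (christoffel G k i j) y a * (b i * c j) := by
  rw [(hasFDerivAt_christoffelMap hG).fderiv]
  simp [Finset.sum_apply, Pi.single_apply]

theorem differentiableAt_christoffelMap {G : (E n) → Matrix (Fin n) (Fin n) ℝ} {y : E n}
    (hG : ∀ k i j, DifferentiableAt ℝ (christoffel G k i j) y) :
    DifferentiableAt ℝ (christoffelMap G) y :=
  (hasFDerivAt_christoffelMap hG).differentiableAt

/-- Lowering the upper index cancels the inverse matrix in `christoffel`; this is the index form of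
the Koszul formula. -/
theorem sum_mul_christoffel {G : (E n) → Matrix (Fin n) (Fin n) ℝ} {y : E n}
    (hdet : IsUnit (G y).det) (c i j : Fin n) :
    ∑ k, G y c k * christoffel G k i j y = (1 / 2 : ℝ) * (pderiv i (fun z ↦ G z j c) y +
      pderiv j (fun z ↦ G z i c) y - pderiv c (fun z ↦ G z i j) y) := by
  have h : ∀ l, ∑ k, G y c k * (G y)⁻¹ k l = if c = l then 1 else 0 := fun l ↦ by
    have := congrFun (congrFun (Matrix.mul_nonsing_inv (G y) hdet) c) l
    rwa [Matrix.mul_apply, Matrix.one_apply] at this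
  simp only [christoffel, Finset.mul_sum]
  rw [Finset.sum_comm]
  have : ∀ l, ∑ k, G y c k * (1 / 2 * ((G y)⁻¹ k l * (pderiv i (fun z ↦ G z j l) y +
      pderiv j (fun z ↦ G z i l) y - pderiv l (fun z ↦ G z i j) y))) =
      (∑ k, G y c k * (G y)⁻¹ k l) * (1 / 2 * (pderiv i (fun z ↦ G z j l) y +
      pderiv j (fun z ↦ G z i l) y - pderiv l (fun z ↦ G z i j) y)) := fun l ↦ by
    rw [Finset.sum_mul]
    exact Finset.sum_congr rfl fun k _ ↦ by ring
  rw [Finset.sum_congr rfl fun l _ ↦ this l]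
  simp [h]

/-- The Koszul formula. -/
theorem metricForm_christoffelMap {G : (E n) → Matrix (Fin n) (Fin n) ℝ} {y : E n}
    (hdet : IsUnit (G y).det) (hG : ∀ i j, DifferentiableAt ℝ (fun z ↦ G z i j) y) (a b c : E n) :
    metricForm G y c (christoffelMap G y a b) = (1 / 2 : ℝ) *
      (fderiv ℝ (metricForm G) y a b c + fderiv ℝ (metricForm G) y b a c -
        fderiv ℝ (metricForm G) y c a b) := by
  have h1 : metricForm G y c (christoffelMap G y a b) =
      ∑ i, ∑ p, ∑ q, (∑ k, G y i k * christoffel G k p q y) * (c i * (a p * b q)) := by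
    rw [metricForm_apply]
    refine Finset.sum_congr rfl fun i _ ↦ ?_
    simp only [christoffelMap_apply, Finset.mul_sum, Finset.sum_mul]
    rw [Finset.sum_comm]
    refine Finset.sum_congr rfl fun p _ ↦ ?_
    rw [Finset.sum_comm]
    exact Finset.sum_congr rfl fun q _ ↦ Finset.sum_congr rfl fun k _ ↦ by ring
  have h2 : fderiv ℝ (metricForm G) y a b c =
      ∑ i, ∑ p, ∑ q, pderiv p (fun z ↦ G z q i) y * (c i * (a p * b q)) := by
    simp only [fderiv_metricForm_apply hG, fderiv_eq_sum_pderiv, Finset.sum_mul]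
    rw [Finset.sum_comm]
    refine Finset.sum_congr rfl fun i _ ↦ ?_
    rw [Finset.sum_comm]
    exact Finset.sum_congr rfl fun q _ ↦ Finset.sum_congr rfl fun k _ ↦ by ring
  have h3 : fderiv ℝ (metricForm G) y b a c =
      ∑ i, ∑ p, ∑ q, pderiv q (fun z ↦ G z p i) y * (c i * (a p * b q)) := by
    simp only [fderiv_metricForm_apply hG, fderiv_eq_sum_pderiv, Finset.sum_mul]
    rw [Finset.sum_comm]
    refine Finset.sum_congr rfl fun i _ ↦ ?_
    exact Finset.sum_congr rfl fun q _ ↦ Finset.sum_congr rfl fun k _ ↦ by ring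
  have h4 : fderiv ℝ (metricForm G) y c a b =
      ∑ i, ∑ p, ∑ q, pderiv i (fun z ↦ G z p q) y * (c i * (a p * b q)) := by
    simp only [fderiv_metricForm_apply hG, fderiv_eq_sum_pderiv, Finset.sum_mul]
    conv_rhs => rw [Finset.sum_comm]
    refine Finset.sum_congr rfl fun p _ ↦ ?_
    conv_rhs => rw [Finset.sum_comm]
    exact Finset.sum_congr rfl fun q _ ↦ Finset.sum_congr rfl fun k _ ↦ by ring
  rw [h1, h2, h3, h4]
  simp only [sum_mul_christoffel hdet, ← Finset.sum_add_distrib, ← Finset.sum_sub_distrib,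
    Finset.mul_sum]
  exact Finset.sum_congr rfl fun i _ ↦ Finset.sum_congr rfl fun q _ ↦
    Finset.sum_congr rfl fun k _ ↦ by ring

/-- The Riemann tensor `R(a, b) c` in coordinates. -/
def riemannMap (G : (E n) → Matrix (Fin n) (Fin n) ℝ) (y a b c : E n) : E n :=
  WithLp.toLp 2 fun l ↦ ∑ i, ∑ j, ∑ k, riemannCoeff G l i j k y * a i * b j * c k

/-- This index-free form, `DΓ` antisymmetrised plus the commutator of `Γ`, is what makes changes of
variables and conformal computations possible without sums. -/
theorem riemannMap_eq {G : (E n) → Matrix (Fin n) (Fin n) ℝ} {y : E n}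
    (hG : ∀ k i j, DifferentiableAt ℝ (christoffel G k i j) y) (a b c : E n) :
    riemannMap G y a b c = fderiv ℝ (christoffelMap G) y a b c -
      fderiv ℝ (christoffelMap G) y b a c +
      (christoffelMap G y a (christoffelMap G y b c) -
        christoffelMap G y b (christoffelMap G y a c)) := by
  ext l
  have h1 : fderiv ℝ (christoffelMap G) y a b c l =
      ∑ i, ∑ j, ∑ k, pderiv i (christoffel G l j k) y * (a i * (b j * c k)) := by
    simp only [fderiv_christoffelMap_apply hG, fderiv_eq_sum_pderiv, Finset.sum_mul]
    conv_rhs => rw [Finset.sum_comm]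
    refine Finset.sum_congr rfl fun i _ ↦ ?_
    rw [Finset.sum_comm]
    exact Finset.sum_congr rfl fun q _ ↦ Finset.sum_congr rfl fun k _ ↦ by ring
  have h2 : fderiv ℝ (christoffelMap G) y b a c l =
      ∑ i, ∑ j, ∑ k, pderiv j (christoffel G l i k) y * (a i * (b j * c k)) := by
    simp only [fderiv_christoffelMap_apply hG, fderiv_eq_sum_pderiv, Finset.sum_mul]
    refine Finset.sum_congr rfl fun i _ ↦ ?_
    rw [Finset.sum_comm]
    exact Finset.sum_congr rfl fun q _ ↦ Finset.sum_congr rfl fun k _ ↦ by ring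
  have h3 : ∀ a b, christoffelMap G y a (christoffelMap G y b c) l =
      ∑ i, ∑ j, ∑ k, ∑ m, christoffel G l i m y * christoffel G m j k y *
        (a i * (b j * c k)) := by
    intro a b
    simp only [christoffelMap_apply, Finset.mul_sum]
    refine Finset.sum_congr rfl fun i _ ↦ ?_
    rw [Finset.sum_comm]
    refine Finset.sum_congr rfl fun j _ ↦ ?_
    rw [Finset.sum_comm]
    exact Finset.sum_congr rfl fun q _ ↦ Finset.sum_congr rfl fun k _ ↦ by ring
  have h4 : christoffelMap G y b (christoffelMap G y a c) l =
      ∑ i, ∑ j, ∑ k, ∑ m, christoffel G l j m y * christoffel G m i k y *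
        (a i * (b j * c k)) := by
    rw [h3, Finset.sum_comm]
    exact Finset.sum_congr rfl fun q _ ↦ Finset.sum_congr rfl fun k _ ↦
      Finset.sum_congr rfl fun q _ ↦ Finset.sum_congr rfl fun k _ ↦ by ring
  simp only [PiLp.add_apply, PiLp.sub_apply]
  rw [h1, h2, h3, h4]
  simp only [riemannMap, riemannCoeff, ← Finset.sum_add_distrib, ← Finset.sum_sub_distrib]
  refine Finset.sum_congr rfl fun i _ ↦ Finset.sum_congr rfl fun j _ ↦
    Finset.sum_congr rfl fun k _ ↦ ?_
  simp only [← sub_mul, ← Finset.sum_mul]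
  ring

theorem lieDerivMetricCoeff_eq {G : (E n) → Matrix (Fin n) (Fin n) ℝ} {X : (E n) → (E n)} {y : E n}
    (hG : ∀ i j, DifferentiableAt ℝ (fun z ↦ G z i j) y) (hX : DifferentiableAt ℝ X y)
    (i j : Fin n) :
    lieDerivMetricCoeff G X i j y =
      fderiv ℝ (metricForm G) y (X y) (EuclideanSpace.single i 1) (EuclideanSpace.single j 1) +
      metricForm G y (fderiv ℝ X y (EuclideanSpace.single i 1)) (EuclideanSpace.single j 1) +
      metricForm G y (EuclideanSpace.single i 1) (fderiv ℝ X y (EuclideanSpace.single j 1)) := by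
  have h : ∀ k i, pderiv i (fun z ↦ X z k) y = fderiv ℝ X y (EuclideanSpace.single i 1) k := by
    intro k i
    have := ((EuclideanSpace.proj k : (E n) →L[ℝ] ℝ).hasFDerivAt.comp y hX.hasFDerivAt).fderiv
    rw [pderiv]
    change fderiv ℝ (⇑(EuclideanSpace.proj k : (E n) →L[ℝ] ℝ) ∘ X) y _ = _
    rw [this]
    rfl
  simp only [lieDerivMetricCoeff, Finset.sum_add_distrib, metricForm_apply,
    fderiv_metricForm_apply hG, fderiv_eq_sum_pderiv, h]
  simp

end Tensor

/-! ### Product rules and smoothness of inverse matrices -/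

section Calculus

open Filter Topology

theorem hasFDerivAt_clm_apply₂ {V F F' W : Type*} [NormedAddCommGroup V] [NormedSpace ℝ V]
    [NormedAddCommGroup F] [NormedSpace ℝ F] [NormedAddCommGroup F'] [NormedSpace ℝ F']
    [NormedAddCommGroup W] [NormedSpace ℝ W]
    {B : V → F →L[ℝ] F' →L[ℝ] W} {p : V → F} {q : V → F'} {z : V}
    (hB : DifferentiableAt ℝ B z) (hp : DifferentiableAt ℝ p z) (hq : DifferentiableAt ℝ q z) :
    DifferentiableAt ℝ (fun y ↦ B y (p y) (q y)) z ∧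
    ∀ c, fderiv ℝ (fun y ↦ B y (p y) (q y)) z c =
      fderiv ℝ B z c (p z) (q z) + B z (fderiv ℝ p z c) (q z) + B z (p z) (fderiv ℝ q z c) := by
  have h := (hB.hasFDerivAt.clm_apply hp.hasFDerivAt).clm_apply hq.hasFDerivAt
  refine ⟨h.differentiableAt, fun c ↦ ?_⟩
  rw [h.fderiv]
  simp
  abel

theorem differentiableAt_comp_and_fderiv {U V W : Type*} [NormedAddCommGroup U] [NormedSpace ℝ U]
    [NormedAddCommGroup V] [NormedSpace ℝ V] [NormedAddCommGroup W] [NormedSpace ℝ W]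
    (B : V → W) {κ : U → V} {z : U}
    (hB : DifferentiableAt ℝ B (κ z)) (hκ : DifferentiableAt ℝ κ z) :
    DifferentiableAt ℝ (fun y ↦ B (κ y)) z ∧
      fderiv ℝ (fun y ↦ B (κ y)) z = (fderiv ℝ B (κ z)).comp (fderiv ℝ κ z) :=
  ⟨hB.comp z hκ, fderiv_comp z hB hκ⟩

theorem fderiv_clm_apply' {V F W : Type*} [NormedAddCommGroup V] [NormedSpace ℝ V]
    [NormedAddCommGroup F] [NormedSpace ℝ F]
    [NormedAddCommGroup W] [NormedSpace ℝ W]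
    {B : V → F →L[ℝ] W} {p : V → F} {z : V}
    (hB : DifferentiableAt ℝ B z) (hp : DifferentiableAt ℝ p z) (c : V) :
    fderiv ℝ (fun y ↦ B y (p y)) z c = fderiv ℝ B z c (p z) + B z (fderiv ℝ p z c) := by
  rw [(hB.hasFDerivAt.clm_apply hp.hasFDerivAt).fderiv]
  simp
  abel

theorem contDiffAt_fderiv {V W : Type*} [NormedAddCommGroup V] [NormedSpace ℝ V]
    [NormedAddCommGroup W] [NormedSpace ℝ W] {f : V → W} {z : V} (hf : ContDiffAt ℝ ∞ f z) :
    ContDiffAt ℝ ∞ (fderiv ℝ f) z :=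
  hf.fderiv_right (m := ∞) (by simp)

theorem fderiv_fderiv_symm {V W : Type*} [NormedAddCommGroup V] [NormedSpace ℝ V]
    [NormedAddCommGroup W] [NormedSpace ℝ W] {f : V → W} {z : V} (hf : ContDiffAt ℝ ∞ f z)
    (a b : V) : fderiv ℝ (fderiv ℝ f) z a b = fderiv ℝ (fderiv ℝ f) z b a :=
  hf.isSymmSndFDerivAt (by simpa using ENat.LEInfty.out) a b

theorem contDiffAt_matrix_det {V ι : Type*} [NormedAddCommGroup V] [NormedSpace ℝ V] [Fintype ι]
    [DecidableEq ι] {A : V → Matrix ι ι ℝ} {z : V} {m : WithTop ℕ∞}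
    (hA : ∀ i j, ContDiffAt ℝ m (fun y ↦ A y i j) z) : ContDiffAt ℝ m (fun y ↦ (A y).det) z := by
  simp only [Matrix.det_apply]
  exact ContDiffAt.sum fun σ _ ↦ (contDiffAt_prod fun i _ ↦ hA _ _).const_smul _

theorem contDiffAt_matrix_inv {V ι : Type*} [NormedAddCommGroup V] [NormedSpace ℝ V] [Fintype ι]
    [DecidableEq ι] {A : V → Matrix ι ι ℝ} {z : V} {m : WithTop ℕ∞}
    (hA : ∀ i j, ContDiffAt ℝ m (fun y ↦ A y i j) z) (hdet : IsUnit (A z).det) (i j : ι) :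
    ContDiffAt ℝ m (fun y ↦ (A y)⁻¹ i j) z := by
  simp only [Matrix.inv_def, Matrix.smul_apply, Ring.inverse_eq_inv', Matrix.adjugate_apply,
    smul_eq_mul]
  refine ((contDiffAt_matrix_det hA).inv hdet.ne_zero).mul (contDiffAt_matrix_det fun k l ↦ ?_)
  by_cases hk : k = j
  · subst hk
    simpa using contDiffAt_const
  · simpa [Matrix.updateRow_ne hk] using hA k l

end Calculus

/-! ### Tensoriality of curvature and Lie derivative under coordinate changes -/

section Transformation

variable {n : ℕ}

local notation "E" n => EuclideanSpace ℝ (Fin n)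

open Filter Topology

/-- The matrix function `G` is smooth, symmetric and nondegenerate near `y`. -/
structure IsMetricNear (G : (E n) → Matrix (Fin n) (Fin n) ℝ) (y : E n) : Prop where
  smooth : ∀ᶠ z in 𝓝 y, ∀ i j, ContDiffAt ℝ ∞ (fun w ↦ G w i j) z
  symm : ∀ᶠ z in 𝓝 y, ∀ i j, G z i j = G z j i
  isUnit_det : ∀ᶠ z in 𝓝 y, IsUnit (G z).det

/-- `H` is the pullback of the metric `G` by the local diffeomorphism `κ` near `y`. -/
structure IsPullbackNear (H G : (E n) → Matrix (Fin n) (Fin n) ℝ) (κ : (E n) → (E n)) (y : E n) :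
    Prop where
  smooth : ∀ᶠ z in 𝓝 y, ContDiffAt ℝ ∞ κ z
  surjective : ∀ᶠ z in 𝓝 y, Function.Surjective (fderiv ℝ κ z)
  eq : ∀ᶠ z in 𝓝 y, ∀ a b, metricForm H z a b =
    metricForm G (κ z) (fderiv ℝ κ z a) (fderiv ℝ κ z b)

variable {G H : (E n) → Matrix (Fin n) (Fin n) ℝ} {κ : (E n) → (E n)} {y : E n}

theorem IsMetricNear.eventually (hG : IsMetricNear G y) : ∀ᶠ z in 𝓝 y, IsMetricNear G z := by
  filter_upwards [hG.smooth.eventually_nhds, hG.symm.eventually_nhds,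
    hG.isUnit_det.eventually_nhds] with z h1 h2 h3
  exact ⟨h1, h2, h3⟩

theorem IsPullbackNear.eventually (hG : IsPullbackNear H G κ y) :
    ∀ᶠ z in 𝓝 y, IsPullbackNear H G κ z := by
  filter_upwards [hG.smooth.eventually_nhds, hG.surjective.eventually_nhds,
    hG.eq.eventually_nhds] with z h1 h2 h3
  exact ⟨h1, h2, h3⟩

theorem contDiffAt_pderiv {f : (E n) → ℝ} (hf : ContDiffAt ℝ ∞ f y) (k : Fin n) :
    ContDiffAt ℝ ∞ (pderiv k f) y :=
  (contDiffAt_fderiv hf).clm_apply contDiffAt_const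

theorem IsMetricNear.differentiableAt (hG : IsMetricNear G y) (i j : Fin n) :
    DifferentiableAt ℝ (fun w ↦ G w i j) y :=
  (hG.smooth.self_of_nhds i j).differentiableAt (by simp)

theorem IsMetricNear.differentiableAt_christoffel (hG : IsMetricNear G y) (k i j : Fin n) :
    DifferentiableAt ℝ (christoffel G k i j) y := by
  have h := hG.smooth.self_of_nhds
  refine ContDiffAt.differentiableAt (n := ∞) ?_ (by simp)
  refine contDiffAt_const.mul (ContDiffAt.sum fun l _ ↦ ?_)
  exact (contDiffAt_matrix_inv h hG.isUnit_det.self_of_nhds k l).mul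
    (((contDiffAt_pderiv (h j l) i).add (contDiffAt_pderiv (h i l) j)).sub
      (contDiffAt_pderiv (h i j) l))

theorem IsMetricNear.metricForm_symm (hG : IsMetricNear G y) (a b : E n) :
    metricForm G y a b = metricForm G y b a := by
  rw [metricForm_apply, metricForm_apply, Finset.sum_comm]
  refine Finset.sum_congr rfl fun i _ ↦ Finset.sum_congr rfl fun j _ ↦ ?_
  rw [hG.symm.self_of_nhds]
  ring

theorem metricForm_nondegenerate (hdet : IsUnit (G y).det) {v w : E n}
    (h : ∀ a, metricForm G y a v = metricForm G y a w) : v = w := by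
  have key : ∀ i, (G y *ᵥ v) i = (G y *ᵥ w) i := fun i ↦ by
    have := h (EuclideanSpace.single i 1)
    simpa [metricForm_apply, Matrix.mulVec, dotProduct, Pi.single_apply] using this
  have := (Matrix.mulVec_injective_iff_isUnit.2 ((Matrix.isUnit_iff_isUnit_det _).2 hdet))
    (funext key)
  ext i
  exact congrFun this i

/-- The pullback identity holds on a neighbourhood, so it may be differentiated; the two `D²κ` terms
are what makes the connection non-tensorial. -/
theorem IsPullbackNear.fderiv_metricForm (hp : IsPullbackNear H G κ y) (hH : IsMetricNear H y)
    (hG : IsMetricNear G (κ y)) (c a b : E n) :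
    fderiv ℝ (metricForm H) y c a b =
      fderiv ℝ (metricForm G) (κ y) (fderiv ℝ κ y c) (fderiv ℝ κ y a) (fderiv ℝ κ y b) +
      metricForm G (κ y) (fderiv ℝ (fderiv ℝ κ) y c a) (fderiv ℝ κ y b) +
      metricForm G (κ y) (fderiv ℝ κ y a) (fderiv ℝ (fderiv ℝ κ) y c b) := by
  have hκ := hp.smooth.self_of_nhds
  have hκ1 : DifferentiableAt ℝ κ y := hκ.differentiableAt (by simp)
  have hκ2 : DifferentiableAt ℝ (fderiv ℝ κ) y :=
    (contDiffAt_fderiv hκ).differentiableAt (by simp)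
  have dH := (hasFDerivAt_metricForm hH.differentiableAt).differentiableAt
  have dG := (hasFDerivAt_metricForm hG.differentiableAt).differentiableAt
  have hc (v : E n) : DifferentiableAt ℝ (fun _ : E n ↦ v) y := differentiableAt_const v
  have e1 := (hasFDerivAt_clm_apply₂ dH (hc a) (hc b)).2 c
  have hκv (v : E n) : DifferentiableAt ℝ (fun z ↦ fderiv ℝ κ z v) y := hκ2.clm_apply (hc v)
  have hκv' (v : E n) : fderiv ℝ (fun z ↦ fderiv ℝ κ z v) y c =
      fderiv ℝ (fderiv ℝ κ) y c v := by
    rw [fderiv_clm_apply' hκ2 (hc v)]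
    simp
  obtain ⟨dGκ, dGκ'⟩ := differentiableAt_comp_and_fderiv
    (W := (E n) →L[ℝ] (E n) →L[ℝ] ℝ) _ (κ := κ) dG hκ1
  have e2 := (hasFDerivAt_clm_apply₂ dGκ (hκv a) (hκv b)).2 c
  have e3 : (fun z ↦ metricForm H z a b) =ᶠ[𝓝 y]
      fun z ↦ metricForm G (κ z) (fderiv ℝ κ z a) (fderiv ℝ κ z b) := by
    filter_upwards [hp.eq] with z hz using hz a b
  rw [e3.fderiv_eq] at e1
  rw [e2, dGκ', hκv', hκv'] at e1
  simpa using e1.symm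

/-- The transformation law of the Levi-Civita connection. -/
theorem IsPullbackNear.christoffelMap (hp : IsPullbackNear H G κ y) (hH : IsMetricNear H y)
    (hG : IsMetricNear G (κ y)) (a b : E n) :
    fderiv ℝ κ y (christoffelMap H y a b) =
      christoffelMap G (κ y) (fderiv ℝ κ y a) (fderiv ℝ κ y b) + fderiv ℝ (fderiv ℝ κ) y a b := by
  -- Both sides are paired with `Dκ c` and expanded by the Koszul formula; by symmetry of `D²κ`,
  -- only the terms in `D²κ(a, b)` survive.
  refine metricForm_nondegenerate hG.isUnit_det.self_of_nhds fun c' ↦ ?_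
  obtain ⟨c, rfl⟩ := hp.surjective.self_of_nhds c'
  have hκ := fderiv_fderiv_symm hp.smooth.self_of_nhds
  rw [← hp.eq.self_of_nhds, metricForm_christoffelMap hH.isUnit_det.self_of_nhds hH.differentiableAt,
    map_add, metricForm_christoffelMap hG.isUnit_det.self_of_nhds hG.differentiableAt,
    hp.fderiv_metricForm hH hG, hp.fderiv_metricForm hH hG, hp.fderiv_metricForm hH hG,
    hκ b a, hκ c a, hκ c b, hG.metricForm_symm (fderiv ℝ κ y b),
    hG.metricForm_symm _ (fderiv ℝ κ y b), hG.metricForm_symm _ (fderiv ℝ κ y c)]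
  ring

/-- Derivative of the transformation law of `Γ`. The term `D³κ(c, a, b)` is symmetric in `c` and
`a`, and so disappears from the curvature, which is antisymmetric in them. -/
theorem IsPullbackNear.fderiv_christoffelMap (hp : IsPullbackNear H G κ y) (hH : IsMetricNear H y)
    (hG : IsMetricNear G (κ y)) (c a b : E n) :
    fderiv ℝ κ y (fderiv ℝ (SasakiThree.christoffelMap H) y c a b) =
      fderiv ℝ (SasakiThree.christoffelMap G) (κ y) (fderiv ℝ κ y c) (fderiv ℝ κ y a)
        (fderiv ℝ κ y b) +
      SasakiThree.christoffelMap G (κ y) (fderiv ℝ (fderiv ℝ κ) y c a) (fderiv ℝ κ y b) +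
      SasakiThree.christoffelMap G (κ y) (fderiv ℝ κ y a) (fderiv ℝ (fderiv ℝ κ) y c b) +
      fderiv ℝ (fderiv ℝ (fderiv ℝ κ)) y c a b -
      fderiv ℝ (fderiv ℝ κ) y c (SasakiThree.christoffelMap H y a b) := by
  have hκ := hp.smooth.self_of_nhds
  have hκ1 : DifferentiableAt ℝ κ y := hκ.differentiableAt (by simp)
  have hκ2 : DifferentiableAt ℝ (fderiv ℝ κ) y :=
    (contDiffAt_fderiv hκ).differentiableAt (by simp)
  have hκ3 : DifferentiableAt ℝ (fderiv ℝ (fderiv ℝ κ)) y :=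
    (contDiffAt_fderiv (contDiffAt_fderiv hκ)).differentiableAt (by simp)
  have dH := differentiableAt_christoffelMap hH.differentiableAt_christoffel
  have dG := differentiableAt_christoffelMap hG.differentiableAt_christoffel
  obtain ⟨dGκ, dGκ'⟩ := differentiableAt_comp_and_fderiv
    (W := (E n) →L[ℝ] (E n) →L[ℝ] (E n)) _ (κ := κ) dG hκ1
  have hc (v : E n) : DifferentiableAt ℝ (fun _ : E n ↦ v) y := differentiableAt_const v
  have hκv (v : E n) : DifferentiableAt ℝ (fun z ↦ fderiv ℝ κ z v) y := hκ2.clm_apply (hc v)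
  have hκv' (v : E n) : fderiv ℝ (fun z ↦ fderiv ℝ κ z v) y c =
      fderiv ℝ (fderiv ℝ κ) y c v := by
    rw [fderiv_clm_apply' hκ2 (hc v)]
    simp
  have e1 := (hasFDerivAt_clm_apply₂ dH (hc a) (hc b))
  have e1' := fderiv_clm_apply' hκ2 e1.1 c
  have e2 := hasFDerivAt_clm_apply₂ dGκ (hκv a) (hκv b)
  have e3 := hasFDerivAt_clm_apply₂ hκ3 (hc a) (hc b)
  have e4 : (fun z ↦ fderiv ℝ κ z (SasakiThree.christoffelMap H z a b)) =ᶠ[𝓝 y]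
      (fun z ↦ SasakiThree.christoffelMap G (κ z) (fderiv ℝ κ z a) (fderiv ℝ κ z b)) +
        fun z ↦ fderiv ℝ (fderiv ℝ κ) z a b := by
    filter_upwards [hp.eventually, hH.eventually,
      hκ1.continuousAt.eventually hG.eventually] with z h1 h2 h3 using
      h1.christoffelMap h2 h3 a b
  rw [e4.fderiv_eq, fderiv_add e2.1 e3.1, add_apply, e2.2, e3.2, e1.2] at e1'
  rw [dGκ', hκv', hκv'] at e1'
  simp only [fderiv_fun_const, Pi.zero_apply, zero_apply, map_zero, add_zero,
    ContinuousLinearMap.comp_apply] at e1'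
  rw [eq_sub_iff_add_eq, e1']
  abel

/-- The Riemann tensor is a tensor. -/
theorem IsPullbackNear.riemannMap (hp : IsPullbackNear H G κ y) (hH : IsMetricNear H y)
    (hG : IsMetricNear G (κ y)) (a b c : E n) :
    fderiv ℝ κ y (riemannMap H y a b c) =
      riemannMap G (κ y) (fderiv ℝ κ y a) (fderiv ℝ κ y b) (fderiv ℝ κ y c) := by
  have hκ := hp.smooth.self_of_nhds
  have s2 := fderiv_fderiv_symm hκ
  have s3 : ∀ a b c, fderiv ℝ (fderiv ℝ (fderiv ℝ κ)) y a b c =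
      fderiv ℝ (fderiv ℝ (fderiv ℝ κ)) y b a c := fun a b c ↦ by
    rw [fderiv_fderiv_symm (contDiffAt_fderiv hκ)]
  rw [riemannMap_eq hH.differentiableAt_christoffel, riemannMap_eq hG.differentiableAt_christoffel]
  simp only [map_add, map_sub, hp.fderiv_christoffelMap hH hG, hp.christoffelMap hH hG]
  rw [s2 b a, s3 b a]
  abel

/-- Differentiating `Dκ X = Y ∘ κ` produces the same `D²κ` terms as differentiating the pulled back
metric, so the Killing equation does not depend on the chart. -/
theorem IsPullbackNear.lieDerivative (hp : IsPullbackNear H G κ y) (hH : IsMetricNear H y)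
    (hG : IsMetricNear G (κ y)) {X Y : (E n) → (E n)} (hX : DifferentiableAt ℝ X y)
    (hY : DifferentiableAt ℝ Y (κ y)) (hXY : ∀ᶠ z in 𝓝 y, fderiv ℝ κ z (X z) = Y (κ z))
    (a b : E n) :
    fderiv ℝ (metricForm H) y (X y) a b + metricForm H y (fderiv ℝ X y a) b +
      metricForm H y a (fderiv ℝ X y b) =
    fderiv ℝ (metricForm G) (κ y) (Y (κ y)) (fderiv ℝ κ y a) (fderiv ℝ κ y b) +
      metricForm G (κ y) (fderiv ℝ Y (κ y) (fderiv ℝ κ y a)) (fderiv ℝ κ y b) +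
      metricForm G (κ y) (fderiv ℝ κ y a) (fderiv ℝ Y (κ y) (fderiv ℝ κ y b)) := by
  have hκ := hp.smooth.self_of_nhds
  have hκ1 : DifferentiableAt ℝ κ y := hκ.differentiableAt (by simp)
  have hκ2 : DifferentiableAt ℝ (fderiv ℝ κ) y :=
    (contDiffAt_fderiv hκ).differentiableAt (by simp)
  have h (c : E n) : fderiv ℝ Y (κ y) (fderiv ℝ κ y c) =
      fderiv ℝ (fderiv ℝ κ) y (X y) c + fderiv ℝ κ y (fderiv ℝ X y c) := by
    have e1 : (fun z ↦ fderiv ℝ κ z (X z)) =ᶠ[𝓝 y] Y ∘ κ := hXY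
    have e2 := fderiv_clm_apply' hκ2 hX c
    rw [e1.fderiv_eq, fderiv_comp y hY hκ1] at e2
    rw [fderiv_fderiv_symm hκ, ← e2]
    rfl
  rw [hp.fderiv_metricForm hH hG, hp.eq.self_of_nhds, hp.eq.self_of_nhds, h, h,
    hXY.self_of_nhds]
  simp only [map_add, add_apply]
  ring

end Transformation

/-! ### Eigenvalues of the Hessian along a conformal Killing field -/

section ConformalKilling

open Filter Topology

variable {V : Type*} [NormedAddCommGroup V] [InnerProductSpace ℝ V]

local notation "⟪" x ", " y "⟫" => inner ℝ x y

theorem fderiv_apply_const' {W W' : Type*} [NormedAddCommGroup W] [NormedSpace ℝ W]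
    [NormedAddCommGroup W'] [NormedSpace ℝ W']
    {B : V → W →L[ℝ] W'} {y : V} (hB : DifferentiableAt ℝ B y) (a : V) (w : W) :
    DifferentiableAt ℝ (fun z ↦ B z w) y ∧ fderiv ℝ (fun z ↦ B z w) y a = fderiv ℝ B y a w := by
  refine ⟨hB.clm_apply (differentiableAt_const w), ?_⟩
  rw [fderiv_clm_apply' hB (differentiableAt_const w)]
  simp

theorem smul_add_of_orthogonal {X : V} (hX : ⟪X, X⟫ ≠ 0) (v : V) :
    ∃ w, ⟪w, X⟫ = 0 ∧ v = (⟪v, X⟫ / ⟪X, X⟫) • X + w :=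
  ⟨v - (⟪v, X⟫ / ⟪X, X⟫) • X, by
    rw [inner_sub_left, real_inner_smul_left, div_mul_cancel₀ _ hX, sub_self], by abel⟩

/-- Symmetry of third derivatives makes the curl of an eigenfield of the Hessian vanish on its
orthogonal complement, unless the two eigenvalues agree. -/
theorem eigenvalue_sub_mul_curl {u : V → ℝ} {X : V → V} {y : V}
    (hu : ContDiffAt ℝ ∞ u y) (hX : ContDiffAt ℝ ∞ X y) (hX0 : ⟪X y, X y⟫ ≠ 0)
    (heig : ∀ᶠ z in 𝓝 y, ∀ b, fderiv ℝ (fderiv ℝ u) z b (X z) * ⟪X z, X z⟫ =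
      fderiv ℝ (fderiv ℝ u) z (X z) (X z) * ⟪b, X z⟫)
    {μ α : ℝ} (hμ : fderiv ℝ (fderiv ℝ u) y (X y) (X y) = μ * ⟪X y, X y⟫)
    (hα : ∀ a b, ⟪a, X y⟫ = 0 → fderiv ℝ (fderiv ℝ u) y a b = α * ⟪a, b⟫)
    {a b : V} (ha : ⟪a, X y⟫ = 0) (hb : ⟪b, X y⟫ = 0) :
    (μ - α) * (⟪b, fderiv ℝ X y a⟫ - ⟪a, fderiv ℝ X y b⟫) = 0 := by
  have hX1 : DifferentiableAt ℝ X y := hX.differentiableAt (by simp)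
  have hu2 : DifferentiableAt ℝ (fderiv ℝ (fderiv ℝ u)) y :=
    (contDiffAt_fderiv (contDiffAt_fderiv hu)).differentiableAt (by simp)
  -- The eigenvector equation is differentiated along `a`. It is stated multiplied by `⟪X, X⟫`, so
  -- that no regularity of the eigenvalue as a function is needed. Exchanging `a` and `b` in the
  -- result isolates the curl.
  have key : ∀ a b, ⟪a, X y⟫ = 0 → ⟪b, X y⟫ = 0 →
      fderiv ℝ (fderiv ℝ (fderiv ℝ u)) y a b (X y) = (μ - α) * ⟪b, fderiv ℝ X y a⟫ := by
    intro a b ha hb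
    have e : (fun z ↦ fderiv ℝ (fderiv ℝ u) z b (X z) * ⟪X z, X z⟫) =ᶠ[𝓝 y]
      fun z ↦ fderiv ℝ (fderiv ℝ u) z (X z) (X z) * ⟪b, X z⟫ := heig.mono fun z hz ↦ hz b
    have e := congrArg (fun L : V →L[ℝ] ℝ ↦ L a) e.fderiv_eq
    have d1 := hasFDerivAt_clm_apply₂ hu2 (differentiableAt_const b) hX1
    have d2 := hasFDerivAt_clm_apply₂ hu2 hX1 hX1
    beta_reduce at e
    rw [fderiv_fun_mul d1.1 (hX1.inner ℝ hX1), fderiv_fun_mul d2.1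
      ((differentiableAt_const b).inner ℝ hX1)] at e
    simp only [add_apply, smul_apply, smul_eq_mul, d1.2,
      fderiv_inner_apply ℝ (differentiableAt_const b) hX1, hb, hα b _ hb, hμ] at e
    simp only [fderiv_fun_const, Pi.zero_apply, zero_apply, map_zero, inner_zero_left, mul_zero,
      zero_mul, add_zero, zero_add] at e
    apply mul_right_cancel₀ hX0
    linear_combination e
  have h1 := key a b ha hb
  have h2 := key b a hb ha
  rw [fderiv_fderiv_symm (contDiffAt_fderiv hu)] at h1
  linear_combination h2 - h1

/-- The second derivative of a conformal Killing field. -/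
theorem inner_fderiv_fderiv_conformalKilling {X : V → V} {h : V → ℝ} {y : V}
    (hX : ContDiffAt ℝ ∞ X y) (hh : ContDiffAt ℝ ∞ h y)
    (hkill : ∀ᶠ z in 𝓝 y, ∀ a b, ⟪fderiv ℝ X z a, b⟫ + ⟪a, fderiv ℝ X z b⟫ = 2 * h z * ⟪a, b⟫)
    (a b c : V) :
    ⟪fderiv ℝ (fderiv ℝ X) y a b, c⟫ = fderiv ℝ h y a * ⟪b, c⟫ + fderiv ℝ h y b * ⟪a, c⟫ -
      fderiv ℝ h y c * ⟪a, b⟫ := by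
  have hX2 : DifferentiableAt ℝ (fderiv ℝ X) y :=
    (contDiffAt_fderiv hX).differentiableAt (by simp)
  have hh1 : DifferentiableAt ℝ h y := hh.differentiableAt (by simp)
  have key : ∀ c a b, ⟪fderiv ℝ (fderiv ℝ X) y c a, b⟫ + ⟪fderiv ℝ (fderiv ℝ X) y c b, a⟫ =
      2 * fderiv ℝ h y c * ⟪a, b⟫ := by
    intro c a b
    have e : (fun z ↦ ⟪fderiv ℝ X z a, b⟫ + ⟪a, fderiv ℝ X z b⟫) =ᶠ[𝓝 y]
      fun z ↦ 2 * h z * ⟪a, b⟫ := hkill.mono fun z hz ↦ hz a b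
    have e := congrArg (fun L : V →L[ℝ] ℝ ↦ L c) e.fderiv_eq
    have da := fderiv_apply_const' hX2 c a
    have db := fderiv_apply_const' hX2 c b
    beta_reduce at e
    rw [fderiv_fun_add (da.1.inner ℝ (differentiableAt_const b))
      ((differentiableAt_const a).inner ℝ db.1), fderiv_mul_const (hh1.const_mul 2),
      fderiv_const_mul hh1] at e
    simp only [add_apply, smul_apply, smul_eq_mul,
      fderiv_inner_apply ℝ (differentiableAt_const a) db.1,
      fderiv_inner_apply ℝ da.1 (differentiableAt_const b), da.2, db.2] at e
    simp only [fderiv_fun_const, Pi.zero_apply, zero_apply, inner_zero_right, inner_zero_left,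
      zero_add, add_zero] at e
    rw [real_inner_comm a, e]
    ring
  have s := fderiv_fderiv_symm hX
  -- `D²X` is symmetric in its two arguments, so three permutations of the differentiated Killing
  -- equation determine it, as in the Koszul formula.
  have k1 := key a b c
  have k2 := key b a c
  have k3 := key c a b
  rw [s c a, s c b] at k3
  rw [s b a] at k2
  linarith

/-- Here `X` represents a unit Killing field of `u⁻²|dy|²`: its Euclidean length is `u` and the
Euclidean metric is scaled by its flow at rate `2h`, with `h = du(X)/u`. Were the two eigenvalues
distinct, the curl would vanish on `X^⊥`, and two evaluations of `h² - dh(X)` would differ by one.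
-/
theorem hessian_eq_of_conformalKilling [CompleteSpace V] {u : V → ℝ} {X : V → V} {y : V}
    (hu : ∀ᶠ z in 𝓝 y, ContDiffAt ℝ ∞ u z) (hX : ∀ᶠ z in 𝓝 y, ContDiffAt ℝ ∞ X z)
    (hpos : ∀ᶠ z in 𝓝 y, 0 < u z) (hunit : ∀ᶠ z in 𝓝 y, ⟪X z, X z⟫ = u z ^ 2)
    (hkill : ∀ᶠ z in 𝓝 y, ∀ a b, u z * (⟪fderiv ℝ X z a, b⟫ + ⟪a, fderiv ℝ X z b⟫) =
      2 * fderiv ℝ u z (X z) * ⟪a, b⟫)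
    (hN : ∀ᶠ z in 𝓝 y, ∃ μ, (∀ b, fderiv ℝ (fderiv ℝ u) z b (X z) = μ * ⟪b, X z⟫) ∧
      ∀ a b, ⟪a, X z⟫ = 0 →
        fderiv ℝ (fderiv ℝ u) z a b = ((1 + ‖fderiv ℝ u z‖ ^ 2) / u z - μ) * ⟪a, b⟫)
    (hperp : ∃ a, ⟪a, a⟫ = 1 ∧ ⟪a, X y⟫ = 0) (a b : V) :
    fderiv ℝ (fderiv ℝ u) y a b = (1 + ‖fderiv ℝ u y‖ ^ 2) / (2 * u y) * ⟪a, b⟫ := by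
  have hu0 := hu.self_of_nhds
  have hX0 := hX.self_of_nhds
  have hX1 : DifferentiableAt ℝ X y := hX0.differentiableAt (by simp)
  have hX2 : DifferentiableAt ℝ (fderiv ℝ X) y :=
    (contDiffAt_fderiv hX0).differentiableAt (by simp)
  have hu1 : DifferentiableAt ℝ u y := hu0.differentiableAt (by simp)
  have hu2 : DifferentiableAt ℝ (fderiv ℝ u) y :=
    (contDiffAt_fderiv hu0).differentiableAt (by simp)
  have hpos0 := hpos.self_of_nhds
  have hXX : ⟪X y, X y⟫ ≠ 0 := by
    rw [hunit.self_of_nhds]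
    positivity
  obtain ⟨μ, hμ, hα⟩ := hN.self_of_nhds
  set α := (1 + ‖fderiv ℝ u y‖ ^ 2) / u y - μ with hαdef
  -- The sum of the two eigenvalues is known, so equality makes each of them half of it.
  suffices hμα : μ = α by
    have hμ2 : μ = (1 + ‖fderiv ℝ u y‖ ^ 2) / (2 * u y) := by
      rw [← div_div, div_right_comm]
      linarith
    obtain ⟨w, hw, hw'⟩ := smul_add_of_orthogonal hXX a
    rw [hw']
    simp only [map_add, map_smul, add_apply, smul_apply, smul_eq_mul, hα _ _ hw, inner_add_left,
      real_inner_smul_left, ← hμα]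
    rw [fderiv_fderiv_symm hu0, hμ, hμ2, real_inner_comm (X y) b]
    ring
  by_contra hne
  -- the derivatives of the unit length condition
  have hunit1 : ∀ᶠ z in 𝓝 y, ∀ c, ⟪fderiv ℝ X z c, X z⟫ = u z * fderiv ℝ u z c := by
    filter_upwards [hu, hX, hunit.eventually_nhds] with z huz hXz hz c
    have hXz1 : DifferentiableAt ℝ X z := hXz.differentiableAt (by simp)
    have huz1 : DifferentiableAt ℝ u z := huz.differentiableAt (by simp)
    have e : (fun z ↦ ⟪X z, X z⟫) =ᶠ[𝓝 z] fun z ↦ u z * u z := hz.mono fun w hw ↦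
      hw.trans (sq _)
    have e := congrArg (fun L : V →L[ℝ] ℝ ↦ L c) e.fderiv_eq
    simp only [fderiv_inner_apply ℝ hXz1 hXz1, fderiv_fun_mul huz1 huz1, add_apply, smul_apply,
      smul_eq_mul] at e
    rw [real_inner_comm] at e
    linarith
  have hunit2 : ∀ c d, ⟪fderiv ℝ (fderiv ℝ X) y d c, X y⟫ + ⟪fderiv ℝ X y c, fderiv ℝ X y d⟫ =
      fderiv ℝ u y d * fderiv ℝ u y c + u y * fderiv ℝ (fderiv ℝ u) y d c := by
    intro c d
    have e : (fun z ↦ ⟪fderiv ℝ X z c, X z⟫) =ᶠ[𝓝 y] fun z ↦ u z * fderiv ℝ u z c :=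
      hunit1.mono fun w hw ↦ hw c
    have e := congrArg (fun L : V →L[ℝ] ℝ ↦ L d) e.fderiv_eq
    have dX := fderiv_apply_const' hX2 d c
    have du := fderiv_apply_const' hu2 d c
    simp only [fderiv_inner_apply ℝ dX.1 hX1, fderiv_fun_mul hu1 du.1, add_apply, smul_apply,
      smul_eq_mul, dX.2, du.2] at e
    linarith
  -- the conformal factor
  set h : V → ℝ := fun z ↦ fderiv ℝ u z (X z) * (u z)⁻¹ with hh
  have hhs : ContDiffAt ℝ ∞ h y :=
    ((contDiffAt_fderiv hu0).clm_apply hX0).mul (hu0.inv hpos0.ne')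
  have hh1 : DifferentiableAt ℝ h y := hhs.differentiableAt (by simp)
  have huh : ∀ᶠ z in 𝓝 y, u z * h z = fderiv ℝ u z (X z) := hpos.mono fun z hz ↦ by
    simp only [hh]
    field_simp
  have hkill' : ∀ᶠ z in 𝓝 y, ∀ a b, ⟪fderiv ℝ X z a, b⟫ + ⟪a, fderiv ℝ X z b⟫ =
      2 * h z * ⟪a, b⟫ := by
    filter_upwards [huh, hkill, hpos] with z h1 h2 h3 a b
    have := h2 a b
    rw [← h1] at this
    apply mul_left_cancel₀ h3.ne'
    linarith
  have hk := hkill'.self_of_nhds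
  have hh2 : fderiv ℝ u y (X y) * h y + u y * fderiv ℝ h y (X y) =
      fderiv ℝ (fderiv ℝ u) y (X y) (X y) + fderiv ℝ u y (fderiv ℝ X y (X y)) := by
    have e : (fun z ↦ u z * h z) =ᶠ[𝓝 y] fun z ↦ fderiv ℝ u z (X z) := huh
    have e := congrArg (fun L : V →L[ℝ] ℝ ↦ L (X y)) e.fderiv_eq
    simp only [fderiv_fun_mul hu1 hh1, add_apply, smul_apply, smul_eq_mul,
      fderiv_clm_apply' hu2 hX1] at e
    linarith
  have huh0 := huh.self_of_nhds
  -- the curl vanishes on the orthogonal complement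
  have hcurl : ∀ a b, ⟪a, X y⟫ = 0 → ⟪b, X y⟫ = 0 → ⟪fderiv ℝ X y a, b⟫ = h y * ⟪a, b⟫ := by
    intro a b ha hb
    have heig : ∀ᶠ z in 𝓝 y, ∀ b, fderiv ℝ (fderiv ℝ u) z b (X z) * ⟪X z, X z⟫ =
        fderiv ℝ (fderiv ℝ u) z (X z) (X z) * ⟪b, X z⟫ := by
      filter_upwards [hN] with z ⟨μ, hz, _⟩ b
      rw [hz, hz]
      ring
    have := eigenvalue_sub_mul_curl hu0 hX0 hXX heig (hμ _) hα ha hb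
    have := (mul_eq_zero.1 this).resolve_left (sub_ne_zero.2 hne)
    have := hk a b
    rw [real_inner_comm] at this ⊢
    linarith
  obtain ⟨a, ha1, ha⟩ := hperp
  -- Without curl, `DX a` is `h a` modulo `X`; the derivative of `⟪X, X⟫ = u²` determines the
  -- component along `X`.
  have hXa : fderiv ℝ X y a = h y • a + (fderiv ℝ u y a / u y) • X y := by
    obtain ⟨w, hw, hw'⟩ := smul_add_of_orthogonal hXX (fderiv ℝ X y a)
    have h1 := hcurl a (w - h y • a) ha (by
      rw [inner_sub_left, hw, real_inner_smul_left, ha]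
      simp)
    have h2 : ⟪w - h y • a, w - h y • a⟫ = 0 := by
      rw [hw', inner_add_left, real_inner_smul_left, inner_sub_right, real_inner_comm w (X y), hw,
        real_inner_smul_right, real_inner_comm a (X y), ha] at h1
      rw [inner_sub_left w, real_inner_smul_left, ← h1]
      simp
    have h3 : w = h y • a := sub_eq_zero.1 (inner_self_eq_zero.1 h2)
    rw [h3, hunit1.self_of_nhds, hunit.self_of_nhds] at hw'
    rw [hw', add_comm]
    congr 2
    field_simp
  -- First evaluation: the second derivative of `⟪X, X⟫ = u²` in the direction `a`. The `du(a)²`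
  -- terms cancel, leaving `h² - dh(X) = u α`.
  have e1 := hunit2 a a
  rw [inner_fderiv_fderiv_conformalKilling hX0 hhs hkill', hXa, hα a a ha] at e1
  simp only [inner_add_left, inner_add_right, real_inner_smul_left, real_inner_smul_right, ha1,
    real_inner_comm a (X y), ha, hunit.self_of_nhds] at e1
  -- Second evaluation: `u h = du(X)` is differentiated along `X`, where `du(DX X)` comes from the
  -- conformal Killing equation tested on `∇u` and `X`. It gives `h² - dh(X) = |∇u|² - u μ`.
  have e2 : fderiv ℝ u y (fderiv ℝ X y (X y)) =
      2 * u y * h y ^ 2 - u y * ‖fderiv ℝ u y‖ ^ 2 := by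
    set g := (InnerProductSpace.toDual ℝ V).symm (fderiv ℝ u y) with hg
    have hgv : ∀ v, ⟪g, v⟫ = fderiv ℝ u y v := fun v ↦ InnerProductSpace.toDual_symm_apply
    have hgn : ‖fderiv ℝ u y‖ ^ 2 = fderiv ℝ u y g := by
      rw [← hgv, real_inner_self_eq_norm_sq, hg, LinearIsometryEquiv.norm_map]
    have := hk g (X y)
    rw [hunit1.self_of_nhds, hgv, hgv, ← huh0] at this
    rw [hgn]
    linarith
  rw [e2, ← huh0, hμ, hunit.self_of_nhds] at hh2
  have e3 : u y * α = 1 + ‖fderiv ℝ u y‖ ^ 2 - u y * μ := by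
    rw [hαdef]
    field_simp
  have e4 : h y ^ 2 - fderiv ℝ h y (X y) = u y * α := by
    have : fderiv ℝ u y a / u y * (fderiv ℝ u y a / u y * u y ^ 2) =
      fderiv ℝ u y a * fderiv ℝ u y a := by field_simp
    linear_combination e1 - this
  have e5 : u y * (h y ^ 2 - fderiv ℝ h y (X y)) =
      u y * (‖fderiv ℝ u y‖ ^ 2 - μ * u y) := by
    linear_combination -hh2
  have e6 := mul_left_cancel₀ hpos0.ne' e5
  -- The two evaluations give `u α = |∇u|² - u μ`, while the definition of `α` has an extra `1`, the
  -- curvature of the planes containing `ξ`.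
  linarith

end ConformalKilling

/-! ### Connection and curvature of `u⁻²|dy|²` -/

section ConformalMetric

open Filter Topology

variable {n : ℕ}

local notation "E" n => EuclideanSpace ℝ (Fin n)
local notation "⟪" x ", " y "⟫" => inner ℝ x y

/-- The metric `G` is `u⁻²` times the Euclidean metric near `y`. -/
structure IsConformalNear (G : (E n) → Matrix (Fin n) (Fin n) ℝ) (u : (E n) → ℝ) (y : E n) :
    Prop where
  smooth : ∀ᶠ z in 𝓝 y, ContDiffAt ℝ ∞ u z
  pos : ∀ᶠ z in 𝓝 y, 0 < u z
  eq : ∀ᶠ z in 𝓝 y, G z = (u z ^ 2)⁻¹ • (1 : Matrix (Fin n) (Fin n) ℝ)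

variable {G : (E n) → Matrix (Fin n) (Fin n) ℝ} {u : (E n) → ℝ} {y : E n}

theorem IsConformalNear.eventually (hG : IsConformalNear G u y) :
    ∀ᶠ z in 𝓝 y, IsConformalNear G u z := by
  filter_upwards [hG.smooth.eventually_nhds, hG.pos.eventually_nhds,
    hG.eq.eventually_nhds] with z h1 h2 h3
  exact ⟨h1, h2, h3⟩

theorem IsConformalNear.isMetricNear (hG : IsConformalNear G u y) : IsMetricNear G y where
  smooth := by
    filter_upwards [hG.smooth, hG.pos, hG.eq.eventually_nhds] with z h1 h2 h3 i j
    have : ContDiffAt ℝ ∞ (fun w ↦ (u w ^ 2)⁻¹ * (1 : Matrix (Fin n) (Fin n) ℝ) i j) z :=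
      ((h1.pow 2).inv (by positivity)).mul contDiffAt_const
    refine this.congr_of_eventuallyEq (h3.mono fun w hw ↦ ?_)
    simp [hw]
  symm := hG.eq.mono fun z hz i j ↦ by
    simp [hz, Matrix.one_apply, eq_comm]
  isUnit_det := by
    filter_upwards [hG.pos, hG.eq] with z h1 h2
    rw [h2, Matrix.det_smul, Matrix.det_one, mul_one, isUnit_iff_ne_zero]
    positivity

theorem IsConformalNear.metricForm_eq (hG : IsConformalNear G u y) (a b : E n) :
    metricForm G y a b = (u y ^ 2)⁻¹ * ⟪a, b⟫ := by
  rw [metricForm_apply, hG.eq.self_of_nhds]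
  simp [Matrix.one_apply, PiLp.inner_apply, Finset.mul_sum, mul_comm]

theorem IsConformalNear.differentiableAt (hG : IsConformalNear G u y) : DifferentiableAt ℝ u y :=
  hG.smooth.self_of_nhds.differentiableAt (by simp)

theorem IsConformalNear.fderiv_metricForm (hG : IsConformalNear G u y) (c a b : E n) :
    fderiv ℝ (metricForm G) y c a b = -2 * (u y ^ 3)⁻¹ * fderiv ℝ u y c * ⟪a, b⟫ := by
  have hpos := hG.pos.self_of_nhds
  have dG := (hasFDerivAt_metricForm hG.isMetricNear.differentiableAt).differentiableAt
  have e : (fun z ↦ metricForm G z a b) =ᶠ[𝓝 y] fun z ↦ (u z ^ 2)⁻¹ * ⟪a, b⟫ :=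
    hG.eventually.mono fun z hz ↦ hz.metricForm_eq a b
  have d := (hasFDerivAt_clm_apply₂ dG (differentiableAt_const a) (differentiableAt_const b)).2 c
  have du := hG.differentiableAt.hasFDerivAt
  have d2 := ((hasDerivAt_inv (pow_ne_zero 2 hpos.ne')).comp_hasFDerivAt y
    (du.pow 2)).mul_const ⟪a, b⟫
  rw [e.fderiv_eq] at d
  have d3 : fderiv ℝ (fun z ↦ (u z ^ 2)⁻¹ * ⟪a, b⟫) y = _ := d2.fderiv
  rw [d3] at d
  simp only [fderiv_fun_const, Pi.zero_apply, zero_apply, map_zero, add_zero] at d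
  rw [← d]
  simp only [smul_apply, smul_eq_mul]
  field_simp
  simp
  ring

theorem IsConformalNear.inner_christoffelMap (hG : IsConformalNear G u y) (a b d : E n) :
    ⟪christoffelMap G y a b, d⟫ = -(u y)⁻¹ *
      (fderiv ℝ u y a * ⟪b, d⟫ + fderiv ℝ u y b * ⟪a, d⟫ - fderiv ℝ u y d * ⟪a, b⟫) := by
  have hpos := hG.pos.self_of_nhds
  have h := metricForm_christoffelMap hG.isMetricNear.isUnit_det.self_of_nhds
    hG.isMetricNear.differentiableAt a b d
  rw [hG.metricForm_eq, hG.fderiv_metricForm, hG.fderiv_metricForm, hG.fderiv_metricForm,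
    real_inner_comm] at h
  field_simp at h ⊢
  linarith

theorem IsConformalNear.inner_fderiv_christoffelMap (hG : IsConformalNear G u y) (a b c d : E n) :
    ⟪fderiv ℝ (christoffelMap G) y a b c, d⟫ = (u y ^ 2)⁻¹ * fderiv ℝ u y a *
      (fderiv ℝ u y b * ⟪c, d⟫ + fderiv ℝ u y c * ⟪b, d⟫ - fderiv ℝ u y d * ⟪b, c⟫) -
      (u y)⁻¹ * (fderiv ℝ (fderiv ℝ u) y a b * ⟪c, d⟫ + fderiv ℝ (fderiv ℝ u) y a c * ⟪b, d⟫ -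
        fderiv ℝ (fderiv ℝ u) y a d * ⟪b, c⟫) := by
  have hpos := hG.pos.self_of_nhds
  have dG := differentiableAt_christoffelMap hG.isMetricNear.differentiableAt_christoffel
  have dΓ := hasFDerivAt_clm_apply₂ dG (differentiableAt_const b) (differentiableAt_const c)
  have e : (fun z ↦ ⟪christoffelMap G z b c, d⟫) =ᶠ[𝓝 y] fun z ↦ -(u z)⁻¹ *
      (fderiv ℝ u z b * ⟪c, d⟫ + fderiv ℝ u z c * ⟪b, d⟫ - fderiv ℝ u z d * ⟪b, c⟫) :=
    hG.eventually.mono fun z hz ↦ hz.inner_christoffelMap b c d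
  have e := congrArg (fun L : (E n) →L[ℝ] ℝ ↦ L a) e.fderiv_eq
  have hu2 : DifferentiableAt ℝ (fderiv ℝ u) y :=
    (contDiffAt_fderiv hG.smooth.self_of_nhds).differentiableAt (by simp)
  have dv (v : E n) := (fderiv_apply_const' hu2 a v)
  have dsum := (((dv b).1.mul_const ⟪c, d⟫).fun_add ((dv c).1.mul_const ⟪b, d⟫)).fun_sub
    ((dv d).1.mul_const ⟪b, c⟫)
  have dinv := ((hasDerivAt_inv hpos.ne').comp_hasFDerivAt y
    hG.differentiableAt.hasFDerivAt).fun_neg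
  beta_reduce at e
  rw [fderiv_inner_apply ℝ dΓ.1 (differentiableAt_const d)] at e
  rw [fderiv_fun_mul (c := fun z ↦ -(u z)⁻¹) dinv.differentiableAt dsum, dΓ.2] at e
  rw [fderiv_fun_sub (((dv b).1.mul_const ⟪c, d⟫).fun_add ((dv c).1.mul_const ⟪b, d⟫))
    ((dv d).1.mul_const ⟪b, c⟫), fderiv_fun_add ((dv b).1.mul_const ⟪c, d⟫)
    ((dv c).1.mul_const ⟪b, d⟫), fderiv_mul_const (dv b).1, fderiv_mul_const (dv c).1,
    fderiv_mul_const (dv d).1] at e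
  have dinv' : fderiv ℝ (fun z ↦ -(u z)⁻¹) y = _ := dinv.fderiv
  rw [dinv'] at e
  simp only [fderiv_fun_const, Pi.zero_apply, zero_apply, map_zero, add_zero, inner_zero_right,
    zero_add, add_apply, sub_apply, smul_apply, neg_apply, smul_eq_mul, (dv _).2] at e
  rw [e]
  ring

/-- Curvature is the Kulkarni–Nomizu product of the Euclidean metric with `Hess u / u - |∇u|²/(2u²)`
times that metric, up to the factor `u⁻²` of `g`, since `d` is paired by the Euclidean inner
product. Products of single first derivatives cancel and only `|∇u|²` remains. -/
theorem IsConformalNear.inner_riemannMap (hG : IsConformalNear G u y) (a b c d : E n) :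
    ⟪riemannMap G y a b c, d⟫ = (u y)⁻¹ *
      (-fderiv ℝ (fderiv ℝ u) y a c * ⟪b, d⟫ + fderiv ℝ (fderiv ℝ u) y b c * ⟪a, d⟫ +
        ⟪b, c⟫ * fderiv ℝ (fderiv ℝ u) y a d - ⟪a, c⟫ * fderiv ℝ (fderiv ℝ u) y b d) +
      (u y ^ 2)⁻¹ * ‖fderiv ℝ u y‖ ^ 2 * (⟪a, c⟫ * ⟪b, d⟫ - ⟪b, c⟫ * ⟪a, d⟫) := by
  set g := (InnerProductSpace.toDual ℝ (E n)).symm (fderiv ℝ u y) with hg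
  have hgv : ∀ v, fderiv ℝ u y v = ⟪v, g⟫ := fun v ↦ by
    rw [real_inner_comm]
    exact InnerProductSpace.toDual_symm_apply.symm
  have hgn : ‖fderiv ℝ u y‖ ^ 2 = fderiv ℝ u y g := by
    rw [hgv, real_inner_self_eq_norm_sq, hg, LinearIsometryEquiv.norm_map]
  have hc : ∀ v w, fderiv ℝ u y (christoffelMap G y v w) = -(u y)⁻¹ *
      (2 * fderiv ℝ u y v * fderiv ℝ u y w - ‖fderiv ℝ u y‖ ^ 2 * ⟪v, w⟫) := fun v w ↦ by
    rw [hgv, hG.inner_christoffelMap, ← hgn, ← hgv, ← hgv]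
    ring
  have hc' : ∀ v w x, ⟪x, christoffelMap G y v w⟫ = ⟪christoffelMap G y v w, x⟫ :=
    fun v w x ↦ real_inner_comm _ _
  have hs := fderiv_fderiv_symm hG.smooth.self_of_nhds b a
  rw [riemannMap_eq hG.isMetricNear.differentiableAt_christoffel]
  simp only [inner_add_left, inner_sub_left, hG.inner_fderiv_christoffelMap,
    hG.inner_christoffelMap, hc, hc', hs, real_inner_comm a b, real_inner_comm a c,
    real_inner_comm b c]
  ring

theorem exists_unit_orthogonal (v w : E 3) :
    ∃ a : E 3, ⟪a, a⟫ = 1 ∧ ⟪a, v⟫ = 0 ∧ ⟪a, w⟫ = 0 := by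
  have hlt : Module.finrank ℝ (Submodule.span ℝ ({v, w} : Set (E 3))) < Module.finrank ℝ (E 3) := by
    have := (finrank_span_finset_le_card (R := ℝ) ({v, w} : Finset (E 3))).trans
      Finset.card_le_two
    simp only [Finset.coe_pair] at this
    rw [finrank_euclideanSpace_fin]
    exact lt_of_le_of_lt this (by norm_num)
  have hne : (Submodule.span ℝ ({v, w} : Set (E 3)))ᗮ ≠ ⊥ := by
    intro h
    rw [Submodule.orthogonal_eq_bot_iff] at h
    rw [h, finrank_top] at hlt
    exact lt_irrefl _ hlt
  obtain ⟨a, ha, ha0⟩ := Submodule.exists_mem_ne_zero_of_ne_bot hne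
  rw [Submodule.mem_orthogonal'] at ha
  have hv := ha v (Submodule.subset_span (by simp))
  have hw := ha w (Submodule.subset_span (by simp))
  refine ⟨‖a‖⁻¹ • a, ?_, ?_, ?_⟩
  · rw [real_inner_smul_left, real_inner_smul_right, real_inner_self_eq_norm_sq]
    have := norm_ne_zero_iff.2 ha0
    field_simp
  · simp [real_inner_smul_left, hv]
  · simp [real_inner_smul_left, hw]

/-- In dimension three, the Sasakian curvature condition forces the Hessian of the conformal
factor to have at most two eigenvalues. -/
theorem hessian_eigen_of_sasakian {G : (E 3) → Matrix (Fin 3) (Fin 3) ℝ} {u : (E 3) → ℝ} {y : E 3}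
    (hG : IsConformalNear G u y) {X : E 3} (hX : ⟪X, X⟫ = u y ^ 2)
    (hR : ∀ a c, riemannMap G y a X c = metricForm G y X c • a - metricForm G y a c • X) :
    ∃ μ, (∀ b, fderiv ℝ (fderiv ℝ u) y b X = μ * ⟪b, X⟫) ∧ ∀ a b, ⟪a, X⟫ = 0 →
      fderiv ℝ (fderiv ℝ u) y a b = ((1 + ‖fderiv ℝ u y‖ ^ 2) / u y - μ) * ⟪a, b⟫ := by
  have hpos := hG.pos.self_of_nhds
  have hs := fderiv_fderiv_symm hG.smooth.self_of_nhds
  have hXX : ⟪X, X⟫ ≠ 0 := by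
    rw [hX]
    positivity
  set N := fderiv ℝ (fderiv ℝ u) y
  set k := (1 + ‖fderiv ℝ u y‖ ^ 2) / u y with hk
  have key : ∀ a c d, -N a c * ⟪X, d⟫ + N X c * ⟪a, d⟫ + ⟪X, c⟫ * N a d - ⟪a, c⟫ * N X d =
      k * (⟪X, c⟫ * ⟪a, d⟫ - ⟪a, c⟫ * ⟪X, d⟫) := by
    intro a c d
    have h := congrArg (fun v ↦ ⟪v, d⟫) (hR a c)
    beta_reduce at h
    rw [hG.inner_riemannMap, hG.metricForm_eq, hG.metricForm_eq, inner_sub_left,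
      real_inner_smul_left, real_inner_smul_left] at h
    rw [hk]
    field_simp at h ⊢
    linear_combination h
  -- The dimension enters here: a unit vector `a` orthogonal to both `X` and `b` is needed, and the
  -- identity at `(a, a, b)` reduces to `N X b = 0`.
  have hNX : ∀ b, ⟪b, X⟫ = 0 → N X b = 0 := by
    intro b hb
    obtain ⟨a, ha, haX, hab⟩ := exists_unit_orthogonal X b
    have := key a a b
    rw [real_inner_comm b X, real_inner_comm a X, hb, haX, ha, hab] at this
    linarith
  have hdec := smul_add_of_orthogonal hXX
  have hμ : ∀ b, N b X = N X X / ⟪X, X⟫ * ⟪b, X⟫ := by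
    intro b
    obtain ⟨w, hw, hw'⟩ := hdec b
    have e : N w X = 0 := by rw [hs, hNX w hw]
    conv_lhs => rw [hw']
    simp only [map_add, map_smul, add_apply, smul_apply, smul_eq_mul, e]
    ring
  refine ⟨N X X / ⟪X, X⟫, hμ, fun a b ha ↦ ?_⟩
  obtain ⟨w, hw, hw'⟩ := hdec b
  -- With `c = X` and `a`, `w` orthogonal to `X`, the identity relates `N a w` to `N X X` and fixes
  -- the sum of the eigenvalues.
  have h1 := key a X w
  have e : N a X = 0 := by rw [hs, hNX a ha]
  rw [ha, e] at h1
  have h2 : N a b = N a w := by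
    conv_lhs => rw [hw']
    simp [e]
  have h3 : ⟪a, b⟫ = ⟪a, w⟫ := by
    conv_lhs => rw [hw']
    simp [inner_add_right, real_inner_smul_right, ha]
  rw [h2, h3]
  field_simp
  linear_combination h1

end ConformalMetric

/-! ### Integrating the pure-trace Hessian equation -/

section RoundMetric

open Filter Topology

variable {n : ℕ}

local notation "E" n => EuclideanSpace ℝ (Fin n)
local notation "⟪" x ", " y "⟫" => inner ℝ x y

/-- The gradient of a function on `ℝⁿ`. -/
def grad (u : (E n) → ℝ) (y : E n) : E n := ∑ i, pderiv i u y • EuclideanSpace.single i (1 : ℝ)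

theorem inner_grad (u : (E n) → ℝ) (y v : E n) : ⟪grad u y, v⟫ = fderiv ℝ u y v := by
  rw [fderiv_eq_sum_pderiv, grad, sum_inner]
  refine Finset.sum_congr rfl fun i _ ↦ ?_
  rw [real_inner_smul_left, EuclideanSpace.inner_single_left]
  simp [mul_comm]

theorem norm_fderiv_eq (u : (E n) → ℝ) (y : E n) : ‖fderiv ℝ u y‖ ^ 2 = ⟪grad u y, grad u y⟫ := by
  have : fderiv ℝ u y = innerSL ℝ (grad u y) := by
    ext1 v
    rw [innerSL_apply_apply, inner_grad]
  rw [this, innerSL_apply_norm, real_inner_self_eq_norm_sq]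

theorem differentiableAt_grad {u : (E n) → ℝ} {y : E n}
    (hu : DifferentiableAt ℝ (fderiv ℝ u) y) : DifferentiableAt ℝ (grad u) y :=
  DifferentiableAt.fun_sum fun i _ ↦
    (fderiv_apply_const' hu 0 (EuclideanSpace.single i 1)).1.smul_const _

theorem inner_fderiv_grad {u : (E n) → ℝ} {y : E n}
    (hu : DifferentiableAt ℝ (fderiv ℝ u) y) (a b : E n) :
    ⟪fderiv ℝ (grad u) y a, b⟫ = fderiv ℝ (fderiv ℝ u) y a b := by
  have h := fderiv_inner_apply ℝ (differentiableAt_grad hu) (differentiableAt_const (c := b)) a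
  simp only [inner_grad] at h
  rw [(fderiv_apply_const' hu a b).2] at h
  simpa using h.symm

/-- A metric `u⁻²|dy|²` of constant curvature one on a connected domain of `ℝⁿ` is given by
the standard formula. -/
theorem exists_eq_of_hessian_eq {u : (E n) → ℝ} {s : Set (E n)} (hs : IsOpen s)
    (hs' : IsPreconnected s) (hne : s.Nonempty) (hu : ∀ y ∈ s, ContDiffAt ℝ ∞ u y)
    (hpos : ∀ y ∈ s, 0 < u y)
    (hess : ∀ y ∈ s, ∀ a b,
      fderiv ℝ (fderiv ℝ u) y a b = (1 + ‖fderiv ℝ u y‖ ^ 2) / (2 * u y) * ⟪a, b⟫) :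
    ∃ c : ℝ, 0 < c ∧ ∃ p : E n, ∀ y ∈ s, u y = (1 + c ^ 2 * ‖y - p‖ ^ 2) / (2 * c) := by
  obtain ⟨y₀, hy₀⟩ := hne
  set κ : (E n) → ℝ := fun y ↦ (1 + ⟪grad u y, grad u y⟫) * (2 * u y)⁻¹ with hκ
  have du : ∀ y ∈ s, DifferentiableAt ℝ u y := fun y hy ↦ (hu y hy).differentiableAt (by simp)
  have du2 : ∀ y ∈ s, DifferentiableAt ℝ (fderiv ℝ u) y := fun y hy ↦
    (contDiffAt_fderiv (hu y hy)).differentiableAt (by simp)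
  have dg : ∀ y ∈ s, HasFDerivAt (grad u) (κ y • ContinuousLinearMap.id ℝ (E n)) y := by
    intro y hy
    have : fderiv ℝ (grad u) y = κ y • ContinuousLinearMap.id ℝ (E n) := by
      ext1 a
      refine ext_inner_right ℝ fun b ↦ ?_
      rw [inner_fderiv_grad (du2 y hy), hess y hy, norm_fderiv_eq, hκ]
      simp [real_inner_smul_left, div_eq_mul_inv]
    rw [← this]
    exact (differentiableAt_grad (du2 y hy)).hasFDerivAt
  -- Since `D(∇u) = κ • id`, both terms of the quotient rule equal `κ du / u`, with opposite signs.
  have dκ : ∀ y ∈ s, HasFDerivAt κ (0 : (E n) →L[ℝ] ℝ) y := by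
    intro y hy
    have hp := hpos y hy
    have h1 := ((dg y hy).inner ℝ (dg y hy)).const_add 1
    have h2 := (hasDerivAt_inv (show 2 * u y ≠ 0 by positivity)).comp_hasFDerivAt y
      ((du y hy).hasFDerivAt.const_mul 2)
    have h3 := h1.mul h2
    convert! h3 using 1
    ext1 a
    have e1 : ⟪a, grad u y⟫ = fderiv ℝ u y a := by rw [real_inner_comm, inner_grad]
    simp only [zero_apply, add_apply, smul_apply, ContinuousLinearMap.comp_apply,
      ContinuousLinearMap.prod_apply, fderivInnerCLM_apply, smul_eq_mul, Function.comp_apply,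
      ContinuousLinearMap.id_apply, real_inner_smul_left, real_inner_smul_right, e1, inner_grad, hκ]
    field_simp
    ring
  have cκ : ∀ y ∈ s, κ y = κ y₀ := fun y hy ↦
    hs.is_const_of_fderiv_eq_zero hs' (fun z hz ↦ (dκ z hz).differentiableAt.differentiableWithinAt)
      (fun z hz ↦ (dκ z hz).fderiv) hy hy₀
  have dd : ∀ y ∈ s, HasFDerivAt (fun y ↦ grad u y - κ y₀ • y) (0 : (E n) →L[ℝ] (E n)) y := by
    intro y hy
    have := (dg y hy).fun_sub ((hasFDerivAt_id y).fun_const_smul (κ y₀))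
    rw [cκ y hy, sub_self] at this
    exact this
  have cd : ∀ y ∈ s, grad u y - κ y₀ • y = grad u y₀ - κ y₀ • y₀ := fun y hy ↦
    hs.is_const_of_fderiv_eq_zero hs' (fun z hz ↦ (dd z hz).differentiableAt.differentiableWithinAt)
      (fun z hz ↦ (dd z hz).fderiv) hy hy₀
  have hκpos : 0 < κ y₀ := by
    have := hpos y₀ hy₀
    have := real_inner_self_nonneg (x := grad u y₀)
    simp only [hκ]
    positivity
  -- The centre `p` is chosen so that `∇u = c (y - p)`; then `c = (1 + |∇u|²)/(2u)` can be solved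
  -- for `u`.
  refine ⟨κ y₀, hκpos, -((κ y₀)⁻¹ • (grad u y₀ - κ y₀ • y₀)), fun y hy ↦ ?_⟩
  have e1 : grad u y = κ y₀ • (y - -((κ y₀)⁻¹ • (grad u y₀ - κ y₀ • y₀))) := by
    rw [← cd y hy, smul_sub, smul_neg, smul_inv_smul₀ hκpos.ne']
    abel
  have e2 := cκ y hy
  have hp := hpos y hy
  rw [← mul_pow, ← Real.norm_of_nonneg hκpos.le, ← norm_smul, Real.norm_of_nonneg hκpos.le, ← e1,
    ← real_inner_self_eq_norm_sq]
  simp only [hκ] at e2 ⊢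
  rw [← e2]
  have := real_inner_self_nonneg (x := grad u y)
  field_simp

/-- A pure-trace Hessian leaves only the constant curvature tensor; the summand `1` in `1 + |∇u|²`
is the value of the curvature. -/
theorem IsConformalNear.riemannMap_eq {G : (E n) → Matrix (Fin n) (Fin n) ℝ} {u : (E n) → ℝ}
    {y : E n} (hG : IsConformalNear G u y) (hess : ∀ a b,
      fderiv ℝ (fderiv ℝ u) y a b = (1 + ‖fderiv ℝ u y‖ ^ 2) / (2 * u y) * ⟪a, b⟫) (a b c : E n) :
    riemannMap G y a b c = metricForm G y b c • a - metricForm G y a c • b := by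
  have hpos := hG.pos.self_of_nhds
  refine ext_inner_right ℝ fun d ↦ ?_
  rw [hG.inner_riemannMap, hess, hess, hess, hess, inner_sub_left, real_inner_smul_left,
    real_inner_smul_left, hG.metricForm_eq, hG.metricForm_eq]
  field_simp
  ring

end RoundMetric

/-! ### Inverse stereographic projection -/

section Stereographic

variable {V W : Type*} [NormedAddCommGroup V] [InnerProductSpace ℝ V] [NormedAddCommGroup W]
  [InnerProductSpace ℝ W]

local notation "⟪" x ", " y "⟫" => inner ℝ x y

/-- Inverse stereographic projection, precomposed with a linear isometry onto a hyperplane. -/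
def stereoInv (L : V →ₗᵢ[ℝ] W) (v : W) (w : V) : W :=
  (‖w‖ ^ 2 + 4)⁻¹ • ((4 : ℝ) • L w + (‖w‖ ^ 2 - 4) • v)

variable {L : V →ₗᵢ[ℝ] W} {v : W}

/-- In this form a single scalar factor multiplies an affine map, which keeps the derivative and the
chordal distance short. -/
theorem stereoInv_eq (L : V →ₗᵢ[ℝ] W) (v : W) (w : V) :
    stereoInv L v w = v + (‖w‖ ^ 2 + 4)⁻¹ • ((4 : ℝ) • L w - (8 : ℝ) • v) := by
  have h : (‖w‖ ^ 2 + 4)⁻¹ * (‖w‖ ^ 2 + 4) = 1 := inv_mul_cancel₀ (by positivity)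
  rw [stereoInv, show ‖w‖ ^ 2 - 4 = (‖w‖ ^ 2 + 4) - 8 by ring, sub_smul, ← add_sub_assoc,
    smul_sub, smul_sub, smul_add, smul_smul (_⁻¹) (_ + _), h, one_smul]
  abel

theorem hasFDerivAt_stereoInv (L : V →ₗᵢ[ℝ] W) (v : W) (w : V) :
    ∃ D : V →L[ℝ] W, HasFDerivAt (stereoInv L v) D w ∧ ∀ a, D a =
      (4 * (‖w‖ ^ 2 + 4)⁻¹) • L a - (2 * ⟪w, a⟫ * ((‖w‖ ^ 2 + 4) ^ 2)⁻¹) •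
        ((4 : ℝ) • L w - (8 : ℝ) • v) := by
  have h1 := (hasStrictFDerivAt_norm_sq w).hasFDerivAt.add_const 4
  have h2 := (hasDerivAt_inv (show ‖w‖ ^ 2 + 4 ≠ 0 by positivity)).comp_hasFDerivAt w h1
  have h3 := (L.toContinuousLinearMap.hasFDerivAt (x := w)).fun_const_smul (4 : ℝ)
  have h4 := (h2.smul (h3.sub_const ((8 : ℝ) • v))).const_add v
  refine ⟨_, h4.congr_of_eventuallyEq (.of_forall fun z ↦ stereoInv_eq L v z), fun a ↦ ?_⟩
  simp [smul_smul, mul_comm, sub_eq_add_neg]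
  abel

theorem norm_stereoInv (hv : ‖v‖ = 1) (hL : ∀ x, ⟪L x, v⟫ = 0) (w : V) : ‖stereoInv L v w‖ = 1 := by
  have hvv : ⟪v, v⟫ = 1 := by rw [real_inner_self_eq_norm_sq, hv, one_pow]
  rw [← sq_eq_sq₀ (norm_nonneg _) zero_le_one, ← real_inner_self_eq_norm_sq, stereoInv]
  simp only [inner_add_left, inner_add_right, real_inner_smul_left, real_inner_smul_right,
    LinearIsometry.inner_map_map, real_inner_comm (L _) v, hL, hvv]
  simp only [real_inner_self_eq_norm_sq]
  field_simp
  ring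

theorem inner_fderiv_stereoInv (hv : ‖v‖ = 1) (hL : ∀ x, ⟪L x, v⟫ = 0) (w a b : V) :
    ⟪fderiv ℝ (stereoInv L v) w a, fderiv ℝ (stereoInv L v) w b⟫ =
      16 * ((‖w‖ ^ 2 + 4) ^ 2)⁻¹ * ⟪a, b⟫ := by
  have hvv : ⟪v, v⟫ = 1 := by rw [real_inner_self_eq_norm_sq, hv, one_pow]
  obtain ⟨D, hD, hD'⟩ := hasFDerivAt_stereoInv L v w
  rw [hD.fderiv, hD', hD']
  simp only [inner_sub_left, inner_sub_right, real_inner_smul_left, real_inner_smul_right,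
    LinearIsometry.inner_map_map, real_inner_comm (L _) v, hL, hvv, real_inner_comm w a]
  simp only [real_inner_self_eq_norm_sq]
  field_simp
  ring

/-- The squared chordal distance is `16 / ((|x|² + 4)(|y|² + 4))` times `|x - y|²`, and this factor
is at most one. Hence an extension radius on the sphere is also one in stereographic coordinates. -/
theorem dist_stereoInv_le (hv : ‖v‖ = 1) (hL : ∀ x, ⟪L x, v⟫ = 0) (x y : V) :
    dist (stereoInv L v x) (stereoInv L v y) ≤ dist x y := by
  have hvv : ⟪v, v⟫ = 1 := by rw [real_inner_self_eq_norm_sq, hv, one_pow]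
  have key : dist (stereoInv L v x) (stereoInv L v y) ^ 2 =
      16 * ((‖x‖ ^ 2 + 4) * (‖y‖ ^ 2 + 4))⁻¹ * dist x y ^ 2 := by
    rw [dist_eq_norm, dist_eq_norm, norm_sub_sq_real x y,
      ← real_inner_self_eq_norm_sq (stereoInv L v x - _), stereoInv_eq, stereoInv_eq]
    simp only [inner_sub_left, inner_sub_right, inner_add_left, inner_add_right,
      real_inner_smul_left, real_inner_smul_right,
      LinearIsometry.inner_map_map, real_inner_comm (L _) v, hL, hvv, real_inner_comm x y]
    simp only [real_inner_self_eq_norm_sq]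
    field_simp
    ring
  rw [← sq_le_sq₀ dist_nonneg dist_nonneg, key]
  refine mul_le_of_le_one_left (sq_nonneg _) ?_
  rw [← div_eq_mul_inv, div_le_one (by positivity)]
  nlinarith [sq_nonneg ‖x‖, sq_nonneg ‖y‖, mul_nonneg (sq_nonneg ‖x‖) (sq_nonneg ‖y‖)]

theorem contDiff_stereoInv (L : V →ₗᵢ[ℝ] W) (v : W) : ContDiff ℝ ∞ (stereoInv L v) := by
  have h₀ : ContDiff ℝ ∞ fun w : V ↦ ‖w‖ ^ 2 := contDiff_norm_sq ℝ
  refine ((h₀.add contDiff_const).inv fun x ↦ by positivity).smul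
    ((L.contDiff.const_smul (4 : ℝ)).add ((h₀.sub contDiff_const).smul contDiff_const))

end Stereographic

/-! ### Isometries and Killing fields of pieces of the sphere are linear -/

section Rigidity

open Filter Topology

variable {n : ℕ} {W : Type*} [NormedAddCommGroup W] [InnerProductSpace ℝ W]

local notation "E" n => EuclideanSpace ℝ (Fin n)
local notation "⟪" x ", " y "⟫" => inner ℝ x y

/-- The rank one operators `w ↦ ⟪a, w⟫ b`, bilinear in `a` and `b`. -/
def outerProd (W : Type*) [NormedAddCommGroup W] [InnerProductSpace ℝ W] :
    W →L[ℝ] W →L[ℝ] (W →L[ℝ] W) :=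
  (ContinuousLinearMap.smulRightL ℝ W W).comp (LinearMap.mkContinuous₂ (innerₗ W) 1 fun x y ↦ by
    simpa using norm_inner_le_norm (𝕜 := ℝ) x y)

theorem outerProd_apply (a b w : W) : outerProd W a b w = ⟪a, w⟫ • b := by
  simp [outerProd]

theorem differentiableAt_outerProd {V : Type*} [NormedAddCommGroup V] [NormedSpace ℝ V]
    {p q : V → W} {y : V} (hp : DifferentiableAt ℝ p y) (hq : DifferentiableAt ℝ q y) :
    DifferentiableAt ℝ (fun z ↦ outerProd W (p z) (q z)) y :=
  ((differentiableAt_comp_and_fderiv (W := W →L[ℝ] W →L[ℝ] W) (outerProd W)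
    (outerProd W).differentiableAt hp).1).clm_apply hq

/-- `s` parametrises a piece of the unit sphere, conformally with factor `ρ`. -/
structure IsSphereParam (s : (E n) → W) (ρ : (E n) → ℝ) (Ω : Set (E n)) : Prop where
  smooth : ∀ y ∈ Ω, ContDiffAt ℝ ∞ s y
  norm_eq : ∀ y ∈ Ω, ‖s y‖ = 1
  factor_smooth : ∀ y ∈ Ω, ContDiffAt ℝ ∞ ρ y
  factor_pos : ∀ y ∈ Ω, 0 < ρ y
  inner_fderiv : ∀ y ∈ Ω, ∀ a b, ⟪fderiv ℝ s y a, fderiv ℝ s y b⟫ = ρ y * ⟪a, b⟫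

theorem inner_fderiv_self_of_norm_eq {V : Type*} [NormedAddCommGroup V] [NormedSpace ℝ V]
    {s : V → W} {Ω : Set V} (hΩ : IsOpen Ω) {y : V} (hy : y ∈ Ω) (hs : DifferentiableAt ℝ s y)
    (hn : ∀ y ∈ Ω, ‖s y‖ = 1) (a : V) : ⟪s y, fderiv ℝ s y a⟫ = 0 := by
  have e : (fun z ↦ ⟪s z, s z⟫) =ᶠ[𝓝 y] fun _ ↦ (1 : ℝ) := by
    filter_upwards [hΩ.mem_nhds hy] with z hz
    rw [real_inner_self_eq_norm_sq, hn z hz, one_pow]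
  have e := congrArg (fun L : V →L[ℝ] ℝ ↦ L a) e.fderiv_eq
  simp only [fderiv_inner_apply ℝ hs hs, fderiv_fun_const, Pi.zero_apply, zero_apply] at e
  rw [real_inner_comm (s y)] at e
  linarith

namespace IsSphereParam

variable {s : (E n) → W} {ρ : (E n) → ℝ} {Ω : Set (E n)}

theorem differentiableAt (hs : IsSphereParam s ρ Ω) {y : E n} (hy : y ∈ Ω) :
    DifferentiableAt ℝ s y := (hs.smooth y hy).differentiableAt (by simp)

theorem inner_self (hs : IsSphereParam s ρ Ω) {y : E n} (hy : y ∈ Ω) : ⟪s y, s y⟫ = 1 := by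
  rw [real_inner_self_eq_norm_sq, hs.norm_eq y hy, one_pow]

theorem inner_fderiv_self (hs : IsSphereParam s ρ Ω) (hΩ : IsOpen Ω) {y : E n} (hy : y ∈ Ω)
    (a : E n) : ⟪s y, fderiv ℝ s y a⟫ = 0 :=
  inner_fderiv_self_of_norm_eq hΩ hy (hs.differentiableAt hy) hs.norm_eq a

/-- The position vector is orthogonal to the injective image of `Ds`, and the dimensions add up to
`n + 1`. -/
theorem span [FiniteDimensional ℝ W] (hs : IsSphereParam s ρ Ω) (hΩ : IsOpen Ω)
    (hdim : Module.finrank ℝ W = n + 1) {y : E n} (hy : y ∈ Ω) (w : W) :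
    ∃ (r : ℝ) (b : E n), w = r • s y + fderiv ℝ s y b := by
  let Φ : (ℝ × (E n)) →ₗ[ℝ] W :=
    (LinearMap.toSpanSingleton ℝ W (s y)).coprod (fderiv ℝ s y : (E n) →ₗ[ℝ] W)
  have hΦ : ∀ r b, Φ (r, b) = r • s y + fderiv ℝ s y b := fun r b ↦ by simp [Φ]
  have hinj : Function.Injective Φ := by
    rw [injective_iff_map_eq_zero]
    rintro ⟨r, b⟩ h
    rw [hΦ] at h
    have h1 := congrArg (fun v ↦ ⟪s y, v⟫) h
    have h2 := congrArg (fun v ↦ ⟪fderiv ℝ s y b, v⟫) h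
    simp only [inner_add_right, real_inner_smul_right, hs.inner_self hy,
      hs.inner_fderiv_self hΩ hy, inner_zero_right, mul_one, add_zero] at h1
    simp only [h1, zero_smul, zero_add, inner_zero_right, hs.inner_fderiv y hy,
      mul_eq_zero, (hs.factor_pos y hy).ne', false_or, inner_self_eq_zero] at h2
    rw [h1, h2]
    rfl
  have hsurj := (LinearMap.injective_iff_surjective_of_finrank_eq_finrank
    (by rw [hdim, Module.finrank_prod, finrank_euclideanSpace_fin, Module.finrank_self]; ring)).1
      hinj
  obtain ⟨⟨r, b⟩, h⟩ := hsurj w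
  exact ⟨r, b, by rw [← h, hΦ]⟩

end IsSphereParam

/-- The linear map sending the frame `(s, ∂ᵢ s)` to `(t, ∂ᵢ t)`. -/
def frameMap (s t : (E n) → W) (ρ : (E n) → ℝ) (y : E n) : W →L[ℝ] W :=
  outerProd W (s y) (t y) + ∑ i, outerProd W (fderiv ℝ s y (EuclideanSpace.single i 1))
    ((ρ y)⁻¹ • fderiv ℝ t y (EuclideanSpace.single i 1))

variable {s t : (E n) → W} {ρ : (E n) → ℝ} {Ω : Set (E n)}

theorem frameMap_apply_self (hs : IsSphereParam s ρ Ω) (hΩ : IsOpen Ω) {y : E n} (hy : y ∈ Ω) :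
    frameMap s t ρ y (s y) = t y := by
  simp only [frameMap, add_apply, sum_apply, outerProd_apply, hs.inner_self hy, one_smul]
  simp [real_inner_comm (s y), hs.inner_fderiv_self hΩ hy]

theorem frameMap_apply_fderiv (hs : IsSphereParam s ρ Ω) (hΩ : IsOpen Ω) {y : E n} (hy : y ∈ Ω)
    (b : E n) : frameMap s t ρ y (fderiv ℝ s y b) = fderiv ℝ t y b := by
  have hρ := (hs.factor_pos y hy).ne'
  simp only [frameMap, add_apply, sum_apply, outerProd_apply, hs.inner_fderiv_self hΩ hy,
    zero_smul, zero_add, hs.inner_fderiv y hy, smul_smul]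
  conv_rhs => rw [← sum_smul_single b]
  rw [map_sum]
  refine Finset.sum_congr rfl fun i _ ↦ ?_
  rw [map_smul, EuclideanSpace.inner_single_left]
  congr 1
  field_simp
  simp

theorem differentiableAt_frameMap (hs : IsSphereParam s ρ Ω) {y : E n} (hy : y ∈ Ω)
    (ht : ContDiffAt ℝ ∞ t y) : DifferentiableAt ℝ (frameMap s t ρ) y := by
  have hd : ∀ {f : (E n) → W}, ContDiffAt ℝ ∞ f y → ∀ v, DifferentiableAt ℝ
      (fun z ↦ fderiv ℝ f z v) y := fun hf v ↦
    (fderiv_apply_const' ((contDiffAt_fderiv hf).differentiableAt (by simp)) 0 v).1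
  refine (differentiableAt_outerProd (hs.differentiableAt hy) (ht.differentiableAt (by simp))).add
    (DifferentiableAt.fun_sum fun i _ ↦ differentiableAt_outerProd (hd (hs.smooth y hy) _) ?_)
  exact (((hs.factor_smooth y hy).inv (hs.factor_pos y hy).ne').differentiableAt (by simp)).smul
    (hd ht _)

/-- The common core of both rigidity statements. Differentiating `A s = t` and `A Ds = Dt` shows
that `DA` kills `s` and that `DA_c(∂_b s)` is symmetric in `b` and `c`; a trilinear form symmetric
in one pair of slots and skew in an overlapping pair is zero. The map `P` covers isometries (`P =
A`) and Killing fields (`P = id`) at once. -/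
theorem fderiv_eq_zero_of_skew {A : (E n) → W →L[ℝ] W} {y : E n}
    (hA : DifferentiableAt ℝ A y) (hs : ContDiffAt ℝ ∞ s y) (ht : ContDiffAt ℝ ∞ t y)
    (h1 : ∀ᶠ z in 𝓝 y, A z (s z) = t z)
    (h2 : ∀ᶠ z in 𝓝 y, ∀ b, A z (fderiv ℝ s z b) = fderiv ℝ t z b)
    (hspan : ∀ w, ∃ (r : ℝ) (b : E n), w = r • s y + fderiv ℝ s y b)
    (P : W →L[ℝ] W) (hP : Function.Surjective P)
    (hskew : ∀ c w w', ⟪fderiv ℝ A y c w, P w'⟫ + ⟪P w, fderiv ℝ A y c w'⟫ = 0) :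
    fderiv ℝ A y = 0 := by
  have hs1 : DifferentiableAt ℝ s y := hs.differentiableAt (by simp)
  have hs2 : DifferentiableAt ℝ (fderiv ℝ s) y := (contDiffAt_fderiv hs).differentiableAt (by simp)
  have ht2 : DifferentiableAt ℝ (fderiv ℝ t) y := (contDiffAt_fderiv ht).differentiableAt (by simp)
  have k1 : ∀ c, fderiv ℝ A y c (s y) = 0 := by
    intro c
    have e : (fun z ↦ A z (s z)) =ᶠ[𝓝 y] t := h1
    have e := congrArg (fun L : (E n) →L[ℝ] W ↦ L c) e.fderiv_eq
    simp only [fderiv_clm_apply' hA hs1, h2.self_of_nhds c] at e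
    simpa using e
  have k2 : ∀ c b, fderiv ℝ A y c (fderiv ℝ s y b) = fderiv ℝ A y b (fderiv ℝ s y c) := by
    have : ∀ c b, fderiv ℝ A y c (fderiv ℝ s y b) =
        fderiv ℝ (fderiv ℝ t) y c b - A y (fderiv ℝ (fderiv ℝ s) y c b) := by
      intro c b
      have e : (fun z ↦ A z (fderiv ℝ s z b)) =ᶠ[𝓝 y] fun z ↦ fderiv ℝ t z b :=
        h2.mono fun z hz ↦ hz b
      have e := congrArg (fun L : (E n) →L[ℝ] W ↦ L c) e.fderiv_eq
      simp only [fderiv_clm_apply' hA (fderiv_apply_const' hs2 c b).1,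
        (fderiv_apply_const' hs2 c b).2, (fderiv_apply_const' ht2 c b).2] at e
      rw [← e]
      abel
    intro c b
    rw [this, this, fderiv_fderiv_symm ht, fderiv_fderiv_symm hs]
  -- Symmetric in `(c, b)` and skew in `(b, d)`: three alternating swaps change the sign.
  have k3 : ∀ c b d, ⟪fderiv ℝ A y c (fderiv ℝ s y b), P (fderiv ℝ s y d)⟫ = 0 := by
    intro c b d
    have sk : ∀ c b d, ⟪fderiv ℝ A y c (fderiv ℝ s y b), P (fderiv ℝ s y d)⟫ =
        -⟪fderiv ℝ A y c (fderiv ℝ s y d), P (fderiv ℝ s y b)⟫ := fun c b d ↦ by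
      have := hskew c (fderiv ℝ s y b) (fderiv ℝ s y d)
      rw [real_inner_comm _ (P _)] at this
      linarith
    have a1 := sk c b d
    have a2 := sk d c b
    have a3 := sk b d c
    rw [k2 c d] at a1
    rw [k2 d b] at a2
    rw [k2 b c] at a3
    linarith
  have k4 : ∀ c b, fderiv ℝ A y c (fderiv ℝ s y b) = 0 := by
    intro c b
    refine ext_inner_right ℝ fun w ↦ ?_
    obtain ⟨w, rfl⟩ := hP w
    obtain ⟨r, d, rfl⟩ := hspan w
    -- The component along `P s` is moved by skewness onto `DA s`, which vanishes.
    have := hskew c (fderiv ℝ s y b) (s y)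
    rw [k1, inner_zero_right, add_zero] at this
    simp [inner_add_right, real_inner_smul_right, k3, this]
  ext c w
  obtain ⟨r, d, rfl⟩ := hspan w
  simp [k1, k4]

variable [FiniteDimensional ℝ W]

theorem frameMap_eq_of_skew (hs : IsSphereParam s ρ Ω) (hΩ : IsOpen Ω) (hΩ' : IsPreconnected Ω)
    (hdim : Module.finrank ℝ W = n + 1) (ht : ∀ y ∈ Ω, ContDiffAt ℝ ∞ t y)
    (hskew : ∀ y ∈ Ω, ∃ P : W →L[ℝ] W, Function.Surjective P ∧ ∀ c w w',
      ⟪fderiv ℝ (frameMap s t ρ) y c w, P w'⟫ +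
        ⟪P w, fderiv ℝ (frameMap s t ρ) y c w'⟫ = 0) {y₀ : E n} (hy₀ : y₀ ∈ Ω) :
    ∀ y ∈ Ω, t y = frameMap s t ρ y₀ (s y) := by
  intro y hy
  rw [← frameMap_apply_self (t := t) hs hΩ hy]
  congr 1
  have d : ∀ z ∈ Ω, DifferentiableAt ℝ (frameMap s t ρ) z := fun z hz ↦
    differentiableAt_frameMap hs hz (ht z hz)
  refine hΩ.is_const_of_fderiv_eq_zero hΩ' (fun z hz ↦ (d z hz).differentiableWithinAt)
    (fun z hz ↦ ?_) hy hy₀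
  obtain ⟨P, hP, hPs⟩ := hskew z hz
  exact fderiv_eq_zero_of_skew (d z hz) (hs.smooth z hz) (ht z hz)
    ((hΩ.eventually_mem hz).mono fun w hw ↦ frameMap_apply_self hs hΩ hw)
    ((hΩ.eventually_mem hz).mono fun w hw b ↦ frameMap_apply_fderiv hs hΩ hw b)
    (hs.span hΩ hdim hz) P hP hPs

/-- Isometries between connected pieces of the sphere are restrictions of linear isometries. -/
theorem exists_linearIsometryEquiv (hs : IsSphereParam s ρ Ω) (hΩ : IsOpen Ω)
    (hΩ' : IsPreconnected Ω) (hne : Ω.Nonempty) (hdim : Module.finrank ℝ W = n + 1)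
    (ht : ∀ y ∈ Ω, ContDiffAt ℝ ∞ t y) (htn : ∀ y ∈ Ω, ‖t y‖ = 1)
    (hts : ∀ y ∈ Ω, ∀ a b, ⟪fderiv ℝ t y a, fderiv ℝ t y b⟫ =
      ⟪fderiv ℝ s y a, fderiv ℝ s y b⟫) :
    ∃ A : W ≃ₗᵢ[ℝ] W, ∀ y ∈ Ω, t y = A (s y) := by
  obtain ⟨y₀, hy₀⟩ := hne
  -- The frames `(s, ∂ᵢs)` and `(t, ∂ᵢt)` have the same Gram matrix, so the map between them is
  -- orthogonal.
  have isom : ∀ y ∈ Ω, ∀ w w', ⟪frameMap s t ρ y w, frameMap s t ρ y w'⟫ = ⟪w, w'⟫ := by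
    intro y hy w w'
    have ht0 : ∀ b, ⟪t y, fderiv ℝ t y b⟫ = 0 := fun b ↦
      inner_fderiv_self_of_norm_eq hΩ hy ((ht y hy).differentiableAt (by simp)) htn b
    obtain ⟨r, b, rfl⟩ := hs.span hΩ hdim hy w
    obtain ⟨r', b', rfl⟩ := hs.span hΩ hdim hy w'
    simp only [map_add, map_smul, frameMap_apply_self hs hΩ hy, frameMap_apply_fderiv hs hΩ hy,
      inner_add_left, inner_add_right, real_inner_smul_left, real_inner_smul_right, ht0,
      hs.inner_fderiv_self hΩ hy, real_inner_comm (t y) (fderiv ℝ t y _),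
      real_inner_comm (s y) (fderiv ℝ s y _), hs.inner_self hy, hts y hy]
    rw [real_inner_self_eq_norm_sq, htn y hy, one_pow]
  have toIsom : ∀ y ∈ Ω, ∃ A : W ≃ₗᵢ[ℝ] W, ∀ w, A w = frameMap s t ρ y w := fun y hy ↦
    ⟨LinearIsometry.toLinearIsometryEquiv
      (LinearMap.isometryOfInner (frameMap s t ρ y : W →ₗ[ℝ] W) (isom y hy)) rfl, fun w ↦ rfl⟩
  obtain ⟨A, hA⟩ := toIsom y₀ hy₀
  refine ⟨A, fun y hy ↦ ?_⟩
  rw [hA]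
  refine frameMap_eq_of_skew hs hΩ hΩ' hdim ht (fun z hz ↦ ?_) hy₀ y hy
  obtain ⟨B, hB⟩ := toIsom z hz
  -- For an orthogonal `A`, differentiating `⟪A w, A w'⟫ = ⟪w, w'⟫` gives the skewness condition
  -- with `P = A`, which is surjective.
  refine ⟨frameMap s t ρ z, fun w ↦ ⟨B.symm w, by rw [← hB]; simp⟩, fun c w w' ↦ ?_⟩
  have e : (fun z ↦ ⟪frameMap s t ρ z w, frameMap s t ρ z w'⟫) =ᶠ[𝓝 z] fun _ ↦ ⟪w, w'⟫ :=
    (hΩ.eventually_mem hz).mono fun z hz ↦ isom z hz w w'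
  have e := congrArg (fun L : (E n) →L[ℝ] ℝ ↦ L c) e.fderiv_eq
  have d := differentiableAt_frameMap hs hz (ht z hz)
  simp only [fderiv_inner_apply ℝ (fderiv_apply_const' d c w).1 (fderiv_apply_const' d c w').1,
    (fderiv_apply_const' d c w).2, (fderiv_apply_const' d c w').2, fderiv_fun_const,
    Pi.zero_apply, zero_apply] at e
  linarith

/-- Killing fields on connected pieces of the sphere are restrictions of skew linear maps. -/
theorem exists_skew (hs : IsSphereParam s ρ Ω) (hΩ : IsOpen Ω)
    (hΩ' : IsPreconnected Ω) (hne : Ω.Nonempty) (hdim : Module.finrank ℝ W = n + 1)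
    (ht : ∀ y ∈ Ω, ContDiffAt ℝ ∞ t y) (hts : ∀ y ∈ Ω, ⟪t y, s y⟫ = 0)
    (hkill : ∀ y ∈ Ω, ∀ a b, ⟪fderiv ℝ t y a, fderiv ℝ s y b⟫ +
      ⟪fderiv ℝ s y a, fderiv ℝ t y b⟫ = 0) :
    ∃ A : W →L[ℝ] W, (∀ w w', ⟪A w, w'⟫ + ⟪w, A w'⟫ = 0) ∧ ∀ y ∈ Ω, t y = A (s y) := by
  obtain ⟨y₀, hy₀⟩ := hne
  -- On the spanning frame, skewness amounts to tangency of `t`, the derivative of that condition,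
  -- and the Killing equation.
  have skew : ∀ y ∈ Ω, ∀ w w', ⟪frameMap s t ρ y w, w'⟫ + ⟪w, frameMap s t ρ y w'⟫ = 0 := by
    intro y hy w w'
    have ht0 : ∀ b, ⟪fderiv ℝ t y b, s y⟫ = -⟪t y, fderiv ℝ s y b⟫ := by
      intro b
      have e : (fun z ↦ ⟪t z, s z⟫) =ᶠ[𝓝 y] fun _ ↦ 0 :=
        (hΩ.eventually_mem hy).mono fun z hz ↦ hts z hz
      have e := congrArg (fun L : (E n) →L[ℝ] ℝ ↦ L b) e.fderiv_eq
      simp only [fderiv_inner_apply ℝ ((ht y hy).differentiableAt (by simp))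
        (hs.differentiableAt hy), fderiv_fun_const, Pi.zero_apply, zero_apply] at e
      linarith
    obtain ⟨r, b, rfl⟩ := hs.span hΩ hdim hy w
    obtain ⟨r', b', rfl⟩ := hs.span hΩ hdim hy w'
    simp only [map_add, map_smul, frameMap_apply_self hs hΩ hy, frameMap_apply_fderiv hs hΩ hy,
      inner_add_left, inner_add_right, real_inner_smul_left, real_inner_smul_right]
    rw [real_inner_comm (t y) (s y), hts y hy, real_inner_comm (fderiv ℝ t y b') (s y),
      real_inner_comm (t y) (fderiv ℝ s y b), ht0, ht0]
    linear_combination hkill y hy b b'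
  refine ⟨frameMap s t ρ y₀, skew y₀ hy₀, ?_⟩
  refine frameMap_eq_of_skew hs hΩ hΩ' hdim ht (fun z hz ↦ ?_) hy₀
  refine ⟨ContinuousLinearMap.id ℝ W, Function.surjective_id, fun c w w' ↦ ?_⟩
  have e : (fun z ↦ ⟪frameMap s t ρ z w, w'⟫ + ⟪w, frameMap s t ρ z w'⟫) =ᶠ[𝓝 z] fun _ ↦ 0 :=
    (hΩ.eventually_mem hz).mono fun z hz ↦ skew z hz w w'
  have e := congrArg (fun L : (E n) →L[ℝ] ℝ ↦ L c) e.fderiv_eq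
  have d := differentiableAt_frameMap hs hz (ht z hz)
  have d1 := fderiv_apply_const' d c w
  have d2 := fderiv_apply_const' d c w'
  beta_reduce at e
  rw [fderiv_fun_add (d1.1.inner ℝ (differentiableAt_const _))
    ((differentiableAt_const _).inner ℝ d2.1)] at e
  simpa only [add_apply, fderiv_inner_apply ℝ d1.1 (differentiableAt_const (c := w')),
    fderiv_inner_apply ℝ (differentiableAt_const (c := w)) d2.1, d1.2, d2.2, fderiv_fun_const,
    Pi.zero_apply, zero_apply, inner_zero_right, inner_zero_left, zero_add, add_zero,
    ContinuousLinearMap.id_apply] using e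

end Rigidity

/-! ### Metrics and vector fields in charts -/

section Charts

set_option linter.unusedSectionVars false

open Filter Topology

variable {n : ℕ} {M : Type*} [TopologicalSpace M] [ChartedSpace (EuclideanSpace ℝ (Fin n)) M]
  [IsManifold (𝓡 n) ∞ M]

local notation "E" n => EuclideanSpace ℝ (Fin n)
local notation "⟪" x ", " y "⟫" => inner ℝ x y

variable {φ ψ : OpenPartialHomeomorph M (EuclideanSpace ℝ (Fin n))}

theorem mdifferentiable_of_mem_maximalAtlas (hφ : φ ∈ IsManifold.maximalAtlas (𝓡 n) ∞ M) :
    φ.MDifferentiable (𝓡 n) (𝓡 n) :=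
  ⟨(contMDiffOn_of_mem_maximalAtlas hφ).mdifferentiableOn (by simp),
    (contMDiffOn_symm_of_mem_maximalAtlas hφ).mdifferentiableOn (by simp)⟩

/-- The differential of a chart, with values in `ℝⁿ`. -/
abbrev dChart (φ : OpenPartialHomeomorph M (EuclideanSpace ℝ (Fin n))) (x : M) :
    TangentSpace (𝓡 n) x →L[ℝ] E n := mvfderiv (𝓡 n) φ x

/-- The differential of the inverse of a chart. -/
abbrev dChartSymm (φ : OpenPartialHomeomorph M (EuclideanSpace ℝ (Fin n))) (y : E n) :
    (E n) →L[ℝ] TangentSpace (𝓡 n) (φ.symm y) := mfderiv (𝓡 n) (𝓡 n) φ.symm y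

theorem dChart_dChartSymm (hφ : φ ∈ IsManifold.maximalAtlas (𝓡 n) ∞ M) {y : E n}
    (hy : y ∈ φ.target) (a : E n) : dChart φ (φ.symm y) (dChartSymm φ y a) = a := by
  have h := (mdifferentiable_of_mem_maximalAtlas hφ).comp_symm_deriv hy
  exact congrArg (fun L ↦ L a) h

theorem dChartSymm_dChart (hφ : φ ∈ IsManifold.maximalAtlas (𝓡 n) ∞ M) {y : E n}
    (hy : y ∈ φ.target) (u : TangentSpace (𝓡 n) (φ.symm y)) :
    dChartSymm φ y (dChart φ (φ.symm y) u) = u := by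
  have h := (mdifferentiable_of_mem_maximalAtlas hφ).symm_comp_deriv (φ.map_target hy)
  have h' := congrArg (fun L ↦ L u) h
  rw [φ.right_inv hy] at h'
  exact h'

theorem metricForm_metricCoeff (g : SmoothMetric n M) (y a b : E n) :
    metricForm (metricCoeff g φ) y a b =
      g.inner (φ.symm y) (dChartSymm φ y a) (dChartSymm φ y b) := by
  rw [metricForm_apply]
  conv_rhs => rw [← sum_smul_single a, ← sum_smul_single b]
  simp only [map_sum, map_smul, sum_apply, smul_apply, smul_eq_mul, Finset.mul_sum]
  rw [Finset.sum_comm]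
  refine Finset.sum_congr rfl fun i _ ↦ Finset.sum_congr rfl fun j _ ↦ ?_
  have h : metricCoeff g φ y j i = g.inner (φ.symm y)
    (dChartSymm φ y (EuclideanSpace.single j 1)) (dChartSymm φ y (EuclideanSpace.single i 1)) := rfl
  rw [h]
  ring

theorem metricForm_metricCoeff_dChart (g : SmoothMetric n M)
    (hφ : φ ∈ IsManifold.maximalAtlas (𝓡 n) ∞ M) {y : E n} (hy : y ∈ φ.target)
    (u v : TangentSpace (𝓡 n) (φ.symm y)) :
    metricForm (metricCoeff g φ) y (dChart φ (φ.symm y) u) (dChart φ (φ.symm y) v) =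
      g.inner (φ.symm y) u v := by
  rw [metricForm_metricCoeff, dChartSymm_dChart hφ hy, dChartSymm_dChart hφ hy]

theorem contDiffAt_transition (hφ : φ ∈ IsManifold.maximalAtlas (𝓡 n) ∞ M)
    (hψ : ψ ∈ IsManifold.maximalAtlas (𝓡 n) ∞ M) {z : E n} (hz : z ∈ ψ.target)
    (hz' : ψ.symm z ∈ φ.source) : ContDiffAt ℝ ∞ (φ ∘ ψ.symm) z :=
  contMDiffAt_iff_contDiffAt.1 ((contMDiffAt_of_mem_maximalAtlas hφ hz').comp z
    (contMDiffAt_symm_of_mem_maximalAtlas hψ hz))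

theorem fderiv_transition (hφ : φ ∈ IsManifold.maximalAtlas (𝓡 n) ∞ M)
    (hψ : ψ ∈ IsManifold.maximalAtlas (𝓡 n) ∞ M) {z : E n} (hz : z ∈ ψ.target)
    (hz' : ψ.symm z ∈ φ.source) (a : E n) :
    fderiv ℝ (φ ∘ ψ.symm) z a = dChart φ (ψ.symm z) (dChartSymm ψ z a) := by
  have h := mfderiv_comp z ((mdifferentiable_of_mem_maximalAtlas hφ).mdifferentiableAt hz')
    ((mdifferentiable_of_mem_maximalAtlas hψ).mdifferentiableAt_symm hz)
  rw [mfderiv_eq_fderiv] at h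
  exact congrArg (fun L ↦ L a) h

theorem eventually_mem_overlap {z : E n} (hz : z ∈ ψ.target) (hz' : ψ.symm z ∈ φ.source) :
    ∀ᶠ w in 𝓝 z, w ∈ ψ.target ∧ ψ.symm w ∈ φ.source :=
  (ψ.open_target.eventually_mem hz).and
    ((ψ.continuousAt_symm hz).eventually (φ.open_source.eventually_mem hz'))

/-- The link to the coordinate calculus: every tensoriality statement for `IsPullbackNear` now
applies to transition maps. -/
theorem isPullbackNear_metricCoeff (g : SmoothMetric n M)
    (hφ : φ ∈ IsManifold.maximalAtlas (𝓡 n) ∞ M) (hψ : ψ ∈ IsManifold.maximalAtlas (𝓡 n) ∞ M)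
    {z : E n} (hz : z ∈ ψ.target) (hz' : ψ.symm z ∈ φ.source) :
    IsPullbackNear (metricCoeff g ψ) (metricCoeff g φ) (φ ∘ ψ.symm) z where
  smooth := (eventually_mem_overlap hz hz').mono fun w hw ↦ contDiffAt_transition hφ hψ hw.1 hw.2
  surjective := (eventually_mem_overlap hz hz').mono fun w hw a ↦ by
    obtain ⟨u, rfl⟩ :=
      (mdifferentiable_of_mem_maximalAtlas hφ).mfderiv_surjective hw.2 a
    refine ⟨dChart ψ (ψ.symm w) u, ?_⟩
    rw [fderiv_transition hφ hψ hw.1 hw.2, dChartSymm_dChart hψ hw.1]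
    rfl
  eq := (eventually_mem_overlap hz hz').mono fun w hw a b ↦ by
    rw [fderiv_transition hφ hψ hw.1 hw.2, fderiv_transition hφ hψ hw.1 hw.2,
      metricForm_metricCoeff]
    have h := metricForm_metricCoeff_dChart g hφ (y := φ (ψ.symm w)) (φ.map_source hw.2)
    rw [φ.left_inv hw.2] at h
    exact (h _ _).symm

theorem fderiv_transition_fieldCoeff (X : ∀ x : M, TangentSpace (𝓡 n) x)
    (hφ : φ ∈ IsManifold.maximalAtlas (𝓡 n) ∞ M) (hψ : ψ ∈ IsManifold.maximalAtlas (𝓡 n) ∞ M)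
    {z : E n} (hz : z ∈ ψ.target) (hz' : ψ.symm z ∈ φ.source) :
    fderiv ℝ (φ ∘ ψ.symm) z (fieldCoeff X ψ z) = fieldCoeff X φ ((φ ∘ ψ.symm) z) := by
  rw [fderiv_transition hφ hψ hz hz', fieldCoeff, dChartSymm_dChart hψ hz, fieldCoeff,
    Function.comp_apply, φ.left_inv hz']

theorem contDiffAt_fieldCoeff {X : ∀ x : M, TangentSpace (𝓡 n) x}
    (hX : ContMDiff (𝓡 n) (𝓡 n).tangent ∞ (fun x ↦ (⟨x, X x⟩ : TangentBundle (𝓡 n) M)))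
    (hφ : φ ∈ IsManifold.maximalAtlas (𝓡 n) ∞ M) {y : E n} (hy : y ∈ φ.target) :
    ContDiffAt ℝ ∞ (fieldCoeff X φ) y := by
  have h1 := (contMDiffOn_of_mem_maximalAtlas hφ).contMDiffOn_tangentMapWithin (m := ∞)
    (by simp) φ.open_source.uniqueMDiffOn
  have h2 : ContMDiffOn (𝓡 n) (𝓡 n).tangent ∞
      (fun y ↦ (⟨φ.symm y, X (φ.symm y)⟩ : TangentBundle (𝓡 n) M)) φ.target :=
    hX.comp_contMDiffOn (contMDiffOn_symm_of_mem_maximalAtlas hφ)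
  have h3 := (contMDiff_snd_tangentBundle_modelSpace (E n) (𝓡 n) (n := ∞)).comp_contMDiffOn
    (h1.comp h2 fun y hy ↦ φ.map_target hy)
  refine (contMDiffOn_iff_contDiffOn.1 (h3.congr fun z hz ↦ ?_)).contDiffAt
    (φ.open_target.mem_nhds hy)
  have h4 := mfderivWithin_of_isOpen (I := 𝓡 n) (I' := 𝓡 n) (f := φ) φ.open_source
    (φ.map_target hz)
  exact congrArg (fun L ↦ L (X (φ.symm z))) h4.symm

/-- Regularity passes from a chart where the matrix is explicit, such as a conformal one, to any
overlapping chart. Nondegeneracy uses that a surjective `Dκ` is injective in equal finite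
dimensions. -/
theorem IsPullbackNear.isMetricNear {G H : (E n) → Matrix (Fin n) (Fin n) ℝ} {κ : (E n) → (E n)}
    {y : E n} (hp : IsPullbackNear H G κ y) (hG : IsMetricNear G (κ y)) : IsMetricNear H y := by
  have hκ : ContinuousAt κ y := hp.smooth.self_of_nhds.continuousAt
  have hG' := hκ.eventually hG.eventually
  refine ⟨?_, ?_, ?_⟩
  · filter_upwards [hp.eventually, hG'] with z hz hGz i j
    have hsm := hz.smooth.self_of_nhds
    have e : (fun w ↦ H w i j) =ᶠ[𝓝 z] fun w ↦ ∑ k, ∑ l, G (κ w) k l *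
        (fderiv ℝ κ w (EuclideanSpace.single i 1) k *
          fderiv ℝ κ w (EuclideanSpace.single j 1) l) := hz.eq.mono fun w hw ↦ by
      have := hw (EuclideanSpace.single i 1) (EuclideanSpace.single j 1)
      rwa [metricForm_single, metricForm_apply] at this
    refine ContDiffAt.congr_of_eventuallyEq ?_ e
    have hd : ∀ i k, ContDiffAt ℝ ∞ (fun w ↦ fderiv ℝ κ w (EuclideanSpace.single i 1) k) z :=
      fun i k ↦ (EuclideanSpace.proj k : (E n) →L[ℝ] ℝ).contDiff.contDiffAt.comp z
        ((contDiffAt_fderiv hsm).clm_apply contDiffAt_const)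
    exact ContDiffAt.sum fun k _ ↦ ContDiffAt.sum fun l _ ↦
      ((hGz.smooth.self_of_nhds k l).comp z hsm).mul ((hd i k).mul (hd j l))
  · filter_upwards [hp.eq, hG'] with z hz hGz i j
    rw [← metricForm_single H, ← metricForm_single H, hz, hz, hGz.metricForm_symm]
  · filter_upwards [hp.eq, hp.surjective, hG'] with z hz hs hGz
    rw [← Matrix.isUnit_iff_isUnit_det, ← Matrix.mulVec_injective_iff_isUnit]
    refine (injective_iff_map_eq_zero (H z).mulVecLin).2 fun v hv ↦ ?_
    have h1 : ∀ a, metricForm H z a (WithLp.toLp 2 v) = 0 := fun a ↦ by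
      have : metricForm H z a (WithLp.toLp 2 v) = ∑ i, a i * (H z).mulVecLin v i := by
        rw [metricForm_apply]
        simp only [Matrix.mulVecLin_apply, Matrix.mulVec, dotProduct, Finset.mul_sum]
        exact Finset.sum_congr rfl fun i _ ↦ Finset.sum_congr rfl fun j _ ↦ by ring
      rw [this, hv]
      simp
    have h2 : fderiv ℝ κ z (WithLp.toLp 2 v) = 0 := by
      refine metricForm_nondegenerate hGz.isUnit_det.self_of_nhds fun b ↦ ?_
      obtain ⟨a, rfl⟩ := hs b
      rw [← hz, h1, map_zero]
    have hinj : Function.Injective (fderiv ℝ κ z : (E n) →ₗ[ℝ] (E n)) :=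
      LinearMap.injective_iff_surjective.2 hs
    have h3 : WithLp.toLp 2 v = (0 : E n) := hinj (by simpa using h2)
    simpa using congrArg WithLp.ofLp h3

end Charts

/-! ### The Sasakian structure in arbitrary and conformal charts -/

section SasakianCharts

open Filter Topology

set_option linter.unusedSectionVars false

variable {n : ℕ} {M : Type*} [TopologicalSpace M] [ChartedSpace (EuclideanSpace ℝ (Fin n)) M]
  [IsManifold (𝓡 n) ∞ M]

local notation "E" n => EuclideanSpace ℝ (Fin n)
local notation "⟪" x ", " y "⟫" => inner ℝ x y

variable {φ : OpenPartialHomeomorph M (EuclideanSpace ℝ (Fin n))}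

theorem metricForm_metricCoeff_apply (g : SmoothMetric n M)
    (hφ : φ ∈ IsManifold.maximalAtlas (𝓡 n) ∞ M) {x : M} (hx : x ∈ φ.source)
    (u v : TangentSpace (𝓡 n) x) :
    metricForm (metricCoeff g φ) (φ x) (dChart φ x u) (dChart φ x v) = g.inner x u v := by
  have h := metricForm_metricCoeff_dChart g hφ (y := φ x) (φ.map_source hx)
  rw [φ.left_inv hx] at h
  exact h u v

theorem dChart_surjective (hφ : φ ∈ IsManifold.maximalAtlas (𝓡 n) ∞ M) {x : M}
    (hx : x ∈ φ.source) : Function.Surjective (dChart φ x) :=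
  (mdifferentiable_of_mem_maximalAtlas hφ).mfderiv_surjective hx

/-- `ContinuousLinearMap.inverse` is the true inverse only for invertible maps; the differential of
a chart at its base point is one. -/
theorem components_ofComponents (x : M) (a : E n) : components x (ofComponents x a) = a := by
  have hψ := mdifferentiable_of_mem_maximalAtlas
    (IsManifold.chart_mem_maximalAtlas (I := 𝓡 n) (n := ∞) x)
  let e : TangentSpace (𝓡 n) x ≃L[ℝ] E n := hψ.mfderiv (mem_chart_source (E n) x)
  have he : mvfderiv (𝓡 n) (chartAt (E n) x) x = (e : TangentSpace (𝓡 n) x →L[ℝ] E n) := rfl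
  rw [components, ofComponents, he, ContinuousLinearMap.inverse_equiv]
  exact e.apply_symm_apply a

theorem components_curvature (g : SmoothMetric n M) (x : M) (u v w : TangentSpace (𝓡 n) x) :
    components x (curvature g x u v w) = riemannMap (metricAt g x) (chartAt (E n) x x)
      (components x u) (components x v) (components x w) :=
  components_ofComponents x _

theorem components_eq_fieldCoeff (ξ : ∀ x : M, TangentSpace (𝓡 n) x) (x : M) :
    fieldCoeff ξ (chartAt (E n) x) (chartAt (E n) x x) = components x (ξ x) := by
  rw [fieldCoeff, (chartAt (E n) x).left_inv (mem_chart_source (E n) x)]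
  rfl

variable {g : SmoothMetric n M} {ξ : ∀ x : M, TangentSpace (𝓡 n) x}

/-- The Sasakian condition in an arbitrary chart. -/
theorem IsSasakian.in_chart (hS : IsSasakian g ξ) (hφ : φ ∈ IsManifold.maximalAtlas (𝓡 n) ∞ M)
    {y : E n} (hy : y ∈ φ.target) (hG : IsMetricNear (metricCoeff g φ) y) :
    (∀ a c, riemannMap (metricCoeff g φ) y a (fieldCoeff ξ φ y) c =
      metricForm (metricCoeff g φ) y (fieldCoeff ξ φ y) c • a -
        metricForm (metricCoeff g φ) y a c • fieldCoeff ξ φ y) ∧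
    (∀ a b, fderiv ℝ (metricForm (metricCoeff g φ)) y (fieldCoeff ξ φ y) a b +
      metricForm (metricCoeff g φ) y (fderiv ℝ (fieldCoeff ξ φ) y a) b +
      metricForm (metricCoeff g φ) y a (fderiv ℝ (fieldCoeff ξ φ) y b) = 0) ∧
    metricForm (metricCoeff g φ) y (fieldCoeff ξ φ y) (fieldCoeff ξ φ y) = 1 := by
  -- The definitions test `x` only in its preferred chart `ψ`, so each condition is read at `ψ x`
  -- and transported by the transition map.
  obtain ⟨x, hx, rfl⟩ : ∃ x ∈ φ.source, φ x = y := ⟨φ.symm y, φ.map_target hy, φ.right_inv hy⟩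
  set ψ := chartAt (E n) x with hψdef
  have hψ : ψ ∈ IsManifold.maximalAtlas (𝓡 n) ∞ M := IsManifold.chart_mem_maximalAtlas x
  have hxψ : x ∈ ψ.source := mem_chart_source (E n) x
  have hz : ψ x ∈ ψ.target := ψ.map_source hxψ
  have hz' : ψ.symm (ψ x) ∈ φ.source := by rwa [ψ.left_inv hxψ]
  have hκ : (φ ∘ ψ.symm) (ψ x) = φ x := by rw [Function.comp_apply, ψ.left_inv hxψ]
  have hp := isPullbackNear_metricCoeff g hφ hψ hz hz'
  have hG' : IsMetricNear (metricCoeff g φ) ((φ ∘ ψ.symm) (ψ x)) := by rwa [hκ]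
  have hH := hp.isMetricNear hG'
  have hX := fderiv_transition_fieldCoeff ξ hφ hψ hz hz'
  have hsurj := hp.surjective.self_of_nhds
  have hcomp : fieldCoeff ξ ψ (ψ x) = components x (ξ x) := components_eq_fieldCoeff ξ x
  refine ⟨fun a' c' ↦ ?_, fun a' b' ↦ ?_, ?_⟩
  · obtain ⟨a, rfl⟩ := hsurj a'
    obtain ⟨c, rfl⟩ := hsurj c'
    obtain ⟨u, rfl⟩ := dChart_surjective hψ hxψ a
    obtain ⟨w, rfl⟩ := dChart_surjective hψ hxψ c
    have h1 := congrArg (components x) (hS.curvature_eq x u w)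
    rw [components_curvature] at h1
    have h2 : components x (g.inner x (ξ x) w • u - g.inner x u w • ξ x) =
        g.inner x (ξ x) w • components x u - g.inner x u w • components x (ξ x) := by
      simp only [components, map_sub, map_smul]
    rw [h2, ← hcomp] at h1
    have h3 := hp.riemannMap hH hG' (dChart ψ x u) (fieldCoeff ξ ψ (ψ x)) (dChart ψ x w)
    have h4 : riemannMap (metricCoeff g ψ) (ψ x) (dChart ψ x u) (fieldCoeff ξ ψ (ψ x))
      (dChart ψ x w) = _ := h1
    rw [h4, ← metricForm_metricCoeff_apply g hψ hxψ, ← metricForm_metricCoeff_apply g hψ hxψ,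
      hp.eq.self_of_nhds, hp.eq.self_of_nhds, map_sub, map_smul, map_smul] at h3
    have h5 : dChart ψ x (ξ x) = fieldCoeff ξ ψ (ψ x) := hcomp.symm
    have h6 : components x u = dChart ψ x u := rfl
    rw [h5, h6, hX, hκ] at h3
    exact h3.symm
  · obtain ⟨a, rfl⟩ := hsurj a'
    obtain ⟨b, rfl⟩ := hsurj b'
    have dX : DifferentiableAt ℝ (fieldCoeff ξ ψ) (ψ x) :=
      (contDiffAt_fieldCoeff hS.contMDiff hψ hz).differentiableAt (by simp)
    have dY : DifferentiableAt ℝ (fieldCoeff ξ φ) ((φ ∘ ψ.symm) (ψ x)) := by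
      rw [hκ]
      exact (contDiffAt_fieldCoeff hS.contMDiff hφ hy).differentiableAt (by simp)
    have h1 := hp.lieDerivative hH hG' dX dY ((eventually_mem_overlap hz hz').mono fun w hw ↦
      fderiv_transition_fieldCoeff ξ hφ hψ hw.1 hw.2) a b
    rw [hκ] at h1
    rw [← h1]
    have h2 : ∀ i j, fderiv ℝ (metricForm (metricCoeff g ψ)) (ψ x) (fieldCoeff ξ ψ (ψ x))
        (EuclideanSpace.single i 1) (EuclideanSpace.single j 1) +
        metricForm (metricCoeff g ψ) (ψ x) (fderiv ℝ (fieldCoeff ξ ψ) (ψ x)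
          (EuclideanSpace.single i 1)) (EuclideanSpace.single j 1) +
        metricForm (metricCoeff g ψ) (ψ x) (EuclideanSpace.single i 1)
          (fderiv ℝ (fieldCoeff ξ ψ) (ψ x) (EuclideanSpace.single j 1)) = 0 := fun i j ↦ by
      rw [← lieDerivMetricCoeff_eq hH.differentiableAt dX]
      exact hS.killing x i j
    rw [← sum_smul_single a, ← sum_smul_single b]
    simp only [map_sum, map_smul, sum_apply, smul_apply, smul_eq_mul]
    rw [← Finset.sum_add_distrib, ← Finset.sum_add_distrib]
    refine Finset.sum_eq_zero fun j _ ↦ ?_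
    simp only [← mul_add, ← Finset.sum_add_distrib, h2, mul_zero, Finset.sum_const_zero]
  · have h1 := hp.eq.self_of_nhds (fieldCoeff ξ ψ (ψ x)) (fieldCoeff ξ ψ (ψ x))
    rw [hX, hκ, hcomp] at h1
    rw [← h1]
    exact (metricForm_metricCoeff_apply g hψ hxψ (ξ x) (ξ x)).trans (hS.unit x)

/-- The factor `u` for which the metric is `u⁻²` times the Euclidean metric. -/
def conformalFactor (φ : OpenPartialHomeomorph M (EuclideanSpace ℝ (Fin n))) (lam : M → ℝ)
    (y : E n) : ℝ := (Real.sqrt (lam (φ.symm y)))⁻¹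

theorem isConformalNear_metricCoeff (hφ : φ ∈ IsManifold.maximalAtlas (𝓡 n) ∞ M) {lam : M → ℝ}
    (hlam : ContMDiffOn (𝓡 n) 𝓘(ℝ) ∞ lam φ.source)
    (hconf : ∀ y ∈ φ.source, 0 < lam y ∧ ∀ u v : TangentSpace (𝓡 n) y,
        g.inner y u v = lam y * inner ℝ (mvfderiv (𝓡 n) φ y u) (mvfderiv (𝓡 n) φ y v))
    {y : E n} (hy : y ∈ φ.target) :
    IsConformalNear (metricCoeff g φ) (conformalFactor φ lam) y where
  smooth := (φ.open_target.eventually_mem hy).mono fun z hz ↦ by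
    have h1 : ContDiffAt ℝ ∞ (lam ∘ φ.symm) z := contMDiffAt_iff_contDiffAt.1
      ((hlam.contMDiffAt (φ.open_source.mem_nhds (φ.map_target hz))).comp z
        (contMDiffAt_symm_of_mem_maximalAtlas hφ hz))
    have h2 := (hconf _ (φ.map_target hz)).1
    exact (h1.sqrt h2.ne').inv (Real.sqrt_pos.2 h2).ne'
  pos := (φ.open_target.eventually_mem hy).mono fun z hz ↦
    inv_pos.2 (Real.sqrt_pos.2 (hconf _ (φ.map_target hz)).1)
  eq := (φ.open_target.eventually_mem hy).mono fun z hz ↦ by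
    ext i j
    obtain ⟨h2, h3⟩ := hconf _ (φ.map_target hz)
    rw [← metricForm_single (metricCoeff g φ) z, metricForm_metricCoeff, h3]
    have h4 : ∀ a, mvfderiv (𝓡 n) φ (φ.symm z) (dChartSymm φ z a) = a := dChart_dChartSymm hφ hz
    rw [h4, h4, conformalFactor, inv_pow, Real.sq_sqrt h2.le, inv_inv]
    simp [Matrix.one_apply, EuclideanSpace.inner_single_left]

end SasakianCharts

/-! ### Constant curvature one, hence Einstein -/

section DimensionThree

open Filter Topology

variable {M : Type*} [TopologicalSpace M] [ChartedSpace (EuclideanSpace ℝ (Fin 3)) M]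
  [IsManifold (𝓡 3) ∞ M] {φ : OpenPartialHomeomorph M (EuclideanSpace ℝ (Fin 3))}
  {g : SmoothMetric 3 M} {ξ : ∀ x : M, TangentSpace (𝓡 3) x}

local notation "⟪" x ", " y "⟫" => inner ℝ x y

/-- A conformally flat Sasakian metric has constant curvature one, expressed through the Hessian of
the conformal factor. -/
theorem IsSasakian.hessian_eq (hS : IsSasakian g ξ)
    (hφ : φ ∈ IsManifold.maximalAtlas (𝓡 3) ∞ M) {u : EuclideanSpace ℝ (Fin 3) → ℝ}
    (hG : ∀ y ∈ φ.target, IsConformalNear (metricCoeff g φ) u y) :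
    ∀ y ∈ φ.target, ∀ a b,
      fderiv ℝ (fderiv ℝ u) y a b = (1 + ‖fderiv ℝ u y‖ ^ 2) / (2 * u y) * ⟪a, b⟫ := by
  intro y hy
  have ev := φ.open_target.eventually_mem hy
  have hc : ∀ z ∈ φ.target, ⟪fieldCoeff ξ φ z, fieldCoeff ξ φ z⟫ = u z ^ 2 := fun z hz ↦ by
    have h1 := (hS.in_chart hφ hz (hG z hz).isMetricNear).2.2
    have hpos := (hG z hz).pos.self_of_nhds
    rw [(hG z hz).metricForm_eq] at h1
    field_simp at h1
    exact h1
  refine hessian_eq_of_conformalKilling (hG y hy).smooth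
    (ev.mono fun z hz ↦ contDiffAt_fieldCoeff hS.contMDiff hφ hz) (hG y hy).pos (ev.mono hc)
    (ev.mono fun z hz a b ↦ ?_) (ev.mono fun z hz ↦ ?_) ?_
  · have h1 := (hS.in_chart hφ hz (hG z hz).isMetricNear).2.1 a b
    have hpos := (hG z hz).pos.self_of_nhds
    rw [(hG z hz).metricForm_eq, (hG z hz).metricForm_eq, (hG z hz).fderiv_metricForm] at h1
    field_simp at h1
    linear_combination h1
  · exact hessian_eigen_of_sasakian (hG z hz) (hc z hz)
      (hS.in_chart hφ hz (hG z hz).isMetricNear).1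
  · obtain ⟨a, h1, h2, -⟩ := exists_unit_orthogonal (fieldCoeff ξ φ y) 0
    exact ⟨a, h1, h2⟩

/-- The identity holds in a conformal chart; since both sides are tensorial and the differential of
the transition map is injective, it holds in the preferred chart. -/
theorem IsSasakian.riemannMap_metricAt (hS : IsSasakian g ξ) (hC : IsConformallyFlat g) (x : M)
    (a b c : EuclideanSpace ℝ (Fin 3)) :
    riemannMap (metricAt g x) (chartAt (EuclideanSpace ℝ (Fin 3)) x x) a b c =
      metricForm (metricAt g x) (chartAt (EuclideanSpace ℝ (Fin 3)) x x) b c • a -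
      metricForm (metricAt g x) (chartAt (EuclideanSpace ℝ (Fin 3)) x x) a c • b := by
  obtain ⟨φ, hφ, hx, lam, hlam, hconf⟩ := hC x
  have hG : ∀ y ∈ φ.target, IsConformalNear (metricCoeff g φ) (conformalFactor φ lam) y :=
    fun y hy ↦ isConformalNear_metricCoeff hφ hlam hconf hy
  set ψ := chartAt (EuclideanSpace ℝ (Fin 3)) x with hψdef
  have hψ : ψ ∈ IsManifold.maximalAtlas (𝓡 3) ∞ M := IsManifold.chart_mem_maximalAtlas x
  have hxψ : x ∈ ψ.source := mem_chart_source _ x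
  have hz : ψ x ∈ ψ.target := ψ.map_source hxψ
  have hz' : ψ.symm (ψ x) ∈ φ.source := by rwa [ψ.left_inv hxψ]
  have hκ : (φ ∘ ψ.symm) (ψ x) ∈ φ.target := φ.map_source hz'
  have hp := isPullbackNear_metricCoeff g hφ hψ hz hz'
  have hH := hp.isMetricNear (hG _ hκ).isMetricNear
  have h := hp.riemannMap hH (hG _ hκ).isMetricNear a b c
  have hinj : Function.Injective (fderiv ℝ (φ ∘ ψ.symm) (ψ x) :
      EuclideanSpace ℝ (Fin 3) →ₗ[ℝ] EuclideanSpace ℝ (Fin 3)) :=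
    LinearMap.injective_iff_surjective.2 hp.surjective.self_of_nhds
  rw [(hG _ hκ).riemannMap_eq (hS.hessian_eq hφ hG _ hκ), ← hp.eq.self_of_nhds,
    ← hp.eq.self_of_nhds, ← map_smul, ← map_smul, ← map_sub] at h
  exact hinj h

/-- The trace over `i` collects three copies of `g_{jk}` and removes one, hence the factor `2`. -/
theorem IsSasakian.ricciCoeff_metricAt (hS : IsSasakian g ξ) (hC : IsConformallyFlat g) (x : M)
    (j k : Fin 3) :
    ricciCoeff (metricAt g x) j k (chartAt (EuclideanSpace ℝ (Fin 3)) x x) =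
      2 * metricAt g x (chartAt (EuclideanSpace ℝ (Fin 3)) x x) j k := by
  have h : ∀ i, riemannCoeff (metricAt g x) i i j k (chartAt (EuclideanSpace ℝ (Fin 3)) x x) =
      metricAt g x (chartAt (EuclideanSpace ℝ (Fin 3)) x x) j k -
      metricAt g x (chartAt (EuclideanSpace ℝ (Fin 3)) x x) i k * if i = j then 1 else 0 := by
    intro i
    have h1 := congrArg (fun v ↦ v i) (hS.riemannMap_metricAt hC x (EuclideanSpace.single i 1)
      (EuclideanSpace.single j 1) (EuclideanSpace.single k 1))
    simp only [metricForm_single] at h1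
    simpa [riemannMap, Pi.single_apply] using h1
  simp only [ricciCoeff, h, Finset.sum_sub_distrib]
  simp
  ring

theorem IsSasakian.ricci_eq (hS : IsSasakian g ξ) (hC : IsConformallyFlat g) (x : M)
    (u v : TangentSpace (𝓡 3) x) : ricci g x u v = 2 * g.inner x u v := by
  rw [← metricForm_metricCoeff_apply g (IsManifold.chart_mem_maximalAtlas x)
    (mem_chart_source (EuclideanSpace ℝ (Fin 3)) x), metricForm_apply, ricci, Finset.mul_sum]
  refine Finset.sum_congr rfl fun j _ ↦ ?_
  rw [Finset.mul_sum]
  refine Finset.sum_congr rfl fun k _ ↦ ?_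
  rw [hS.ricciCoeff_metricAt hC, mul_assoc, mul_assoc]
  rfl

theorem IsSasakian.scalarCurvature_eq (hS : IsSasakian g ξ) (hC : IsConformallyFlat g) (x : M) :
    scalarCurvature g x = 6 := by
  obtain ⟨φ, hφ, hx, lam, hlam, hconf⟩ := hC x
  set ψ := chartAt (EuclideanSpace ℝ (Fin 3)) x with hψdef
  have hψ : ψ ∈ IsManifold.maximalAtlas (𝓡 3) ∞ M := IsManifold.chart_mem_maximalAtlas x
  have hxψ : x ∈ ψ.source := mem_chart_source _ x
  have hz : ψ x ∈ ψ.target := ψ.map_source hxψ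
  have hz' : ψ.symm (ψ x) ∈ φ.source := by rwa [ψ.left_inv hxψ]
  have hH : IsMetricNear (metricAt g x) (ψ x) :=
    (isPullbackNear_metricCoeff g hφ hψ hz hz').isMetricNear
      (isConformalNear_metricCoeff hφ hlam hconf (φ.map_source hz')).isMetricNear
  have h : ∀ j, ∑ k, (metricAt g x (ψ x))⁻¹ j k * metricAt g x (ψ x) k j = 1 := fun j ↦ by
    have := congrFun (congrFun (Matrix.nonsing_inv_mul _ hH.isUnit_det.self_of_nhds) j) j
    rwa [Matrix.mul_apply, Matrix.one_apply_eq] at this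
  have h' : ∀ j, ∑ k, (metricAt g x (ψ x))⁻¹ j k *
      ricciCoeff (metricAt g x) j k (ψ x) = 2 := fun j ↦ by
    refine Eq.trans ?_ ((congrArg (2 * ·) (h j)).trans (mul_one 2))
    rw [Finset.mul_sum]
    refine Finset.sum_congr rfl fun k _ ↦ ?_
    rw [hS.ricciCoeff_metricAt hC, hH.symm.self_of_nhds k j]
    ring
  simp only [scalarCurvature]
  rw [Finset.sum_congr rfl fun j _ ↦ h' j]
  norm_num

end DimensionThree

/-! ### Orthogonal complex structures on `ℝ⁴` -/

section LinearAlgebra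

local notation "⟪" x ", " y "⟫" => inner ℝ x y
local notation "E4" => EuclideanSpace ℝ (Fin 4)

theorem exists_unit_orthogonal_four (v w : E4) :
    ∃ a : E4, ⟪a, a⟫ = 1 ∧ ⟪a, v⟫ = 0 ∧ ⟪a, w⟫ = 0 := by
  have hlt : Module.finrank ℝ (Submodule.span ℝ ({v, w} : Set E4)) < Module.finrank ℝ E4 := by
    have := (finrank_span_finset_le_card (R := ℝ) ({v, w} : Finset E4)).trans
      Finset.card_le_two
    simp only [Finset.coe_pair] at this
    rw [finrank_euclideanSpace_fin]
    exact lt_of_le_of_lt this (by norm_num)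
  have hne : (Submodule.span ℝ ({v, w} : Set E4))ᗮ ≠ ⊥ := by
    intro h
    rw [Submodule.orthogonal_eq_bot_iff] at h
    rw [h, finrank_top] at hlt
    exact lt_irrefl _ hlt
  obtain ⟨a, ha, ha0⟩ := Submodule.exists_mem_ne_zero_of_ne_bot hne
  rw [Submodule.mem_orthogonal'] at ha
  have hv := ha v (Submodule.subset_span (by simp))
  have hw := ha w (Submodule.subset_span (by simp))
  refine ⟨‖a‖⁻¹ • a, ?_, ?_, ?_⟩
  · rw [real_inner_smul_left, real_inner_smul_right, real_inner_self_eq_norm_sq]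
    have := norm_ne_zero_iff.2 ha0
    field_simp
  · simp [real_inner_smul_left, hv]
  · simp [real_inner_smul_left, hw]

/-- Every orthogonal complex structure on `ℝ⁴` is conjugate to the standard one. -/
theorem exists_conj_mulI {A : E4 →L[ℝ] E4} (hskew : ∀ w w', ⟪A w, w'⟫ + ⟪w, A w'⟫ = 0)
    (hsq : ∀ w, A (A w) = -w) : ∃ R : E4 ≃ₗᵢ[ℝ] E4, ∀ w, mulI (R w) = R (A w) := by
  have hisom : ∀ w w', ⟪A w, A w'⟫ = ⟪w, w'⟫ := fun w w' ↦ by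
    have := hskew (A w) w'
    rw [hsq, inner_neg_left] at this
    linarith
  have hself : ∀ w, ⟪w, A w⟫ = 0 := fun w ↦ by
    have := hskew w w
    rw [real_inner_comm] at this
    linarith
  obtain ⟨e, he, -, -⟩ := exists_unit_orthogonal_four 0 0
  -- With `f` orthogonal to the complex line of `e`, the vectors `e, A e, f, A f` are orthonormal,
  -- and `A` acts on them as `mulI` acts on the standard basis.
  obtain ⟨f, hf, hfe, hfe'⟩ := exists_unit_orthogonal_four e (A e)
  have h1 : ⟪A f, e⟫ = 0 := by
    have := hskew f e
    linarith
  have hnorm : ∀ {w : E4}, ⟪w, w⟫ = 1 → ‖w‖ = 1 := fun h ↦ by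
    rw [norm_eq_sqrt_real_inner, h, Real.sqrt_one]
  have hon : Orthonormal ℝ ![e, A e, f, A f] := by
    refine ⟨fun i ↦ ?_, fun i j hij ↦ ?_⟩
    · fin_cases i
      exacts [hnorm he, hnorm ((hisom e e).trans he), hnorm hf, hnorm ((hisom f f).trans hf)]
    · have c : ∀ {a b : E4}, ⟪a, b⟫ = 0 → ⟪b, a⟫ = 0 := fun h ↦ by rwa [real_inner_comm]
      have h2 : ⟪A f, A e⟫ = 0 := (hisom f e).trans hfe
      fin_cases i <;> fin_cases j <;> first
        | exact absurd rfl hij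
        | exact hfe
        | exact hfe'
        | exact h1
        | exact h2
        | exact hself _
        | exact c hfe
        | exact c hfe'
        | exact c h1
        | exact c h2
        | exact c (hself _)
  let b : OrthonormalBasis (Fin 4) ℝ E4 := OrthonormalBasis.mk hon (by
    have := (basisOfOrthonormalOfCardEqFinrank hon (by simp)).span_eq
    rw [coe_basisOfOrthonormalOfCardEqFinrank] at this
    exact this.ge)
  have hb : ∀ i w, b.repr w i = ⟪![e, A e, f, A f] i, w⟫ := fun i w ↦ by
    rw [OrthonormalBasis.repr_apply_apply, OrthonormalBasis.coe_mk]
  have hs : ∀ w w', ⟪w, A w'⟫ = -⟪A w, w'⟫ := fun w w' ↦ by linarith [hskew w w']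
  refine ⟨b.repr, fun w ↦ ?_⟩
  ext i
  fin_cases i <;> simp [mulI, hb, hisom, hs]

/-- A skew map preserving the length of the points of a piece of the sphere is a complex
structure. -/
theorem apply_apply_eq_neg {n : ℕ} {W : Type*} [NormedAddCommGroup W] [InnerProductSpace ℝ W]
    [FiniteDimensional ℝ W] {s : EuclideanSpace ℝ (Fin n) → W}
    {ρ : EuclideanSpace ℝ (Fin n) → ℝ} {Ω : Set (EuclideanSpace ℝ (Fin n))}
    (hs : IsSphereParam s ρ Ω) (hΩ : IsOpen Ω) (hne : Ω.Nonempty)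
    (hdim : Module.finrank ℝ W = n + 1) {A : W →L[ℝ] W}
    (hskew : ∀ w w', ⟪A w, w'⟫ + ⟪w, A w'⟫ = 0) (hA : ∀ y ∈ Ω, ⟪A (s y), A (s y)⟫ = 1) (w : W) :
    A (A w) = -w := by
  -- `Q = A² + 1` is symmetric with `⟪Q s, s⟫ = 0`. One derivative gives `Q s = 0` by symmetry, a
  -- second gives `Q (Ds) = 0`, and `s` with the image of `Ds` spans.
  set Q : W →L[ℝ] W := A.comp A + ContinuousLinearMap.id ℝ W with hQ
  have hQs : ∀ a b, ⟪Q a, b⟫ = ⟪a, Q b⟫ := fun a b ↦ by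
    have h1 := hskew (A a) b
    have h2 := hskew a (A b)
    simp only [hQ, add_apply, ContinuousLinearMap.comp_apply, ContinuousLinearMap.id_apply,
      inner_add_left, inner_add_right]
    linarith
  have h0 : ∀ y ∈ Ω, ⟪Q (s y), s y⟫ = 0 := fun y hy ↦ by
    have h1 := hskew (A (s y)) (s y)
    simp only [hQ, add_apply, ContinuousLinearMap.comp_apply, ContinuousLinearMap.id_apply,
      inner_add_left, hs.inner_self hy]
    linarith [hA y hy]
  have h1 : ∀ y ∈ Ω, Q (s y) = 0 := fun y hy ↦ by
    have hd : ∀ b, ⟪Q (s y), fderiv ℝ s y b⟫ = 0 := fun b ↦ by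
      have e : (fun z ↦ ⟪Q (s z), s z⟫) =ᶠ[nhds y] fun _ ↦ 0 :=
        (hΩ.eventually_mem hy).mono fun z hz ↦ h0 z hz
      have e := congrArg (fun L : EuclideanSpace ℝ (Fin n) →L[ℝ] ℝ ↦ L b) e.fderiv_eq
      have d := Q.hasFDerivAt.comp y (hs.differentiableAt hy).hasFDerivAt
      have d' : fderiv ℝ (fun z ↦ Q (s z)) y = Q.comp (fderiv ℝ s y) := d.fderiv
      simp only [fderiv_inner_apply ℝ (f := fun z ↦ Q (s z)) d.differentiableAt
        (hs.differentiableAt hy), d',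
        fderiv_fun_const, Pi.zero_apply, zero_apply, ContinuousLinearMap.comp_apply] at e
      rw [hQs (fderiv ℝ s y b), real_inner_comm (Q (s y))] at e
      linarith
    refine ext_inner_right ℝ fun w ↦ ?_
    obtain ⟨r, b, rfl⟩ := hs.span hΩ hdim hy w
    simp [inner_add_right, real_inner_smul_right, hd, h0 y hy]
  obtain ⟨y, hy⟩ := hne
  have h2 : ∀ b, Q (fderiv ℝ s y b) = 0 := fun b ↦ by
    have e : (fun z ↦ Q (s z)) =ᶠ[nhds y] fun _ ↦ 0 :=
      (hΩ.eventually_mem hy).mono fun z hz ↦ h1 z hz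
    have e := congrArg (fun L : EuclideanSpace ℝ (Fin n) →L[ℝ] W ↦ L b) e.fderiv_eq
    have d := Q.hasFDerivAt.comp y (hs.differentiableAt hy).hasFDerivAt
    have d' : fderiv ℝ (fun z ↦ Q (s z)) y = Q.comp (fderiv ℝ s y) := d.fderiv
    simpa [d'] using e
  have h3 : Q w = 0 := by
    obtain ⟨r, b, rfl⟩ := hs.span hΩ hdim hy w
    simp [h1 y hy, h2]
  exact eq_neg_of_add_eq_zero_left h3

end LinearAlgebra

/-! ### Differentials on the sphere read in `ℝ⁴` -/

section Sphere

local notation "⟪" x ", " y "⟫" => inner ℝ x y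
local notation "E4" => EuclideanSpace ℝ (Fin 4)
local notation "E3" => EuclideanSpace ℝ (Fin 3)

/-- Makes the explicit formulas for `stereoInv` available for the charts of the manifold structure
on `S3`. -/
theorem exists_stereographic'_symm_eq (v : S3) : ∃ L : E3 →ₗᵢ[ℝ] E4, (∀ x, ⟪L x, (v : E4)⟫ = 0) ∧
    ∀ w, ((stereographic' 3 v).symm w : E4) = stereoInv L (v : E4) w := by
  let U : (ℝ ∙ (v : E4))ᗮ ≃ₗᵢ[ℝ] E3 :=
    (OrthonormalBasis.fromOrthogonalSpanSingleton 3 (ne_zero_of_mem_unit_sphere v)).repr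
  refine ⟨(ℝ ∙ (v : E4))ᗮ.subtypeₗᵢ.comp U.symm.toLinearIsometry, fun x ↦ ?_, fun w ↦ ?_⟩
  · exact Submodule.mem_orthogonal_singleton_iff_inner_left.1 (U.symm x).2
  · rw [stereographic'_symm_apply, stereoInv, smul_add]
    have h : ‖((U.symm w : (ℝ ∙ (v : E4))ᗮ) : E4)‖ = ‖w‖ :=
      U.symm.norm_map w
    simp only [U] at h
    simp only [h]
    rfl

/-- The homeomorphism of `S³` induced by a linear isometry of `ℝ⁴`. -/
def sphereHomeo (R : E4 ≃ₗᵢ[ℝ] E4) : S3 ≃ₜ S3 where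
  toFun p := ⟨R p, by simp⟩
  invFun p := ⟨R.symm p, by simp⟩
  left_inv p := by simp
  right_inv p := by simp
  continuous_toFun := by fun_prop
  continuous_invFun := by fun_prop

theorem contMDiff_sphereHomeo (R : E4 ≃ₗᵢ[ℝ] E4) :
    ContMDiff (𝓡 3) (𝓡 3) ∞ (sphereHomeo R) := by
  have h : ContMDiff (𝓡 3) 𝓘(ℝ, E4) ∞ (fun p : S3 ↦ R (p : E4)) :=
    R.contDiff.contMDiff.comp (contMDiff_coe_sphere (n := 3))
  exact h.codRestrict_sphere (n := 3) fun p ↦ by simp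

theorem contMDiff_sphereHomeo_symm (R : E4 ≃ₗᵢ[ℝ] E4) :
    ContMDiff (𝓡 3) (𝓡 3) ∞ (sphereHomeo R).symm :=
  contMDiff_sphereHomeo R.symm

theorem dIncl_injective (p : S3) : Function.Injective (dIncl p) :=
  injective_mvfderiv_subtypeVal_sphere (n := 3) p

/-- The differential of a map into the sphere, read in `ℝ⁴`. -/
theorem dIncl_mfderiv {M : Type*} [TopologicalSpace M] [ChartedSpace E3 M] {Φ : M → S3} {x : M}
    (h : MDifferentiableAt (𝓡 3) (𝓡 3) Φ x) (u : TangentSpace (𝓡 3) x) :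
    dIncl (Φ x) (mfderiv (𝓡 3) (𝓡 3) Φ x u) = mvfderiv (𝓡 3) (fun y ↦ (Φ y : E4)) x u := by
  have h1 : MDifferentiableAt (𝓡 3) 𝓘(ℝ, E4) ((↑) : S3 → E4) (Φ x) :=
    (contMDiff_coe_sphere (n := 3) (m := ∞)).mdifferentiableAt (by simp)
  have h2 := mfderiv_comp x h1 h
  exact (congrArg (fun L ↦ L u) h2).symm

end Sphere

/-! ### Local identification with the standard sphere -/

section SphereCharts

open Filter Topology

local notation "⟪" x ", " y "⟫" => inner ℝ x y
local notation "E4" => EuclideanSpace ℝ (Fin 4)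
local notation "E3" => EuclideanSpace ℝ (Fin 3)

/-- A similarity of `ℝ³` followed by inverse stereographic projection. -/
theorem isSphereParam_stereoInv {L : E3 →ₗᵢ[ℝ] E4} {v : E4} (hv : ‖v‖ = 1)
    (hL : ∀ x, ⟪L x, v⟫ = 0) {c : ℝ} (hc : 0 < c) (p : E3) (Ω : Set E3) :
    IsSphereParam (fun y ↦ stereoInv L v ((2 * c) • (y - p)))
      (fun y ↦ (((1 + c ^ 2 * ‖y - p‖ ^ 2) / (2 * c)) ^ 2)⁻¹) Ω where
  smooth y _ := ((contDiff_stereoInv L v).comp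
    ((contDiff_id.sub contDiff_const).const_smul (2 * c))).contDiffAt
  norm_eq y _ := norm_stereoInv hv hL _
  factor_smooth y _ := by
    have h : ContDiff ℝ ∞ fun y : E3 ↦ ‖y - p‖ ^ 2 :=
      (contDiff_norm_sq ℝ).comp (contDiff_id.sub contDiff_const)
    refine ((((contDiff_const.add (contDiff_const.mul h)).div_const _).pow 2).contDiffAt).inv ?_
    positivity
  factor_pos y _ := by positivity
  inner_fderiv y _ a b := by
    have h1 : HasFDerivAt (fun y : E3 ↦ (2 * c) • (y - p))
        ((2 * c) • ContinuousLinearMap.id ℝ E3) y :=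
      ((hasFDerivAt_id y).sub_const p).fun_const_smul (2 * c)
    have h2 : HasFDerivAt (stereoInv L v) _ ((2 * c) • (y - p)) :=
      ((contDiff_stereoInv L v).differentiable (by simp)).differentiableAt.hasFDerivAt
    have h3 : fderiv ℝ (fun y ↦ stereoInv L v ((2 * c) • (y - p))) y = _ :=
      (h2.comp (f := fun y : E3 ↦ (2 * c) • (y - p)) y h1).fderiv
    rw [h3]
    simp only [ContinuousLinearMap.comp_apply, smul_apply,
      ContinuousLinearMap.id_apply, inner_fderiv_stereoInv hv hL, real_inner_smul_left,
      real_inner_smul_right, norm_smul, Real.norm_eq_abs, mul_pow, sq_abs]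
    field_simp
    ring

/-- Smoothness of an open partial homeomorphism and of its inverse. -/
def IsPartialDiffeo {M N : Type*} [TopologicalSpace M] [ChartedSpace E3 M] [TopologicalSpace N]
    [ChartedSpace E3 N] (e : OpenPartialHomeomorph M N) : Prop :=
  ContMDiffOn (𝓡 3) (𝓡 3) ∞ e e.source ∧ ContMDiffOn (𝓡 3) (𝓡 3) ∞ e.symm e.target

variable {M N K : Type*} [TopologicalSpace M] [ChartedSpace E3 M] [TopologicalSpace N]
    [ChartedSpace E3 N] [TopologicalSpace K] [ChartedSpace E3 K]

theorem IsPartialDiffeo.trans {e : OpenPartialHomeomorph M N} {f : OpenPartialHomeomorph N K}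
    (he : IsPartialDiffeo e) (hf : IsPartialDiffeo f) : IsPartialDiffeo (e.trans f) := by
  constructor
  · rw [e.coe_trans, e.trans_source]
    exact hf.1.comp (he.1.mono Set.inter_subset_left) fun x hx ↦ hx.2
  · rw [e.coe_trans_symm, e.trans_target]
    exact he.2.comp (hf.2.mono Set.inter_subset_left) fun x hx ↦ hx.2

theorem IsPartialDiffeo.symm {e : OpenPartialHomeomorph M N} (he : IsPartialDiffeo e) :
    IsPartialDiffeo e.symm := ⟨he.2, he.1⟩

theorem IsPartialDiffeo.restrOpen {e : OpenPartialHomeomorph M N} (he : IsPartialDiffeo e)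
    {s : Set M} (hs : IsOpen s) : IsPartialDiffeo (e.restrOpen s hs) :=
  ⟨he.1.mono Set.inter_subset_left, he.2.mono Set.inter_subset_left⟩

theorem isPartialDiffeo_stereographic' (v : S3) : IsPartialDiffeo (stereographic' 3 v) := by
  have h : stereographic' 3 v ∈ IsManifold.maximalAtlas (𝓡 3) ∞ S3 :=
    IsManifold.subset_maximalAtlas ⟨v, rfl⟩
  exact ⟨contMDiffOn_of_mem_maximalAtlas h, contMDiffOn_symm_of_mem_maximalAtlas h⟩

variable [IsManifold (𝓡 3) ∞ M]

/-- `Φ` identifies an open piece of `(M, g, ξ)` with an open piece of the standard `S³`. -/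
structure IsStandardChart (g : SmoothMetric 3 M) (ξ : ∀ x : M, TangentSpace (𝓡 3) x)
    (Φ : OpenPartialHomeomorph M S3) : Prop where
  smooth : ContMDiffOn (𝓡 3) (𝓡 3) ∞ Φ Φ.source
  smooth_symm : ContMDiffOn (𝓡 3) (𝓡 3) ∞ Φ.symm Φ.target
  inner_eq : ∀ y ∈ Φ.source, ∀ u v : TangentSpace (𝓡 3) y,
    roundMetric (Φ y) (mfderiv (𝓡 3) (𝓡 3) Φ y u) (mfderiv (𝓡 3) (𝓡 3) Φ y v) = g.inner y u v
  field_eq : ∀ y ∈ Φ.source, mfderiv (𝓡 3) (𝓡 3) Φ y (ξ y) = hopfField (Φ y)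

variable {g : SmoothMetric 3 M} {ξ : ∀ x : M, TangentSpace (𝓡 3) x}

/-- In conformal coordinates, a conformally flat Sasakian 3-manifold is parametrised by a piece of
the sphere in such a way that the Killing field is a complex structure. -/
theorem IsSasakian.exists_complexStructure (hS : IsSasakian g ξ)
    {φ : OpenPartialHomeomorph M E3} (hφ : φ ∈ IsManifold.maximalAtlas (𝓡 3) ∞ M) {u ρ : E3 → ℝ}
    (hG : ∀ y ∈ φ.target, IsConformalNear (metricCoeff g φ) u y) {s : E3 → E4} {Ω : Set E3}
    (hs : IsSphereParam s ρ Ω) (hΩ : IsOpen Ω) (hΩ' : IsPreconnected Ω) (hne : Ω.Nonempty)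
    (hΩφ : Ω ⊆ φ.target) (hρ : ∀ y ∈ Ω, ρ y = (u y ^ 2)⁻¹) :
    ∃ A : E4 →L[ℝ] E4, (∀ w w', ⟪A w, w'⟫ + ⟪w, A w'⟫ = 0) ∧ (∀ w, A (A w) = -w) ∧
      ∀ y ∈ Ω, fderiv ℝ s y (fieldCoeff ξ φ y) = A (s y) := by
  have hdim : Module.finrank ℝ E4 = 3 + 1 := by simp
  have hmet : ∀ y ∈ Ω, ∀ a b, metricForm (metricCoeff g φ) y a b =
      ⟪fderiv ℝ s y a, fderiv ℝ s y b⟫ := fun y hy a b ↦ by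
    rw [hs.inner_fderiv y hy, hρ y hy, (hG y (hΩφ hy)).metricForm_eq]
  have hX : ∀ y ∈ Ω, ContDiffAt ℝ ∞ (fieldCoeff ξ φ) y := fun y hy ↦
    contDiffAt_fieldCoeff hS.contMDiff hφ (hΩφ hy)
  -- The field pushed forward to `ℝ⁴` is `t = Ds(X)`. The Killing equation for `X` in the metric
  -- `⟪Ds a, Ds b⟫` becomes the one for `t` because `D²s` is symmetric.
  obtain ⟨A, hA, hA'⟩ := exists_skew (t := fun y ↦ fderiv ℝ s y (fieldCoeff ξ φ y)) hs hΩ hΩ' hne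
    hdim (fun y hy ↦ (contDiffAt_fderiv (hs.smooth y hy)).clm_apply (hX y hy))
    (fun y hy ↦ by rw [real_inner_comm, hs.inner_fderiv_self hΩ hy]) (fun y hy a b ↦ by
      have hM := (hG y (hΩφ hy)).isMetricNear
      have h1 := (hS.in_chart hφ (hΩφ hy) hM).2.1 a b
      have d2 : DifferentiableAt ℝ (fderiv ℝ s) y :=
        (contDiffAt_fderiv (hs.smooth y hy)).differentiableAt (by simp)
      have dX : DifferentiableAt ℝ (fieldCoeff ξ φ) y := (hX y hy).differentiableAt (by simp)
      have e : (fun z ↦ metricForm (metricCoeff g φ) z a b) =ᶠ[𝓝 y]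
          fun z ↦ ⟪fderiv ℝ s z a, fderiv ℝ s z b⟫ :=
        (hΩ.eventually_mem hy).mono fun z hz ↦ hmet z hz a b
      have e := congrArg (fun L : E3 →L[ℝ] ℝ ↦ L (fieldCoeff ξ φ y)) e.fderiv_eq
      have k1 := fderiv_apply_const'
        (hasFDerivAt_metricForm hM.differentiableAt).differentiableAt (fieldCoeff ξ φ y) a
      have k2 := fderiv_apply_const' k1.1 (fieldCoeff ξ φ y) b
      have k3 := fderiv_apply_const' d2 (fieldCoeff ξ φ y) a
      have k4 := fderiv_apply_const' d2 (fieldCoeff ξ φ y) b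
      simp only [fderiv_inner_apply ℝ k3.1 k4.1, k2.2, k1.2, k3.2, k4.2] at e
      rw [e, hmet y hy, hmet y hy] at h1
      simp only [fderiv_clm_apply' d2 dX]
      rw [fderiv_fderiv_symm (hs.smooth y hy) a, fderiv_fderiv_symm (hs.smooth y hy) b,
        inner_add_left, inner_add_right]
      linarith)
  refine ⟨A, hA, fun w ↦ apply_apply_eq_neg hs hΩ hne hdim hA (fun y hy ↦ ?_) w, hA'⟩
  rw [← hA' y hy, ← hmet y hy]
  exact (hS.in_chart hφ (hΩφ hy) (hG y (hΩφ hy)).isMetricNear).2.2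

/-- On a ball in conformal coordinates the explicit `u` is the factor of stereographic projection
after a similarity. The field is then a complex structure `A`, and a final rotation `R` turns `A`
into `i`. -/
theorem IsSasakian.exists_standardChart (hS : IsSasakian g ξ) (hC : IsConformallyFlat g) (x : M) :
    ∃ Φ, IsStandardChart g ξ Φ ∧ x ∈ Φ.source := by
  obtain ⟨φ, hφ, hx, lam, hlam, hconf⟩ := hC x
  have hG : ∀ y ∈ φ.target, IsConformalNear (metricCoeff g φ) (conformalFactor φ lam) y :=
    fun y hy ↦ isConformalNear_metricCoeff hφ hlam hconf hy
  obtain ⟨ε, hε, hB⟩ := Metric.isOpen_iff.1 φ.open_target _ (φ.map_source hx)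
  set B := Metric.ball (φ x) ε with hBdef
  have hxB : φ x ∈ B := Metric.mem_ball_self hε
  have hBo : IsOpen B := Metric.isOpen_ball
  have hBc : IsPreconnected B := (convex_ball _ _).isPreconnected
  obtain ⟨c, hc, p, hu⟩ := exists_eq_of_hessian_eq hBo hBc ⟨_, hxB⟩
    (fun y hy ↦ (hG y (hB hy)).smooth.self_of_nhds) (fun y hy ↦ (hG y (hB hy)).pos.self_of_nhds)
    (fun y hy ↦ hS.hessian_eq hφ hG y (hB hy))
  obtain ⟨v⟩ : Nonempty S3 := ⟨⟨EuclideanSpace.single 0 1, by simp⟩⟩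
  obtain ⟨L, hL, hL'⟩ := exists_stereographic'_symm_eq v
  have hs := isSphereParam_stereoInv (norm_eq_of_mem_sphere v) hL hc p B
  set s : E3 → E4 := fun y ↦ stereoInv L v ((2 * c) • (y - p)) with hsdef
  obtain ⟨A, hA, hAA, hA'⟩ := hS.exists_complexStructure hφ hG hs hBo hBc ⟨_, hxB⟩ hB
    (fun y hy ↦ by rw [hu y hy])
  obtain ⟨R, hR⟩ := exists_conj_mulI hA hAA
  have hc0 : (2 * c) ≠ 0 := by positivity
  -- Scaling by `2c` about `p` turns the stereographic factor `16/(|w|² + 4)²` into `u⁻²`.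
  let T : E3 ≃ₜ E3 := (Homeomorph.subRight p).trans (Homeomorph.smulOfNeZero (2 * c) hc0)
  have hT : IsPartialDiffeo T.toOpenPartialHomeomorph := by
    constructor
    · exact (contMDiff_iff_contDiff.2
        ((contDiff_id.sub contDiff_const).const_smul (2 * c))).contMDiffOn
    · exact (contMDiff_iff_contDiff.2
        ((contDiff_id.const_smul (2 * c)⁻¹).add contDiff_const)).contMDiffOn
  let Φ := (((φ.restrOpen _ (φ.isOpen_inter_preimage hBo)).trans T.toOpenPartialHomeomorph).trans
    (stereographic' 3 v).symm).trans (sphereHomeo R).toOpenPartialHomeomorph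
  have hΦ : IsPartialDiffeo Φ := by
    refine IsPartialDiffeo.trans (IsPartialDiffeo.trans (IsPartialDiffeo.trans
      (IsPartialDiffeo.restrOpen ⟨contMDiffOn_of_mem_maximalAtlas hφ,
        contMDiffOn_symm_of_mem_maximalAtlas hφ⟩ _) hT) (isPartialDiffeo_stereographic' v).symm) ?_
    exact ⟨(contMDiff_sphereHomeo R).contMDiffOn, (contMDiff_sphereHomeo_symm R).contMDiffOn⟩
  have hsrc : ∀ y, y ∈ Φ.source ↔ y ∈ φ.source ∧ φ y ∈ B := fun y ↦ by
    simp [Φ]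
  have hval : ∀ y, (Φ y : E4) = R (s (φ y)) := fun y ↦ congrArg R (hL' _)
  have hd : ∀ y ∈ Φ.source, ∀ w : TangentSpace (𝓡 3) y, dIncl (Φ y) (mfderiv (𝓡 3) (𝓡 3) Φ y w) =
      R (fderiv ℝ s (φ y) (dChart φ y w)) := fun y hy w ↦ by
    have hy' := (hsrc y).1 hy
    rw [dIncl_mfderiv ((hΦ.1.contMDiffAt (Φ.open_source.mem_nhds hy)).mdifferentiableAt (by simp))]
    simp only [hval]
    have h1 : HasFDerivAt (fun z ↦ R (s z)) _ (φ y) :=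
      (R.toContinuousLinearEquiv.hasFDerivAt (x := s (φ y))).comp (φ y)
        (hs.differentiableAt hy'.2).hasFDerivAt
    have h2 : MDifferentiableAt (𝓡 3) (𝓡 3) φ y :=
      (mdifferentiable_of_mem_maximalAtlas hφ).mdifferentiableAt hy'.1
    have h3 := mfderiv_comp y h1.differentiableAt.mdifferentiableAt h2
    rw [mfderiv_eq_fderiv, h1.fderiv] at h3
    exact congrArg (fun L ↦ L w) h3
  refine ⟨Φ, ⟨hΦ.1, hΦ.2, fun y hy w w' ↦ ?_, fun y hy ↦ dIncl_injective _ ?_⟩,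
    (hsrc x).2 ⟨hx, hxB⟩⟩
  · have hy' := (hsrc y).1 hy
    rw [roundMetric, hd y hy, hd y hy, LinearIsometryEquiv.inner_map_map, hs.inner_fderiv _ hy'.2,
      ← metricForm_metricCoeff_apply g hφ hy'.1, (hG _ (hB hy'.2)).metricForm_eq, ← hu _ hy'.2]
  · have hy' := (hsrc y).1 hy
    have h1 : dChart φ y (ξ y) = fieldCoeff ξ φ (φ y) := by
      rw [fieldCoeff, φ.left_inv hy'.1]
    rw [hd y hy, h1, hA' _ hy'.2, dIncl_hopfField, hval, hR]

theorem IsSasakian.isLocallyStandard (hS : IsSasakian g ξ) (hC : IsConformallyFlat g) :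
    IsLocallyStandard g ξ := fun x ↦ by
  obtain ⟨Φ, hΦ, hx⟩ := hS.exists_standardChart hC x
  exact ⟨Φ, hx, hΦ.smooth, hΦ.smooth_symm, fun y hy ↦ ⟨hΦ.inner_eq y hy, hΦ.field_eq y hy⟩⟩

end SphereCharts

/-! ### Transitions between standard charts are unitary -/

section Transitions

open Filter Topology

local notation "⟪" x ", " y "⟫" => inner ℝ x y
local notation "E4" => EuclideanSpace ℝ (Fin 4)
local notation "E3" => EuclideanSpace ℝ (Fin 3)

/-- Agreement on the piece gives agreement on its tangent vectors, and at one point these span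
together with the position vector. -/
theorem IsSphereParam.clm_ext {n : ℕ} {W : Type*} [NormedAddCommGroup W] [InnerProductSpace ℝ W]
    [FiniteDimensional ℝ W] {s : EuclideanSpace ℝ (Fin n) → W}
    {ρ : EuclideanSpace ℝ (Fin n) → ℝ} {Ω : Set (EuclideanSpace ℝ (Fin n))}
    (hs : IsSphereParam s ρ Ω) (hΩ : IsOpen Ω) (hne : Ω.Nonempty)
    (hdim : Module.finrank ℝ W = n + 1) {A B : W →L[ℝ] W} (h : ∀ y ∈ Ω, A (s y) = B (s y)) :
    A = B := by
  obtain ⟨y, hy⟩ := hne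
  have h2 : ∀ b, A (fderiv ℝ s y b) = B (fderiv ℝ s y b) := fun b ↦ by
    have e : (fun z ↦ A (s z)) =ᶠ[𝓝 y] fun z ↦ B (s z) := (hΩ.eventually_mem hy).mono h
    have e := congrArg (fun L : EuclideanSpace ℝ (Fin n) →L[ℝ] W ↦ L b) e.fderiv_eq
    have d := (hs.differentiableAt hy).hasFDerivAt
    have dA : fderiv ℝ (fun z ↦ A (s z)) y = A.comp (fderiv ℝ s y) :=
      (A.hasFDerivAt.comp y d).fderiv
    have dB : fderiv ℝ (fun z ↦ B (s z)) y = B.comp (fderiv ℝ s y) :=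
      (B.hasFDerivAt.comp y d).fderiv
    simpa [dA, dB] using e
  ext1 w
  obtain ⟨r, b, rfl⟩ := hs.span hΩ hdim hy w
  simp [h y hy, h2]

/-- Multiplication by `i` on `ℝ⁴ = ℂ²` as a continuous linear map. -/
def mulIL : E4 →L[ℝ] E4 := LinearMap.toContinuousLinearMap
  { toFun := mulI
    map_add' := fun a b ↦ by ext i; fin_cases i <;> simp [mulI] <;> ring
    map_smul' := fun r a ↦ by ext i; fin_cases i <;> simp [mulI] }

theorem mulIL_apply (a : E4) : mulIL a = mulI a := rfl

theorem continuous_stereographic'_symm (v : S3) : Continuous (stereographic' 3 v).symm := by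
  have h := (stereographic' 3 v).continuousOn_symm
  rwa [stereographic'_target, continuousOn_univ] at h

/-- Around each of its points, `S³` is parametrised by a ball in `ℝ³`. -/
theorem exists_isSphereParam (p : S3) {U : Set S3} (hU : U ∈ 𝓝 p) :
    ∃ (e : OpenPartialHomeomorph S3 E3) (Ω : Set E3) (ρ : E3 → ℝ), IsPartialDiffeo e ∧
      e.target = Set.univ ∧ p ∈ e.source ∧ IsOpen Ω ∧ IsPreconnected Ω ∧ e p ∈ Ω ∧
      (∀ y ∈ Ω, e.symm y ∈ U) ∧ IsSphereParam (fun y ↦ (e.symm y : E4)) ρ Ω := by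
  -- Projecting from the antipode `-p` puts `p` in the domain of the chart.
  obtain ⟨L, hL, hL'⟩ := exists_stereographic'_symm_eq (-p)
  have hp : p ∈ (stereographic' 3 (-p)).source := by
    rw [stereographic'_source]
    exact ne_neg_of_mem_unit_sphere ℝ p
  have h1 : (stereographic' 3 (-p)).symm ⁻¹' U ∈ 𝓝 (stereographic' 3 (-p) p) := by
    refine (continuous_stereographic'_symm (-p)).continuousAt.preimage_mem_nhds ?_
    rwa [(stereographic' 3 (-p)).left_inv hp]
  obtain ⟨ε, hε, hB⟩ := Metric.mem_nhds_iff.1 h1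
  -- With `c = 1/2` and centre `0` the similarity is the identity.
  have hs := isSphereParam_stereoInv (norm_eq_of_mem_sphere (-p)) hL one_half_pos 0
    (Metric.ball (stereographic' 3 (-p) p) ε)
  simp only [mul_one_div_cancel (two_ne_zero (α := ℝ)), one_smul, sub_zero, ← hL'] at hs
  exact ⟨_, _, _, isPartialDiffeo_stereographic' (-p), stereographic'_target _, hp,
    Metric.isOpen_ball, (convex_ball _ _).isPreconnected, Metric.mem_ball_self hε, hB, hs⟩

theorem IsPartialDiffeo.mdifferentiable {M N : Type*} [TopologicalSpace M] [ChartedSpace E3 M]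
    [TopologicalSpace N] [ChartedSpace E3 N] {e : OpenPartialHomeomorph M N}
    (he : IsPartialDiffeo e) : e.MDifferentiable (𝓡 3) (𝓡 3) :=
  ⟨he.1.mdifferentiableOn (by simp), he.2.mdifferentiableOn (by simp)⟩

/-- `F` preserves the standard structure of `S³` on `U`. -/
structure PreservesStandard (F : S3 → S3) (U : Set S3) : Prop where
  smooth : ContMDiffOn (𝓡 3) (𝓡 3) ∞ F U
  inner_eq : ∀ q ∈ U, ∀ u v : TangentSpace (𝓡 3) q, roundMetric (F q)
    (mfderiv (𝓡 3) (𝓡 3) F q u) (mfderiv (𝓡 3) (𝓡 3) F q v) = roundMetric q u v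
  field_eq : ∀ q ∈ U, mfderiv (𝓡 3) (𝓡 3) F q (hopfField q) = hopfField (F q)

theorem fderiv_coe_sphere {t : E3 → S3} {y : E3} (h : MDifferentiableAt (𝓡 3) (𝓡 3) t y) (a : E3) :
    fderiv ℝ (fun z ↦ (t z : E4)) y a = dIncl (t y) (mfderiv (𝓡 3) (𝓡 3) t y a) := by
  have h1 : mfderiv (𝓡 3) 𝓘(ℝ, E4) (fun z ↦ (t z : E4)) y = fderiv ℝ (fun z ↦ (t z : E4)) y :=
    mfderiv_eq_fderiv
  have h2 := dIncl_mfderiv h a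
  exact ((congrArg (fun L : E3 →L[ℝ] E4 ↦ L a) h1).symm).trans h2.symm

/-- Rigidity gives an orthogonal `R`; preservation of the Hopf field makes it commute with `i`. -/
theorem PreservesStandard.exists_eq {F : S3 → S3} {U : Set S3} (hF : PreservesStandard F U)
    (hU : IsOpen U) {p : S3} (hp : p ∈ U) :
    ∃ R : E4 ≃ₗᵢ[ℝ] E4, (∀ w, mulI (R w) = R (mulI w)) ∧ F =ᶠ[𝓝 p] sphereHomeo R := by
  have hdim : Module.finrank ℝ E4 = 3 + 1 := by simp
  obtain ⟨e, Ω, ρ, he, het, hpe, hΩ, hΩ', hpΩ, hΩU, hs⟩ := exists_isSphereParam p (hU.mem_nhds hp)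
  have ht : ∀ y, y ∈ e.target := fun y ↦ het ▸ Set.mem_univ y
  have des : ∀ y, ContMDiffAt (𝓡 3) (𝓡 3) ∞ e.symm y := fun y ↦
    he.2.contMDiffAt (e.open_target.mem_nhds (ht y))
  have dF : ∀ y ∈ Ω, ContMDiffAt (𝓡 3) (𝓡 3) ∞ F (e.symm y) := fun y hy ↦
    hF.smooth.contMDiffAt (hU.mem_nhds (hΩU y hy))
  have d1 : ∀ y a, fderiv ℝ (fun z ↦ (e.symm z : E4)) y a =
      dIncl (e.symm y) (mfderiv (𝓡 3) (𝓡 3) e.symm y a) := fun y a ↦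
    fderiv_coe_sphere ((des y).mdifferentiableAt (by simp)) a
  have d2 : ∀ y ∈ Ω, ∀ a, fderiv ℝ (fun z ↦ (F (e.symm z) : E4)) y a =
      dIncl (F (e.symm y)) (mfderiv (𝓡 3) (𝓡 3) F (e.symm y) (mfderiv (𝓡 3) (𝓡 3) e.symm y a)) := by
    intro y hy a
    have h1 := fderiv_coe_sphere (t := F ∘ e.symm)
      (((dF y hy).comp y (des y)).mdifferentiableAt (by simp)) a
    rw [mfderiv_comp y ((dF y hy).mdifferentiableAt (by simp))
      ((des y).mdifferentiableAt (by simp))] at h1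
    exact h1
  obtain ⟨R, hR⟩ := exists_linearIsometryEquiv (t := fun y ↦ (F (e.symm y) : E4)) hs hΩ hΩ'
    ⟨_, hpΩ⟩ hdim (fun y hy ↦ contMDiffAt_iff_contDiffAt.1
      ((contMDiff_coe_sphere (n := 3)).contMDiffAt.comp y ((dF y hy).comp y (des y))))
    (fun y hy ↦ norm_eq_of_mem_sphere _) (fun y hy a b ↦ by
      rw [d1, d1, d2 y hy, d2 y hy]
      exact hF.inner_eq _ (hΩU y hy) _ _)
  -- Both composites are linear, so it suffices to compare them on the piece of sphere, where the
  -- equation is preservation of the Hopf field.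
  have hcomm : mulIL.comp (R : E4 →L[ℝ] E4) = (R : E4 →L[ℝ] E4).comp mulIL := by
    refine hs.clm_ext hΩ ⟨_, hpΩ⟩ hdim fun y hy ↦ ?_
    obtain ⟨X, hX⟩ := he.mdifferentiable.symm.mfderiv_surjective (ht y) (hopfField (e.symm y))
    have h1 : fderiv ℝ (fun z ↦ (e.symm z : E4)) y X = mulI (e.symm y : E4) :=
      (d1 y X).trans ((congrArg _ hX).trans (dIncl_hopfField _))
    have h2 : fderiv ℝ (fun z ↦ (F (e.symm z) : E4)) y X = mulI (F (e.symm y) : E4) := by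
      refine (d2 y hy X).trans ?_
      rw [hX, hF.field_eq _ (hΩU y hy), dIncl_hopfField]
    have h3 : (fun z ↦ (F (e.symm z) : E4)) =ᶠ[𝓝 y] fun z ↦ R (e.symm z : E4) :=
      (hΩ.eventually_mem hy).mono hR
    have h4 : fderiv ℝ (fun z ↦ R (e.symm z : E4)) y = (R : E4 →L[ℝ] E4).comp _ :=
      ((R : E4 →L[ℝ] E4).hasFDerivAt.comp y (hs.differentiableAt hy).hasFDerivAt).fderiv
    rw [h3.fderiv_eq, h4, hR y hy] at h2
    rw [ContinuousLinearMap.comp_apply, ContinuousLinearMap.comp_apply, mulIL_apply, mulIL_apply,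
      ← h1]
    exact h2.symm
  refine ⟨R, fun w ↦ congrArg (fun L : E4 →L[ℝ] E4 ↦ L w) hcomm, ?_⟩
  filter_upwards [(e.continuousAt hpe).eventually (hΩ.mem_nhds hpΩ), e.open_source.mem_nhds hpe]
    with q hq hqs
  have h := hR _ hq
  rw [e.left_inv hqs] at h
  exact Subtype.ext h

theorem sphereHomeo_eq_self {R : E4 ≃ₗᵢ[ℝ] E4} {p : S3} (h : ∀ᶠ q in 𝓝 p, sphereHomeo R q = q)
    (q : S3) : sphereHomeo R q = q := by
  obtain ⟨e, Ω, ρ, -, -, -, hΩ, -, hpΩ, hΩU, hs⟩ := exists_isSphereParam p h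
  have h1 : (R : E4 →L[ℝ] E4) = ContinuousLinearMap.id ℝ E4 :=
    hs.clm_ext hΩ ⟨_, hpΩ⟩ (by simp) fun y hy ↦ congrArg Subtype.val (hΩU y hy)
  exact Subtype.ext (congrArg (fun L : E4 →L[ℝ] E4 ↦ L q) h1)

theorem dIncl_mfderiv_sphereHomeo (R : E4 ≃ₗᵢ[ℝ] E4) (p : S3) (u : TangentSpace (𝓡 3) p) :
    dIncl (sphereHomeo R p) (mfderiv (𝓡 3) (𝓡 3) (sphereHomeo R) p u) = R (dIncl p u) := by
  rw [dIncl_mfderiv ((contMDiff_sphereHomeo R).mdifferentiableAt (by simp))]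
  have h1 : HasFDerivAt R (R : E4 →L[ℝ] E4) (p : E4) := (R : E4 →L[ℝ] E4).hasFDerivAt
  have h2 := mfderiv_comp p h1.differentiableAt.mdifferentiableAt
    ((contMDiff_coe_sphere (n := 3) (m := ∞)).mdifferentiableAt (x := p) (by simp))
  rw [mfderiv_eq_fderiv, h1.fderiv] at h2
  exact congrArg (fun L ↦ L u) h2

theorem preservesStandard_sphereHomeo {R : E4 ≃ₗᵢ[ℝ] E4} (hR : ∀ w, mulI (R w) = R (mulI w)) :
    PreservesStandard (sphereHomeo R) Set.univ where
  smooth := (contMDiff_sphereHomeo R).contMDiffOn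
  inner_eq q _ u v := by
    rw [roundMetric, dIncl_mfderiv_sphereHomeo, dIncl_mfderiv_sphereHomeo,
      LinearIsometryEquiv.inner_map_map, roundMetric]
  field_eq q _ := by
    refine dIncl_injective _ ?_
    rw [dIncl_mfderiv_sphereHomeo, dIncl_hopfField, dIncl_hopfField, ← hR]
    rfl

variable {M : Type*} [TopologicalSpace M] [ChartedSpace E3 M] [IsManifold (𝓡 3) ∞ M]
  {g : SmoothMetric 3 M} {ξ : ∀ x : M, TangentSpace (𝓡 3) x} {Φ Ψ : OpenPartialHomeomorph M S3}

namespace IsStandardChart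

theorem isPartialDiffeo (hΦ : IsStandardChart g ξ Φ) : IsPartialDiffeo Φ :=
  ⟨hΦ.smooth, hΦ.smooth_symm⟩

theorem mfderiv_mfderiv_symm (hΦ : IsStandardChart g ξ Φ) {p : S3} (hp : p ∈ Φ.target)
    (u : TangentSpace (𝓡 3) p) :
    mfderiv (𝓡 3) (𝓡 3) Φ (Φ.symm p) (mfderiv (𝓡 3) (𝓡 3) Φ.symm p u) = u :=
  congrArg (fun L ↦ L u) (hΦ.isPartialDiffeo.mdifferentiable.comp_symm_deriv hp)

theorem inner_symm (hΦ : IsStandardChart g ξ Φ) {p : S3} (hp : p ∈ Φ.target)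
    (u v : TangentSpace (𝓡 3) p) :
    g.inner (Φ.symm p) (mfderiv (𝓡 3) (𝓡 3) Φ.symm p u) (mfderiv (𝓡 3) (𝓡 3) Φ.symm p v) =
      roundMetric p u v := by
  -- All tangent spaces unfold to `E3`, so the base point `Φ (Φ.symm p)` can be replaced by `p` by
  -- substitution.
  have h : ∀ q, q = p → ∀ a b : E3, roundMetric q a b = roundMetric p a b := by
    rintro _ rfl _ _
    rfl
  rw [← hΦ.inner_eq _ (Φ.map_target hp), hΦ.mfderiv_mfderiv_symm hp, hΦ.mfderiv_mfderiv_symm hp]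
  exact h _ (Φ.right_inv hp) u v

theorem field_symm (hΦ : IsStandardChart g ξ Φ) {p : S3} (hp : p ∈ Φ.target) :
    mfderiv (𝓡 3) (𝓡 3) Φ.symm p (hopfField p) = ξ (Φ.symm p) := by
  have h : ∀ q, q = p → (hopfField p : E3) = hopfField q := by
    rintro _ rfl
    rfl
  refine hΦ.isPartialDiffeo.mdifferentiable.mfderiv_injective (Φ.map_target hp) ?_
  rw [hΦ.mfderiv_mfderiv_symm hp, hΦ.field_eq _ (Φ.map_target hp)]
  exact h _ (Φ.right_inv hp)

theorem preservesStandard_transition (hΦ : IsStandardChart g ξ Φ) (hΨ : IsStandardChart g ξ Ψ) :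
    PreservesStandard (Ψ ∘ Φ.symm) (Φ.symm.trans Ψ).source := by
  have hd : ∀ p ∈ (Φ.symm.trans Ψ).source, mfderiv (𝓡 3) (𝓡 3) (Ψ ∘ Φ.symm) p =
      (mfderiv (𝓡 3) (𝓡 3) Ψ (Φ.symm p)).comp (mfderiv (𝓡 3) (𝓡 3) Φ.symm p) := fun p hp ↦ by
    rw [Φ.symm.trans_source] at hp
    exact mfderiv_comp p (hΨ.isPartialDiffeo.mdifferentiable.mdifferentiableAt hp.2)
      (hΦ.isPartialDiffeo.mdifferentiable.mdifferentiableAt_symm hp.1)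
  refine ⟨(hΦ.isPartialDiffeo.symm.trans hΨ.isPartialDiffeo).1, fun p hp u v ↦ ?_, fun p hp ↦ ?_⟩
  · have hp' := hp
    rw [Φ.symm.trans_source] at hp'
    rw [hd p hp]
    exact (hΨ.inner_eq _ hp'.2 _ _).trans (hΦ.inner_symm hp'.1 u v)
  · have hp' := hp
    rw [Φ.symm.trans_source] at hp'
    rw [hd p hp]
    exact (congrArg _ (hΦ.field_symm hp'.1)).trans (hΨ.field_eq _ hp'.2)

/-- Transitions between standard charts are restrictions of linear isometries. -/
theorem exists_transition_eq (hΦ : IsStandardChart g ξ Φ) (hΨ : IsStandardChart g ξ Ψ) {p : S3}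
    (hp : p ∈ Φ.target) (hp' : Φ.symm p ∈ Ψ.source) :
    ∃ R : E4 ≃ₗᵢ[ℝ] E4, (∀ w, mulI (R w) = R (mulI w)) ∧ Ψ ∘ Φ.symm =ᶠ[𝓝 p] sphereHomeo R :=
  (hΦ.preservesStandard_transition hΨ).exists_eq (Φ.symm.trans Ψ).open_source
    (by rw [Φ.symm.trans_source]; exact ⟨hp, hp'⟩)

theorem trans_sphereHomeo (hΦ : IsStandardChart g ξ Φ) {R : E4 ≃ₗᵢ[ℝ] E4}
    (hR : ∀ w, mulI (R w) = R (mulI w)) :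
    IsStandardChart g ξ (Φ.trans (sphereHomeo R).toOpenPartialHomeomorph) := by
  have hP := preservesStandard_sphereHomeo hR
  have hT : IsPartialDiffeo (Φ.trans (sphereHomeo R).toOpenPartialHomeomorph) :=
    hΦ.isPartialDiffeo.trans
      ⟨(contMDiff_sphereHomeo R).contMDiffOn, (contMDiff_sphereHomeo_symm R).contMDiffOn⟩
  have hsrc : ∀ y ∈ (Φ.trans (sphereHomeo R).toOpenPartialHomeomorph).source, y ∈ Φ.source :=
    fun y hy ↦ by simpa using hy
  have hd : ∀ y ∈ Φ.source, mfderiv (𝓡 3) (𝓡 3) (Φ.trans (sphereHomeo R).toOpenPartialHomeomorph) y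
      = (mfderiv (𝓡 3) (𝓡 3) (sphereHomeo R) (Φ y)).comp (mfderiv (𝓡 3) (𝓡 3) Φ y) := fun y hy ↦
    mfderiv_comp y ((contMDiff_sphereHomeo R).mdifferentiableAt (by simp))
      (hΦ.isPartialDiffeo.mdifferentiable.mdifferentiableAt hy)
  refine ⟨hT.1, hT.2, fun y hy u v ↦ ?_, fun y hy ↦ ?_⟩
  · rw [hd y (hsrc y hy)]
    exact (hP.inner_eq _ (Set.mem_univ _) _ _).trans (hΦ.inner_eq y (hsrc y hy) u v)
  · rw [hd y (hsrc y hy)]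
    exact (congrArg _ (hΦ.field_eq y (hsrc y hy))).trans (hP.field_eq _ (Set.mem_univ _))

end IsStandardChart

end Transitions

/-! ### Continuation of germs with a uniform radius -/

section Continuation

open Filter Topology Metric

/-- Continuation in a normed space of germs that extend to balls of a fixed radius. -/
theorem exists_continuation {E α : Type*} [NormedAddCommGroup E] [NormedSpace ℝ E]
    {P : (E → α) → E → Prop} (hcongr : ∀ f h y, f =ᶠ[𝓝 y] h → P h y → P f y)
    (huniq : ∀ s, IsPreconnected s → ∀ f h, (∀ y ∈ s, P f y) → (∀ y ∈ s, P h y) →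
      ∀ y₀ ∈ s, f =ᶠ[𝓝 y₀] h → ∀ y ∈ s, f =ᶠ[𝓝 y] h) {ε : ℝ} (hε : 0 < ε)
    (hext : ∀ f y, P f y → ∃ F, F =ᶠ[𝓝 y] f ∧ ∀ z ∈ ball y ε, P F z) {f : E → α} {y₀ : E}
    (hf : P f y₀) : ∃ F, F =ᶠ[𝓝 y₀] f ∧ ∀ y, P F y := by
  have hpre : ∀ x y : E, ∀ r s, IsPreconnected (ball x r ∩ ball y s) := fun x y r s ↦
    ((convex_ball x r).inter (convex_ball y s)).isPreconnected
  have step : ∀ r > 0, ∀ f, (∀ y ∈ ball y₀ r, P f y) →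
      ∃ F, F =ᶠ[𝓝 y₀] f ∧ ∀ y ∈ ball y₀ (r + ε / 2), P F y := by
    intro r hr f hf
    have : Nonempty (E → α) := ⟨f⟩
    choose! F hF1 hF2 using fun z (hz : z ∈ ball y₀ r) ↦ hext f z (hf z hz)
    set t := r / (r + ε / 2) with ht
    have ht0 : 0 < t := by positivity
    have htr : t * (r + ε / 2) = r := by rw [ht]; field_simp
    have ht1 : t < 1 := by rw [ht, div_lt_one (by positivity)]; linarith
    -- The radial contraction maps the ball of radius `r + ε/2` into that of radius `r` and moves
    -- points by less than `ε/2`; the new value at `y` is that of the extension centred at `κ y`.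
    set κ : E → E := fun y ↦ AffineMap.lineMap y₀ y t with hκ
    have κ0 : κ y₀ = y₀ := by simp [hκ]
    have κc : Continuous κ := by
      simp only [hκ, AffineMap.lineMap_apply_module]
      fun_prop
    have κ1 : ∀ y ∈ ball y₀ (r + ε / 2), κ y ∈ ball y₀ r := fun y hy ↦ by
      rw [mem_ball, hκ, dist_lineMap_left, Real.norm_of_nonneg ht0.le, dist_comm, ← htr]
      exact mul_lt_mul_of_pos_left hy ht0
    have κ2 : ∀ y ∈ ball y₀ (r + ε / 2), dist y (κ y) < ε / 2 := fun y hy ↦ by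
      rw [dist_comm, hκ, dist_lineMap_right, Real.norm_of_nonneg (by linarith), dist_comm]
      have := mul_lt_mul_of_pos_left (mem_ball.1 hy) (sub_pos.2 ht1)
      linarith
    have agree : ∀ z ∈ ball y₀ r, ∀ w ∈ ball z ε ∩ ball y₀ r, F z =ᶠ[𝓝 w] f := fun z hz ↦
      huniq _ (hpre _ _ _ _) _ _ (fun y hy ↦ hF2 z hz y hy.1) (fun y hy ↦ hf y hy.2) z
        ⟨mem_ball_self hε, hz⟩ (hF1 z hz)
    -- Extensions centred at the nearby points `κ y` and `κ y'` both agree with `f` near `κ y'`,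
    -- hence on the intersection of their balls, which is convex and contains `y'`.
    have key : ∀ y ∈ ball y₀ (r + ε / 2), (fun y ↦ F (κ y) y) =ᶠ[𝓝 y] F (κ y) := fun y hy ↦ by
      filter_upwards [isOpen_ball.mem_nhds hy,
        κc.continuousAt.preimage_mem_nhds (ball_mem_nhds (κ y) (half_pos hε))] with y' hy' hd
      have hd' : dist (κ y') (κ y) < ε / 2 := hd
      have hz := κ1 y hy
      have hz' := κ1 y' hy'
      have e1 := agree _ hz (κ y') ⟨mem_ball.2 (by linarith), hz'⟩
      have e2 := agree _ hz' (κ y') ⟨mem_ball_self hε, hz'⟩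
      refine (huniq _ (hpre (κ y') (κ y) ε ε) _ _ (fun y hy ↦ hF2 _ hz' y hy.1)
        (fun y hy ↦ hF2 _ hz y hy.2) (κ y') ⟨mem_ball_self hε, mem_ball.2 (by linarith)⟩
        (e2.trans e1.symm) y' ⟨?_, ?_⟩).eq_of_nhds
      · exact mem_ball.2 (by linarith [κ2 y' hy'])
      · exact mem_ball.2 (by linarith [κ2 y' hy', dist_triangle y' (κ y') (κ y)])
    refine ⟨fun y ↦ F (κ y) y, ?_, fun y hy ↦ hcongr _ _ _ (key y hy) (hF2 _ (κ1 y hy) y ?_)⟩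
    · have := key y₀ (mem_ball_self (by positivity))
      rw [κ0] at this
      exact this.trans (hF1 y₀ (mem_ball_self hr))
    · exact mem_ball.2 (by linarith [κ2 y hy])
  have all : ∀ n : ℕ, ∃ F, F =ᶠ[𝓝 y₀] f ∧ ∀ y ∈ ball y₀ (ε + n * (ε / 2)), P F y := by
    intro n
    induction n with
    | zero => simpa using hext f y₀ hf
    | succ n ih =>
      obtain ⟨F, h1, h2⟩ := ih
      obtain ⟨F', h1', h2'⟩ := step _ (by positivity) F h2
      refine ⟨F', h1'.trans h1, fun y hy ↦ h2' y ?_⟩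
      push_cast at hy
      rwa [add_assoc, ← add_one_mul]
  choose F hF1 hF2 using all
  have hN : ∀ y, ∃ n : ℕ, y ∈ ball y₀ (ε + n * (ε / 2)) := fun y ↦ by
    obtain ⟨n, hn⟩ := exists_nat_gt (dist y y₀ / (ε / 2))
    rw [div_lt_iff₀ (half_pos hε)] at hn
    exact ⟨n, mem_ball.2 (by linarith)⟩
  choose N hN using hN
  -- All `F n` have the same germ at `y₀`, so any two agree on their common ball and the choice of
  -- `N y` does not matter.
  have key : ∀ y, (fun y ↦ F (N y) y) =ᶠ[𝓝 y] F (N y) := fun y ↦ by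
    filter_upwards [isOpen_ball.mem_nhds (hN y)] with y' hy'
    exact (huniq _ (hpre _ _ _ _) _ _ (fun z hz ↦ hF2 (N y') z hz.1)
      (fun z hz ↦ hF2 (N y) z hz.2) y₀
      ⟨mem_ball_self (by positivity), mem_ball_self (by positivity)⟩
      ((hF1 _).trans (hF1 _).symm) y' ⟨hN y', hy'⟩).eq_of_nhds
  exact ⟨fun y ↦ F (N y) y, (key y₀).trans (hF1 _), fun y ↦ hcongr _ _ _ (key y) (hF2 _ _ (hN y))⟩

end Continuation

/-! ### The developing map and the covering of a closed manifold -/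

section Developing

open Filter Topology Metric

local notation "E4" => EuclideanSpace ℝ (Fin 4)
local notation "E3" => EuclideanSpace ℝ (Fin 3)

variable {M : Type*} [TopologicalSpace M] [ChartedSpace E3 M] [IsManifold (𝓡 3) ∞ M]
  {g : SmoothMetric 3 M} {ξ : ∀ x : M, TangentSpace (𝓡 3) x}

/-- Near `p`, the map `f : S³ → M` is the inverse of a standard chart. -/
def IsDevelopingAt (g : SmoothMetric 3 M) (ξ : ∀ x : M, TangentSpace (𝓡 3) x) (f : S3 → M)
    (p : S3) : Prop :=
  ∃ Φ, IsStandardChart g ξ Φ ∧ p ∈ Φ.target ∧ f =ᶠ[𝓝 p] Φ.symm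

theorem IsDevelopingAt.congr {f h : S3 → M} {p : S3} (hh : IsDevelopingAt g ξ h p)
    (e : f =ᶠ[𝓝 p] h) : IsDevelopingAt g ξ f p := by
  obtain ⟨Φ, h1, h2, h3⟩ := hh
  exact ⟨Φ, h1, h2, e.trans h3⟩

theorem IsStandardChart.isDevelopingAt {Φ : OpenPartialHomeomorph M S3}
    (hΦ : IsStandardChart g ξ Φ) {p : S3} (hp : p ∈ Φ.target) : IsDevelopingAt g ξ Φ.symm p :=
  ⟨Φ, hΦ, hp, .rfl⟩

theorem IsDevelopingAt.continuousAt {f : S3 → M} {p : S3} (hf : IsDevelopingAt g ξ f p) :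
    ContinuousAt f p := by
  obtain ⟨Φ, -, h2, h3⟩ := hf
  exact (Φ.continuousAt_symm h2).congr h3.symm

/-- Near `p` the two maps differ by a linear isometry `R`. They agree near some `q` close to `p`, so
`R` fixes an open set of the sphere and is the identity there, hence everywhere. -/
theorem IsDevelopingAt.eventuallyEq_of_mem_closure {f h : S3 → M} {p : S3}
    (hf : IsDevelopingAt g ξ f p) (hh : IsDevelopingAt g ξ h p) (hp : f p = h p)
    (hcl : p ∈ closure {q | f =ᶠ[𝓝 q] h}) : f =ᶠ[𝓝 p] h := by
  obtain ⟨Φ, hΦ, hpΦ, hf⟩ := hf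
  obtain ⟨Ψ, hΨ, hpΨ, hh⟩ := hh
  have e : Φ.symm p = Ψ.symm p := by rw [← hf.eq_of_nhds, hp, hh.eq_of_nhds]
  have hpΨ' : Φ.symm p ∈ Ψ.source := e ▸ Ψ.map_target hpΨ
  obtain ⟨R, -, hR⟩ := hΦ.exists_transition_eq hΨ hpΦ hpΨ'
  have ev := ((hf.eventuallyEq_nhds.and hh.eventuallyEq_nhds).and hR.eventuallyEq_nhds).and
    (Ψ.open_target.eventually_mem hpΨ)
  obtain ⟨q, hq, ⟨⟨hfq, hhq⟩, hRq⟩, hqΨ⟩ :=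
    ((mem_closure_iff_frequently.1 hcl).and_eventually ev).exists
  have hid : ∀ᶠ q' in 𝓝 q, sphereHomeo R q' = q' := by
    filter_upwards [hq, hfq, hhq, hRq, Ψ.open_target.mem_nhds hqΨ] with q' h1 h2 h3 h4 h5
    rw [← h4, Function.comp_apply, ← h2, h1, h3, Ψ.right_inv h5]
  have hid := sphereHomeo_eq_self hid
  have hs : ∀ᶠ q in 𝓝 p, Φ.symm q ∈ Ψ.source :=
    (Φ.continuousAt_symm hpΦ).eventually (Ψ.open_source.mem_nhds hpΨ')
  filter_upwards [hf, hh, hR, hs] with q h1 h2 h3 h4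
  rw [h1, h2]
  rw [hid, Function.comp_apply] at h3
  rw [← Ψ.left_inv h4, h3]

/-- Developing maps satisfy unique continuation. -/
theorem IsDevelopingAt.unique_continuation [T2Space M] {s : Set S3} (hs : IsPreconnected s)
    {f h : S3 → M} (hf : ∀ p ∈ s, IsDevelopingAt g ξ f p) (hh : ∀ p ∈ s, IsDevelopingAt g ξ h p)
    {p₀ : S3} (hp₀ : p₀ ∈ s) (h₀ : f =ᶠ[𝓝 p₀] h) : ∀ p ∈ s, f =ᶠ[𝓝 p] h := by
  refine hs.subset_of_closure_inter_subset (u := {p | f =ᶠ[𝓝 p] h}) isOpen_setOfPred_eventually_nhds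
    ⟨p₀, hp₀, h₀⟩ fun p hp ↦ ?_
  refine (hf p hp.2).eventuallyEq_of_mem_closure (hh p hp.2) ?_ hp.1
  refine tendsto_nhds_unique_of_frequently_eq (hf p hp.2).continuousAt (hh p hp.2).continuousAt ?_
  exact (mem_closure_iff_frequently.1 hp.1).mono fun q hq ↦ hq.eq_of_nhds

/-- A Lebesgue number argument: near each point half the radius of a ball in the target works, and
compactness makes this uniform. -/
theorem exists_uniform_standardChart [CompactSpace M]
    (hloc : ∀ x : M, ∃ Φ, IsStandardChart g ξ Φ ∧ x ∈ Φ.source) :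
    ∃ ε > 0, ∀ x : M, ∃ Φ, IsStandardChart g ξ Φ ∧ x ∈ Φ.source ∧ ball (Φ x) ε ⊆ Φ.target := by
  suffices h : ∃ ε > 0, ∀ x ∈ (Set.univ : Set M), ∃ Φ, IsStandardChart g ξ Φ ∧ x ∈ Φ.source ∧
      ball (Φ x) ε ⊆ Φ.target by simpa using h
  refine isCompact_univ.induction_on (p := fun s : Set M ↦ ∃ ε > 0, ∀ x ∈ s, ∃ Φ,
    IsStandardChart g ξ Φ ∧ x ∈ Φ.source ∧ ball (Φ x) ε ⊆ Φ.target) ?_ ?_ ?_ ?_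
  · exact ⟨1, one_pos, fun x hx ↦ hx.elim⟩
  · rintro s t hst ⟨ε, hε, h⟩
    exact ⟨ε, hε, fun x hx ↦ h x (hst hx)⟩
  · rintro s t ⟨ε, hε, h⟩ ⟨δ, hδ, h'⟩
    refine ⟨min ε δ, lt_min hε hδ, ?_⟩
    rintro x (hx | hx)
    · obtain ⟨Φ, h1, h2, h3⟩ := h x hx
      exact ⟨Φ, h1, h2, (ball_subset_ball (min_le_left _ _)).trans h3⟩
    · obtain ⟨Φ, h1, h2, h3⟩ := h' x hx
      exact ⟨Φ, h1, h2, (ball_subset_ball (min_le_right _ _)).trans h3⟩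
  · intro x _
    obtain ⟨Φ, h1, h2⟩ := hloc x
    obtain ⟨ε, hε, hB⟩ := Metric.isOpen_iff.1 Φ.open_target _ (Φ.map_source h2)
    refine ⟨_, mem_nhdsWithin_of_mem_nhds (inter_mem (Φ.open_source.mem_nhds h2)
      ((Φ.continuousAt h2).preimage_mem_nhds (ball_mem_nhds _ (half_pos hε)))), ε / 2, half_pos hε,
      fun y hy ↦ ⟨Φ, h1, hy.1, (ball_subset_ball' ?_).trans hB⟩⟩
    have : dist (Φ y) (Φ x) < ε / 2 := hy.2
    linarith

/-- On a compact manifold, germs of developing maps extend to balls of a fixed radius. -/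
theorem IsDevelopingAt.exists_extension {ε : ℝ}
    (hε : ∀ x : M, ∃ Φ, IsStandardChart g ξ Φ ∧ x ∈ Φ.source ∧ ball (Φ x) ε ⊆ Φ.target)
    {f : S3 → M} {p : S3} (hf : IsDevelopingAt g ξ f p) :
    ∃ F, F =ᶠ[𝓝 p] f ∧ ∀ q ∈ ball p ε, IsDevelopingAt g ξ F q := by
  obtain ⟨Φ, hΦ, hp, hfΦ⟩ := hf
  obtain ⟨Ψ, hΨ, hpΨ, hB⟩ := hε (Φ.symm p)
  obtain ⟨R, hR, hRe⟩ := hΦ.exists_transition_eq hΨ hp hpΨ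
  have hR' : ∀ w, mulI (R.symm w) = R.symm (mulI w) := fun w ↦ by
    apply R.injective
    rw [← hR, R.apply_symm_apply, R.apply_symm_apply]
  -- Correcting `Ψ` by `R⁻¹` makes it match `Φ` near `p`. As `R` is an isometry, the ball of radius
  -- `ε` about `p` stays in the target.
  have hΨ' := hΨ.trans_sphereHomeo hR'
  have hsymm : ∀ q, (Ψ.trans (sphereHomeo R.symm).toOpenPartialHomeomorph).symm q =
      Ψ.symm (sphereHomeo R q) := fun q ↦ rfl
  refine ⟨_, ?_, fun q hq ↦ hΨ'.isDevelopingAt ?_⟩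
  · have hs : ∀ᶠ q in 𝓝 p, Φ.symm q ∈ Ψ.source :=
      (Φ.continuousAt_symm hp).eventually (Ψ.open_source.mem_nhds hpΨ)
    filter_upwards [hfΦ, hRe, hs] with q h1 h2 h3
    rw [hsymm, ← h2, Function.comp_apply, Ψ.left_inv h3, h1]
  · have h1 : sphereHomeo R q ∈ Ψ.target := by
      refine hB ?_
      have h2 : Ψ (Φ.symm p) = sphereHomeo R p := hRe.eq_of_nhds
      rw [mem_ball, h2]
      exact (R.isometry.dist_eq (q : E4) p).trans_lt hq
    rw [OpenPartialHomeomorph.trans_target]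
    exact ⟨Set.mem_univ _, h1⟩

theorem dist_stereographic'_symm_le (v : S3) (x y : E3) :
    dist ((stereographic' 3 v).symm x) ((stereographic' 3 v).symm y) ≤ dist x y := by
  obtain ⟨L, hL, hL'⟩ := exists_stereographic'_symm_eq v
  rw [Subtype.dist_eq, hL', hL']
  exact dist_stereoInv_le (norm_eq_of_mem_sphere v) hL x y

/-- Stereographic projection from `v` identifies the complement with `ℝ³`, where
`exists_continuation` applies; the inverse projection does not increase distances, so `ε` remains an
extension radius. -/
theorem IsDevelopingAt.exists_on_compl_singleton [T2Space M] {ε : ℝ} (hε0 : 0 < ε)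
    (hε : ∀ x : M, ∃ Φ, IsStandardChart g ξ Φ ∧ x ∈ Φ.source ∧ ball (Φ x) ε ⊆ Φ.target)
    {f : S3 → M} {p v : S3} (hf : IsDevelopingAt g ξ f p) (hv : p ≠ v) :
    ∃ F, F =ᶠ[𝓝 p] f ∧ ∀ q, q ≠ v → IsDevelopingAt g ξ F q := by
  set e := stereographic' 3 v with he
  have hsrc : ∀ q, q ∈ e.source ↔ q ≠ v := fun q ↦ by rw [he, stereographic'_source]; rfl
  have htgt : ∀ y, y ∈ e.target := fun y ↦ by rw [he, stereographic'_target]; trivial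
  have hc : Continuous e.symm := continuous_stereographic'_symm v
  have push : ∀ {f h : E3 → M} {y}, f =ᶠ[𝓝 y] h → f ∘ e =ᶠ[𝓝 (e.symm y)] h ∘ e := by
    intro f h y hfh
    have h1 : Tendsto e (𝓝 (e.symm y)) (𝓝 y) := by
      have := e.continuousAt (e.map_target (htgt y))
      rwa [ContinuousAt, e.right_inv (htgt y)] at this
    exact hfh.comp_tendsto h1
  have pull : ∀ {f h : S3 → M} {y}, f =ᶠ[𝓝 (e.symm y)] h → f ∘ e.symm =ᶠ[𝓝 y] h ∘ e.symm :=
    fun hfh ↦ hfh.comp_tendsto hc.continuousAt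
  have cancel : ∀ f : E3 → M, (f ∘ e) ∘ e.symm = f := fun f ↦ funext fun y ↦ by
    simp [e.right_inv (htgt y)]
  have cancel' : ∀ (f : S3 → M) {q}, q ≠ v → (f ∘ e.symm) ∘ e =ᶠ[𝓝 q] f := fun f q hq ↦ by
    filter_upwards [e.open_source.mem_nhds ((hsrc q).2 hq)] with q' hq'
    simp [e.left_inv hq']
  have hne : ∀ y, e.symm y ≠ v := fun y ↦ (hsrc _).1 (e.map_target (htgt y))
  have hy₀ : e.symm (e p) = p := e.left_inv ((hsrc p).2 hv)
  obtain ⟨F, hF1, hF2⟩ := exists_continuation (E := E3) (α := M)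
    (P := fun f y ↦ IsDevelopingAt g ξ (f ∘ e) (e.symm y))
    (fun f h y hfh hh ↦ hh.congr (push hfh))
    (fun s hs f h hf hh y₀ hy₀ h₀ y hy ↦ by
      have h1 := IsDevelopingAt.unique_continuation (hs.image _ hc.continuousOn)
        (by rintro _ ⟨y, hy, rfl⟩; exact hf y hy) (by rintro _ ⟨y, hy, rfl⟩; exact hh y hy)
        (Set.mem_image_of_mem e.symm hy₀) (push h₀) _ (Set.mem_image_of_mem e.symm hy)
      have h2 := pull h1
      rwa [cancel, cancel] at h2) hε0
    (fun f y hf ↦ by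
      obtain ⟨F, hF1, hF2⟩ := hf.exists_extension hε
      refine ⟨F ∘ e.symm, ?_, fun z hz ↦ (hF2 _ ?_).congr (cancel' F (hne z))⟩
      · have := pull hF1
        rwa [cancel] at this
      · exact mem_ball.2 ((dist_stereographic'_symm_le v z y).trans_lt hz))
    (f := f ∘ e.symm) (y₀ := e p) (by
      rw [hy₀]
      exact hf.congr (cancel' f hv))
  refine ⟨F ∘ e, ?_, fun q hq ↦ ?_⟩
  · have := push hF1
    rw [hy₀] at this
    exact this.trans (cancel' f hv)
  · have := hF2 (e q)
    rwa [e.left_inv ((hsrc q).2 hq)] at this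

/-- The overlap of two punctured spheres; in stereographic coordinates it is `ℝ³`, minus a point if
`v' ≠ v`. -/
theorem isPreconnected_compl_pair (v v' : S3) : IsPreconnected ({v, v'}ᶜ : Set S3) := by
  set e := stereographic' 3 v with he
  by_cases hv : v' = v
  · have h : ({v, v'}ᶜ : Set S3) = e.symm '' Set.univ := by
      rw [hv, Set.pair_eq_singleton, ← stereographic'_source (n := 3) v, ← stereographic'_target (n := 3) v]
      exact e.symm.image_source_eq_target.symm
    rw [h]
    exact isPreconnected_univ.image _ (continuous_stereographic'_symm v).continuousOn
  · have hv' : v' ∈ e.source := by rw [he, stereographic'_source]; exact hv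
    have h : ({v, v'}ᶜ : Set S3) = e.symm '' {e v'}ᶜ := by
      ext q
      simp only [Set.mem_compl_iff, Set.mem_insert_iff, Set.mem_singleton_iff, Set.mem_image,
        not_or]
      constructor
      · rintro ⟨h1, h2⟩
        have hq : q ∈ e.source := by rw [he, stereographic'_source]; exact h1
        exact ⟨e q, fun h ↦ h2 (e.injOn hq hv' h), e.left_inv hq⟩
      · rintro ⟨y, hy, rfl⟩
        have hy' : y ∈ e.target := by rw [he, stereographic'_target]; trivial
        refine ⟨?_, fun h ↦ hy ?_⟩
        · have := e.map_target hy'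
          rw [he, stereographic'_source] at this
          exact this
        · rw [← h, e.right_inv hy']
    rw [h]
    refine (isConnected_compl_singleton_of_one_lt_rank ?_ _).isPreconnected.image _
      (continuous_stereographic'_symm v).continuousOn
    rw [← Module.finrank_eq_rank]
    simp

/-- A germ of a developing map extends to the whole sphere. -/
theorem IsDevelopingAt.exists_global [T2Space M] [CompactSpace M]
    (hloc : ∀ x : M, ∃ Φ, IsStandardChart g ξ Φ ∧ x ∈ Φ.source) {f : S3 → M} {p : S3}
    (hf : IsDevelopingAt g ξ f p) : ∃ F, ∀ q, IsDevelopingAt g ξ F q := by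
  classical
  obtain ⟨ε, hε0, hε⟩ := exists_uniform_standardChart hloc
  -- Orthogonality to `p` keeps both punctures `v` and `-v` away from `p`.
  obtain ⟨v, hv⟩ : ∃ v : S3, inner ℝ (v : E4) (p : E4) = 0 := by
    obtain ⟨a, ha, ha', -⟩ := exists_unit_orthogonal_four (p : E4) 0
    refine ⟨⟨a, ?_⟩, ha'⟩
    rw [mem_sphere_zero_iff_norm, norm_eq_sqrt_real_inner, ha, Real.sqrt_one]
  have hpp : inner ℝ (p : E4) (p : E4) = 1 := by
    rw [real_inner_self_eq_norm_sq, norm_eq_of_mem_sphere, one_pow]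
  have h1 : p ≠ v := by
    rintro rfl
    linarith
  have h2 : p ≠ -v := by
    intro h
    have h3 : (p : E4) = -(v : E4) := congrArg Subtype.val h
    rw [show (v : E4) = -(p : E4) by rw [h3, neg_neg], inner_neg_left] at hv
    linarith
  have h3 : v ≠ -v := ne_neg_of_mem_unit_sphere ℝ v
  obtain ⟨F, hF, hF'⟩ := hf.exists_on_compl_singleton hε0 hε h1
  obtain ⟨H, hH, hH'⟩ := hf.exists_on_compl_singleton hε0 hε h2
  have agree := IsDevelopingAt.unique_continuation (isPreconnected_compl_pair v (-v))
    (f := F) (h := H) (fun q hq ↦ hF' q fun h ↦ hq (by simp [h]))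
    (fun q hq ↦ hH' q fun h ↦ hq (by simp [h])) (p₀ := p) (by simp [h1, h2]) (hF.trans hH.symm)
  -- `F` is only wrong at `v`, where the value of `H` is used; the two agree off both punctures, so
  -- near `v` the glued map is `H`.
  refine ⟨fun q ↦ if q = v then H q else F q, fun q ↦ ?_⟩
  by_cases hq : q = v
  · subst hq
    refine (hH' q h3).congr ?_
    filter_upwards [isOpen_compl_singleton.mem_nhds (show q ∈ ({-q} : Set S3)ᶜ from h3)] with q' hq'
    by_cases h : q' = q
    · simp [h]
    · rw [if_neg h]
      exact (agree q' (by simpa [h] using hq')).eq_of_nhds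
  · refine (hF' q hq).congr ?_
    filter_upwards [isOpen_compl_singleton.mem_nhds (show q ∈ ({v} : Set S3)ᶜ from hq)] with q' hq'
    exact if_neg hq'

/-- A global developing map on a closed manifold is a covering by the standard sphere. -/
theorem isCoveredByStandard_of_isDevelopingAt [T2Space M] [ConnectedSpace M] {f : S3 → M}
    (hf : ∀ p, IsDevelopingAt g ξ f p) : IsCoveredByStandard g ξ := by
  have hl : IsLocalDiffeomorph (𝓡 3) (𝓡 3) ∞ f := fun p ↦ by
    obtain ⟨Φ, hΦ, hp, hfΦ⟩ := hf p
    obtain ⟨U, hU, hUo, hpU⟩ := _root_.eventually_nhds_iff.1 hfΦ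
    have hr := hΦ.isPartialDiffeo.symm.restrOpen hUo
    exact ⟨{ (Φ.symm.restrOpen U hUo).toPartialEquiv with
      open_source := (Φ.symm.restrOpen U hUo).open_source
      open_target := (Φ.symm.restrOpen U hUo).open_target
      contMDiffOn_toFun := hr.1
      contMDiffOn_invFun := hr.2 }, ⟨hp, hpU⟩, fun q hq ↦ hU q hq.2⟩
  have hh := hl.isLocalHomeomorph
  have hne : Nonempty S3 := ⟨⟨EuclideanSpace.single 0 1, by simp⟩⟩
  -- A local homeomorphism from the compact `S³` to a connected Hausdorff space is a covering. The
  -- image is compact and open, hence everything.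
  refine ⟨f, isLocalHomeomorph_iff_isCoveringMap.1 hh, ?_, hl, fun p ↦ ?_⟩
  · rw [← Set.range_eq_univ]
    exact IsClopen.eq_univ ⟨(isCompact_range hh.continuous).isClosed,
      hh.isOpenMap.isOpen_range⟩ (Set.range_nonempty f)
  · obtain ⟨Φ, hΦ, hp, hfΦ⟩ := hf p
    have h0 := hfΦ.eq_of_nhds
    have h1 : mfderiv (𝓡 3) (𝓡 3) f p = mfderiv (𝓡 3) (𝓡 3) Φ.symm p := hfΦ.mfderiv_eq
    rw [h1]
    constructor
    · intro u v
      rw [← hΦ.inner_symm hp u v]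
      have : ∀ x, x = Φ.symm p → ∀ a b : E3, g.inner x a b = g.inner (Φ.symm p) a b := by
        rintro _ rfl _ _
        rfl
      exact this _ h0 _ _
    · have : ∀ x, x = Φ.symm p → (ξ (Φ.symm p) : E3) = ξ x := by
        rintro _ rfl
        rfl
      exact (hΦ.field_symm hp).trans (this _ h0)

theorem IsSasakian.isCoveredByStandard [T2Space M] [CompactSpace M] [ConnectedSpace M]
    (hS : IsSasakian g ξ) (hC : IsConformallyFlat g) : IsCoveredByStandard g ξ := by
  obtain ⟨x⟩ : Nonempty M := inferInstance
  obtain ⟨Φ, hΦ, hx⟩ := hS.exists_standardChart hC x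
  obtain ⟨F, hF⟩ := (hΦ.isDevelopingAt (Φ.map_source hx)).exists_global
    (hS.exists_standardChart hC)
  exact isCoveredByStandard_of_isDevelopingAt hF

end Developing

end SasakiThree

end

/-- A conformally flat Sasakian 3-manifold is Einstein with scalar curvature `6`, is locally the
standard Sasakian `S³`, and, if closed, is covered by it. -/
theorem theorem6 {M : Type*} [TopologicalSpace M] [T2Space M]
    [ChartedSpace (EuclideanSpace ℝ (Fin 3)) M] [IsManifold (𝓡 3) ∞ M]
    (g : SasakiThree.SmoothMetric 3 M) (ξ : ∀ x : M, TangentSpace (𝓡 3) x)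
    (hS : SasakiThree.IsSasakian g ξ) (hC : SasakiThree.IsConformallyFlat g) :
    (∀ (x : M) (u v : TangentSpace (𝓡 3) x), SasakiThree.ricci g x u v = 2 * g.inner x u v) ∧
    (∀ x : M, SasakiThree.scalarCurvature g x = 6) ∧
    SasakiThree.IsLocallyStandard g ξ ∧
    (CompactSpace M → ConnectedSpace M → SasakiThree.IsCoveredByStandard g ξ) := by
  exact ⟨hS.ricci_eq hC, hS.scalarCurvature_eq hC, hS.isLocallyStandard hC,
    fun _ _ ↦ hS.isCoveredByStandard hC⟩
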